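/- **Conventions.** $\hat u(\kappa)=\int_{\mathbb R}u(x)e^{i\kappa x}\,dx$. Let $1<\alpha\le 2$, $|\theta|\le\min\{\alpha,2-\alpha\}$, $1<\mu\le2$, $0\le\nu\le1$, and put $\gamma=(1-\nu)(2-\mu)$, $\delta=\nu(2-\mu)$, $\psi(\kappa)=\psi_\alpha^\theta(\kappa)=|\kappa|^\alpha e^{i\,\mathrm{sign}(\kappa)\theta\pi/2}$. For $\sigma>0$, $(I^\sigma u)(y)=\frac1{\Gamma(\sigma)}\int_0^y (y-t)^{\sigma-1}u(t)\,dt$, and $I^0$ is the identity. The Hilfer derivative is ${}_yD^{\mu,\nu}_{0+}u=I^{\delta}\frac{d^2}{dy^2}I^{\gamma}u$. The Mittag-Leffler functions are $E_{a,b}(z)=\sum_{k\ge0}\frac{z^k}{\Gamma(ak+b)}$ and $E^{c}_{a,b}(z)=\sum_{k\ge0}\frac{(c)_k}{\Gamma(ak+b)}\frac{z^k}{k!}$, and the Prabhakar operator is $(\mathcal E^{\omega;c}_{0+;a,b}u)(y)=\int_0^y(y-\xi)^{b-1}E^{c}_{a,b}(\omega(y-\xi)^a)u(\xi)\,d\xi$.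 A function $v$ is called the Fourier transform of a function $u$ (in the sense of tempered distributions) if $\int u\,\hat\varphi\,dx=\int v\,\varphi\,d\kappa$, with both integrals absolutely convergent, for all Schwartz functions $\varphi$. Let $f,g\in L^1(\mathbb R)$ and let $\Phi$ be a complex function on $\mathbb R\times(0,\infty)$ that is integrable on $\mathbb R\times(0,Y]$ for every $Y>0$. A function $N:\mathbb R\times(0,\infty)\to\mathbb C$ is called a *solution* of $${}_xD^\alpha_\theta N(x,y)+{}_yD^{\mu,\nu}_{0+}N(x,y)=\Phi(x,y),\qquad x\in\mathbb R,\ y>0, \tag{1}$$ $$(I^{\gamma}N)(x,0+)=f(x),\quad \Big(\frac{d}{dy}I^{\gamma}N\Big)(x,0+)=g(x),\quad \lim_{x\to\pm\infty}N(x,y)=0 \tag{2}$$ if: $N$ is continuous; for all $x$ and all $y>0$ the fractional integrals in ${}_yD_{0+}^{\mu,\nu}N(x,\cdot)$ converge absolutely at $y$ and $I^{\gamma}N(x,\cdot)$ is twice differentiable at $y$; there are functions $V={}_xD^\alpha_\theta N$ and $n$ such that, for each $y>0$, $n(\cdot,y)$ is the Fourier transform of $N(\cdot,y)$ and $-\psi\,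 n(\cdot,y)$ is that of $V(\cdot,y)$, with the products $N\hat\varphi$, $n\varphi$, $V\hat\varphi$, $\psi n\varphi$ ($\varphi$ Schwartz, in the variable $x$ or $\kappa$) integrable on $\mathbb R\times(0,Y]$ for every $Y>0$; (1) holds at every point with this $V$; and (2) holds for all $x$, respectively all $y>0$. **Theorem.** (i) *Representation.* If $N$ is a solution, then for every $y>0$ the Fourier transform of $N(\cdot,y)$ is $$y^{-\gamma}E_{\mu,1-\gamma}(y^\mu\psi(\kappa))\hat f(\kappa)+y^{1-\gamma}E_{\mu,2-\gamma}(y^\mu\psi(\kappa))\hat g(\kappa)+\big(\mathcal E^{\psi(\kappa);1}_{0+;\mu,\mu}\hat\Phi(\kappa,\cdot)\big)(y).$$ For every $y>0$ for which the functions $E_{\mu,1-\gamma}(y^\mu\psi)\hat f$, $E_{\mu,2-\gamma}(y^\mu\psi)\hat g$ and $(\mathcal E^{\psi;1}_{0+;\mu,\mu}\hat\Phi)(\cdot,y)$ of $\kappa$ are integrable over $\mathbb R$, one has for all $x\in\mathbb R$ $$\begin{aligned}N(x,y)&=\frac{y^{-\gamma}}{2\pi}\int_{\mathbb R}E_{\mu,1-\gamma}(y^\mu\psi(\kappa))\hat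 f(\kappa)e^{-i\kappa x}d\kappa+\frac{y^{1-\gamma}}{2\pi}\int_{\mathbb R}E_{\mu,2-\gamma}(y^\mu\psi(\kappa))\hat g(\kappa)e^{-i\kappa x}d\kappa\\&\quad+\frac1{2\pi}\int_{\mathbb R}\int_0^y(y-\xi)^{\mu-1}E_{\mu,\mu}((y-\xi)^\mu\psi(\kappa))\hat\Phi(\kappa,\xi)e^{-i\kappa x}\,d\xi\,d\kappa,\end{aligned}\tag{3}$$ and the last term equals $\frac1{2\pi}\int_{\mathbb R}(\mathcal E^{\psi(\kappa);1}_{0+;\mu,\mu}\hat\Phi)(\kappa,y)e^{-i\kappa x}d\kappa$. (ii) *Existence and uniqueness.* Suppose moreover that $f,g$ are continuous, that $e^{c|\kappa|^{\alpha/\mu}}\hat f$ and $e^{c|\kappa|^{\alpha/\mu}}\hat g$ are integrable for every $c>0$, and that $\Phi(x,\cdot)=I^{\delta}\chi(x,\cdot)$ on $(0,\infty)$ for all $x$, with a continuous $\chi$ on $\mathbb R\times(0,\infty)$ such that for all $c,Y>0$ there are $M$ and $b<1$ for which $\chi(\cdot,y)$ and $e^{c|\kappa|^{\alpha/\mu}}\hat\chi(\kappa,y)$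 are integrable over $\mathbb R$ with $L^1$-norms at most $My^{-b}$ for all $0<y\le Y$. Then the integrability required for (3) holds for every $y>0$, both forms of the last term in (3) agree, and $N$ is a solution if and only if (3) holds for all $x\in\mathbb R$ and $y>0$; that is, (3) is the unique solution. -/

import Mathlib

open MeasureTheory Set Filter Topology

noncomputable section

namespace FracPoisson

/-! ### Fourier transform and Riesz-Feller derivative -/

/-- Fourier transform `û(κ) = ∫ u(x) exp(iκx) dx`. -/
def fourierT (u : ℝ → ℂ) (κ : ℝ) : ℂ :=
  ∫ x : ℝ, u x * Complex.exp (Complex.I * κ * x)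

/-- Inverse Fourier transform `(2π)⁻¹ ∫ v(κ) exp(-iκx) dκ`. -/
def invFourierT (v : ℝ → ℂ) (x : ℝ) : ℂ :=
  (1 / (2 * Real.pi : ℂ)) * ∫ κ : ℝ, v κ * Complex.exp (-Complex.I * κ * x)

/-- The function `v` is the Fourier transform of the function `u` in the sense of tempered
distributions: `∫ u ℱ[φ] dx = ∫ v φ dκ` for every Schwartz function `φ`, both integrals being
absolutely convergent. -/
def IsFourierTransform (u v : ℝ → ℂ) : Prop :=
  ∀ φ : SchwartzMap ℝ ℂ,
    Integrable (fun x => u x * fourierT φ x) ∧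
    Integrable (fun κ => v κ * φ κ) ∧
    ∫ x, u x * fourierT φ x = ∫ κ, v κ * φ κ

/-- `v(·, y)` is the Fourier transform of `U(·, y)` for every `y > 0`, and the pairings with
Schwartz functions of the variable `x` (or `κ`) are summable in `y` over each `(0, Y]`. -/
def IsPartialFourierTransform (U v : ℝ → ℝ → ℂ) : Prop :=
  (∀ y : ℝ, 0 < y → IsFourierTransform (fun x => U x y) (fun κ => v κ y)) ∧
  ∀ Y : ℝ, 0 < Y → ∀ φ : SchwartzMap ℝ ℂ,
    IntegrableOn (fun p : ℝ × ℝ => U p.1 p.2 * fourierT φ p.1) (univ ×ˢ Ioc 0 Y) ∧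
    IntegrableOn (fun p : ℝ × ℝ => v p.1 p.2 * φ p.1) (univ ×ˢ Ioc 0 Y)

/-- `ψ(κ) = |κ|^α exp(i sign(κ) θπ/2)`; the Riesz-Feller derivative has symbol `-ψ`. -/
def psi (α θ κ : ℝ) : ℂ :=
  ((|κ| ^ α : ℝ) : ℂ) * Complex.exp (Complex.I * (Real.sign κ : ℂ) * (θ * Real.pi / 2))

/-- `V(·, y)` is the Riesz-Feller derivative of order `α` and skewness `θ` of `U(·, y)` for every
`y > 0`: `ℱ[V] = -ψ ℱ[U]`. -/
def IsRieszFellerDeriv (α θ : ℝ) (U V : ℝ → ℝ → ℂ) : Prop :=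
  ∃ v : ℝ → ℝ → ℂ, IsPartialFourierTransform U v ∧
    IsPartialFourierTransform V (fun κ y => -psi α θ κ * v κ y)

/-! ### Riemann-Liouville integral and Hilfer derivative -/

/-- Riemann-Liouville integral of order `σ ≥ 0` based at `0`; the identity for `σ = 0`. -/
def rlIntegral (σ : ℝ) (u : ℝ → ℂ) (y : ℝ) : ℂ :=
  if σ = 0 then u y
  else ((1 / Real.Gamma σ : ℝ) : ℂ) * ∫ t in (0 : ℝ)..y, (((y - t) ^ (σ - 1) : ℝ) : ℂ) * u t

/-- The Riemann-Liouville integral of order `σ` converges absolutely at `y`. -/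
def RLConverges (σ : ℝ) (u : ℝ → ℂ) (y : ℝ) : Prop :=
  σ = 0 ∨ IntervalIntegrable (fun t => (((y - t) ^ (σ - 1) : ℝ) : ℂ) * u t) volume 0 y

/-- Hilfer derivative of order `μ` and type `ν` based at `0`:
`I^{ν(n-μ)} (d/dy)^n I^{(1-ν)(n-μ)} u` with `n - 1 < μ ≤ n`. -/
def hilferDeriv (μ ν : ℝ) (u : ℝ → ℂ) : ℝ → ℂ :=
  rlIntegral (ν * (⌈μ⌉₊ - μ))
    (iteratedDeriv ⌈μ⌉₊ (rlIntegral ((1 - ν) * (⌈μ⌉₊ - μ)) u))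

/-- All integrals and derivatives in the definition of the Hilfer derivative exist on `(0, ∞)`. -/
def HilferDifferentiable (μ ν : ℝ) (u : ℝ → ℂ) : Prop :=
  ∀ y : ℝ, 0 < y →
    RLConverges ((1 - ν) * (⌈μ⌉₊ - μ)) u y ∧
    (∀ k : ℕ, k < ⌈μ⌉₊ →
      DifferentiableAt ℝ (iteratedDeriv k (rlIntegral ((1 - ν) * (⌈μ⌉₊ - μ)) u)) y) ∧
    RLConverges (ν * (⌈μ⌉₊ - μ))
      (iteratedDeriv ⌈μ⌉₊ (rlIntegral ((1 - ν) * (⌈μ⌉₊ - μ)) u)) y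

/-! ### Mittag-Leffler functions and the Prabhakar operator -/

/-- Two-parameter Mittag-Leffler function. -/
def mittagLeffler (a b : ℝ) (z : ℂ) : ℂ :=
  ∑' k : ℕ, z ^ k / (Real.Gamma (a * k + b) : ℂ)

/-- Three-parameter (Prabhakar) Mittag-Leffler function. -/
def mittagLeffler3 (a b c : ℝ) (z : ℂ) : ℂ :=
  ∑' k : ℕ, ((((ascPochhammer ℝ k).eval c : ℝ) : ℂ) / (Real.Gamma (a * k + b) : ℂ)) *
    (z ^ k / (k.factorial : ℂ))

/-- Prabhakar integral operator
`∫₀^y (y-ξ)^{b-1} E_{a,b}^c(ω (y-ξ)^a) u(ξ) dξ`. -/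
def prabhakar (a b c : ℝ) (ω : ℂ) (u : ℝ → ℂ) (y : ℝ) : ℂ :=
  ∫ ξ in (0 : ℝ)..y, (((y - ξ) ^ (b - 1) : ℝ) : ℂ) *
    mittagLeffler3 a b c (ω * (((y - ξ) ^ a : ℝ) : ℂ)) * u ξ

/-! ### The boundary value problem -/

/-- `N` solves `D_x N + D_y N = Φ` on `ℝ × (0, ∞)`, with the Riesz-Feller derivative in `x` and the
Hilfer derivative in `y`, with boundary data `f`, `g` at `y = 0+` and decay as `x → ±∞`. -/
structure IsSolution (α θ μ ν : ℝ) (f g : ℝ → ℂ) (Φ : ℝ → ℝ → ℂ) (N : ℝ → ℝ → ℂ) : Prop where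
  continuous : ContinuousOn (fun p : ℝ × ℝ => N p.1 p.2) (univ ×ˢ Ioi 0)
  differentiable : ∀ x, HilferDifferentiable μ ν (N x)
  equation : ∃ V : ℝ → ℝ → ℂ, IsRieszFellerDeriv α θ N V ∧
    ∀ x y : ℝ, 0 < y → V x y + hilferDeriv μ ν (N x) y = Φ x y
  boundary_f : ∀ x,
    Tendsto (rlIntegral ((1 - ν) * (2 - μ)) (N x)) (𝓝[>] 0) (𝓝 (f x))
  boundary_g : ∀ x,
    Tendsto (deriv (rlIntegral ((1 - ν) * (2 - μ)) (N x))) (𝓝[>] 0) (𝓝 (g x))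
  decay_top : ∀ y : ℝ, 0 < y → Tendsto (fun x => N x y) atTop (𝓝 0)
  decay_bot : ∀ y : ℝ, 0 < y → Tendsto (fun x => N x y) atBot (𝓝 0)

/-! ### The three terms of the solution in Fourier space -/

/-- `E_{μ,1-(1-ν)(2-μ)}(y^μ ψ(κ)) f̂(κ)`. -/
def termF (α θ μ ν : ℝ) (f : ℝ → ℂ) (y κ : ℝ) : ℂ :=
  mittagLeffler μ (1 - (1 - ν) * (2 - μ)) (((y ^ μ : ℝ) : ℂ) * psi α θ κ) * fourierT f κ

/-- `E_{μ,2-(1-ν)(2-μ)}(y^μ ψ(κ)) ĝ(κ)`. -/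
def termG (α θ μ ν : ℝ) (g : ℝ → ℂ) (y κ : ℝ) : ℂ :=
  mittagLeffler μ (2 - (1 - ν) * (2 - μ)) (((y ^ μ : ℝ) : ℂ) * psi α θ κ) * fourierT g κ

/-- The Prabhakar operator with `ω = ψ(κ)` applied to `Φ̂(κ, ·)`, at `y`. -/
def termPhi (α θ μ : ℝ) (Φ : ℝ → ℝ → ℂ) (y κ : ℝ) : ℂ :=
  prabhakar μ μ 1 (psi α θ κ) (fun ξ => fourierT (fun x => Φ x ξ) κ) y

/-- The three integrals over `κ` in the solution formula converge absolutely at height `y`. -/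
def FormulaConverges (α θ μ ν : ℝ) (f g : ℝ → ℂ) (Φ : ℝ → ℝ → ℂ) (y : ℝ) : Prop :=
  Integrable (termF α θ μ ν f y) ∧ Integrable (termG α θ μ ν g y) ∧
    Integrable (termPhi α θ μ Φ y)

/-- The solution formula, with the source term written as an explicit double integral. -/
def formula (α θ μ ν : ℝ) (f g : ℝ → ℂ) (Φ : ℝ → ℝ → ℂ) (x y : ℝ) : ℂ :=
  ((y ^ (-((1 - ν) * (2 - μ))) : ℝ) : ℂ) / (2 * Real.pi) *
      (∫ κ : ℝ, mittagLeffler μ (1 - (1 - ν) * (2 - μ)) (((y ^ μ : ℝ) : ℂ) * psi α θ κ) *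
        fourierT f κ * Complex.exp (-Complex.I * κ * x)) +
    ((y ^ (1 - (1 - ν) * (2 - μ)) : ℝ) : ℂ) / (2 * Real.pi) *
      (∫ κ : ℝ, mittagLeffler μ (2 - (1 - ν) * (2 - μ)) (((y ^ μ : ℝ) : ℂ) * psi α θ κ) *
        fourierT g κ * Complex.exp (-Complex.I * κ * x)) +
    1 / (2 * Real.pi) *
      ∫ κ : ℝ, ∫ ξ in (0 : ℝ)..y, (((y - ξ) ^ (μ - 1) : ℝ) : ℂ) *
        mittagLeffler μ μ ((((y - ξ) ^ μ : ℝ) : ℂ) * psi α θ κ) *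
        fourierT (fun x' => Φ x' ξ) κ * Complex.exp (-Complex.I * κ * x)

/-- The solution formula, with the source term written through the Prabhakar operator. -/
def formulaPrabhakar (α θ μ ν : ℝ) (f g : ℝ → ℂ) (Φ : ℝ → ℝ → ℂ) (x y : ℝ) : ℂ :=
  ((y ^ (-((1 - ν) * (2 - μ))) : ℝ) : ℂ) * invFourierT (termF α θ μ ν f y) x +
    ((y ^ (1 - (1 - ν) * (2 - μ)) : ℝ) : ℂ) * invFourierT (termG α θ μ ν g y) x +
    invFourierT (termPhi α θ μ Φ y) x

/-- Data for which the formula makes sense at every height and defines a classical solution.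
The Cauchy problem is ill-posed: the Mittag-Leffler factors grow like `exp(c |κ|^{α/μ})`, so the
transforms of the data must absorb every such factor. Moreover `Φ(x, ·)` must lie in the range of
`I^{ν(2-μ)}`, as the Hilfer derivative does (no restriction if `ν = 0` or `μ = 2`). -/
structure AdmissibleData (α μ ν : ℝ) (f g : ℝ → ℂ) (Φ : ℝ → ℝ → ℂ) : Prop where
  continuous_f : Continuous f
  continuous_g : Continuous g
  weight_f : ∀ c : ℝ, 0 < c →
    Integrable (fun κ : ℝ => (Real.exp (c * |κ| ^ (α / μ)) : ℂ) * fourierT f κ)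
  weight_g : ∀ c : ℝ, 0 < c →
    Integrable (fun κ : ℝ => (Real.exp (c * |κ| ^ (α / μ)) : ℂ) * fourierT g κ)
  source : ∃ χ : ℝ → ℝ → ℂ,
    ContinuousOn (fun p : ℝ × ℝ => χ p.1 p.2) (univ ×ˢ Ioi 0) ∧
    (∀ x y : ℝ, 0 < y → Φ x y = rlIntegral (ν * (2 - μ)) (χ x) y) ∧
    ∀ c Y : ℝ, 0 < c → 0 < Y → ∃ M b : ℝ, b < 1 ∧ ∀ y ∈ Ioc 0 Y,
      Integrable (fun x => χ x y) ∧ ∫ x, ‖χ x y‖ ≤ M * y ^ (-b) ∧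
      Integrable (fun κ : ℝ =>
        (Real.exp (c * |κ| ^ (α / μ)) : ℂ) * fourierT (fun x => χ x y) κ) ∧
      ∫ κ : ℝ, ‖(Real.exp (c * |κ| ^ (α / μ)) : ℂ) * fourierT (fun x => χ x y) κ‖
        ≤ M * y ^ (-b)

end FracPoisson

end

/-!
Write `k_b(s) = s^{b-1}/Γ(b)` for the Riemann-Liouville kernel, `e_b(s) = s^{b-1} E_{μ,b}(ψ s^μ)` for
the Mittag-Leffler kernel at a frequency with symbol `ψ = ψ(κ)`, `*` for convolution on `(0, y)`, and
`γ = (1-ν)(2-μ)`, `δ = ν(2-μ)`, so that `γ + δ = 2 - μ`. Two identities carry the whole argument: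
`k_σ * e_b = e_{b+σ}` (termwise beta integrals, `vconv_rlKernel_mlKernel`) and the resolvent identity
`e_b = k_b + ψ e_{b+μ}` (a shift of the index in the series, `mlKernel_eq_add`), together with the
associativity of convolution (`vconv_assoc`).

*Representation.* At a fixed `x`, integrating the equation twice and then undoing `I^γ` turns it into
the Volterra equation `N = k_{1-γ} f + k_{2-γ} g + k_μ * (Φ - V)` (`eq_volterra_of_hilfer`). It holds
for almost every `x` and at *every* height `y`, because `k_μ` is continuous and vanishes at `0`. Both
sides can therefore be paired with a Schwartz function at every height, and the transform `n` of `N`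
satisfies `n = k_{1-γ} f̂ + k_{2-γ} ĝ + k_μ * (Φ̂ + ψ n)` (`transform_volterra`). Convolution with
`e_μ` solves this equation, since `ψ e_μ * k_b = e_b - k_b` (`eq_mlKernel_of_volterra`). If the
resulting transform is integrable, Fourier inversion and the continuity of `N(·, y)` give the formula
at every `x`.

*Existence.* The bound `|E_{μ,b}(z)| ≤ C exp(3|z|^{1/μ})` shows that the Mittag-Leffler factors are
absorbed by the exponential weights on the data. With `χ` the density of the source, `Φ = I^δ χ`, put
`m = e_{μ-1} f̂ + e_μ ĝ + e_μ * χ̂`. The transform of the formula is `n = I^δ m`, and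
`I^γ n = f̂ + y ĝ + I²(χ̂ + ψ m)` (`spectralSum_one_two`). As fractional integration commutes with the
inverse Fourier transform, `I^γ N = f + y g + I² H` with `H = χ + ℱ⁻¹[ψ m]`, a function that is
continuous for `y > 0` and integrable near `0`; this yields the two derivatives and the boundary
values. Finally `I^δ H = Φ + ℱ⁻¹[ψ n]`, which is the equation. The term `χ` is kept outside the inverse
transform because `χ̂(κ, ·)` need not be continuous.
-/


namespace FracPoisson

/-! ### The Fourier transform on the line -/

open FourierTransform in
/-- The convention of `fourierT` differs from Mathlib's by a reflection and a dilation. -/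
theorem fourierT_eq_fourier (u : ℝ → ℂ) (κ : ℝ) :
    fourierT u κ = 𝓕 u (-κ / (2 * Real.pi)) := by
  rw [Real.fourier_eq', fourierT]
  refine integral_congr_ae (Eventually.of_forall fun x => ?_)
  simp only [smul_eq_mul, RCLike.inner_apply, conj_trivial]
  rw [mul_comm]
  congr 2
  push_cast
  field_simp

open FourierTransform in
theorem invFourierT_eq_fourier (v : ℝ → ℂ) (x : ℝ) :
    invFourierT v x = (1 / (2 * Real.pi : ℂ)) * 𝓕 v (x / (2 * Real.pi)) := by
  rw [Real.fourier_eq', invFourierT]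
  congr 1
  refine integral_congr_ae (Eventually.of_forall fun x => ?_)
  simp only [smul_eq_mul, RCLike.inner_apply, conj_trivial]
  rw [mul_comm]
  congr 2
  push_cast
  field_simp

theorem norm_exp_I_mul (κ x : ℝ) : ‖Complex.exp (Complex.I * κ * x)‖ = 1 := by
  have : Complex.I * κ * x = ((κ * x : ℝ) : ℂ) * Complex.I := by push_cast; ring
  rw [this, Complex.norm_exp_ofReal_mul_I]

theorem norm_exp_neg_I_mul (κ x : ℝ) : ‖Complex.exp (-Complex.I * κ * x)‖ = 1 := by
  have := norm_exp_I_mul (-κ) x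
  rwa [show Complex.I * ((-κ : ℝ) : ℂ) * x = -Complex.I * κ * x by push_cast; ring] at this

theorem norm_fourierT_le (u : ℝ → ℂ) (κ : ℝ) : ‖fourierT u κ‖ ≤ ∫ x, ‖u x‖ := by
  refine (norm_integral_le_integral_norm _).trans_eq ?_
  simp only [norm_mul, norm_exp_I_mul, mul_one]

theorem norm_invFourierT_le (v : ℝ → ℂ) (x : ℝ) : ‖invFourierT v x‖ ≤ ∫ κ, ‖v κ‖ := by
  rw [invFourierT, norm_mul]
  have h1 : ‖∫ κ : ℝ, v κ * Complex.exp (-Complex.I * κ * x)‖ ≤ ∫ κ, ‖v κ‖ := by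
    refine (norm_integral_le_integral_norm _).trans_eq ?_
    simp only [norm_mul, norm_exp_neg_I_mul, mul_one]
  have h2 : ‖(1 / (2 * Real.pi : ℂ))‖ ≤ 1 := by
    have : (1 / (2 * Real.pi : ℂ)) = ((1 / (2 * Real.pi) : ℝ) : ℂ) := by push_cast; rfl
    rw [this, Complex.norm_real, Real.norm_of_nonneg (by positivity), div_le_one (by positivity)]
    linarith [Real.pi_gt_three]
  calc _ ≤ 1 * ∫ κ, ‖v κ‖ := mul_le_mul h2 h1 (norm_nonneg _) zero_le_one
    _ = _ := one_mul _

open FourierTransform in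
theorem continuous_fourierT {u : ℝ → ℂ} (hu : Integrable u) : Continuous (fourierT u) := by
  have h : Continuous (𝓕 u) :=
    VectorFourier.fourierIntegral_continuous Real.continuous_fourierChar
      (innerSL ℝ).continuous₂ hu
  have : fourierT u = fun κ => 𝓕 u (-κ / (2 * Real.pi)) := funext (fourierT_eq_fourier u)
  rw [this]
  exact h.comp (by fun_prop)

open FourierTransform in
theorem continuous_invFourierT {u : ℝ → ℂ} (hu : Integrable u) : Continuous (invFourierT u) := by
  have h : Continuous (𝓕 u) :=
    VectorFourier.fourierIntegral_continuous Real.continuous_fourierChar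
      (innerSL ℝ).continuous₂ hu
  have : invFourierT u = fun x => (1 / (2 * Real.pi : ℂ)) * 𝓕 u (x / (2 * Real.pi)) :=
    funext (invFourierT_eq_fourier u)
  rw [this]
  exact continuous_const.mul (h.comp (by fun_prop))

open FourierTransform in
theorem integrable_fourierT_schwartz (φ : SchwartzMap ℝ ℂ) : Integrable (fourierT φ) := by
  have : fourierT φ = fun κ => (𝓕 φ : SchwartzMap ℝ ℂ) (κ * (-1 / (2 * Real.pi))) := by
    funext κ
    rw [fourierT_eq_fourier, SchwartzMap.fourier_coe]
    ring_nf
  rw [this]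
  exact ((𝓕 φ : SchwartzMap ℝ ℂ).integrable).comp_mul_right' (by
    have := Real.pi_pos; exact div_ne_zero (by norm_num) (by positivity))

open FourierTransform in
/-- Every Schwartz function is the transform of a Schwartz function. -/
theorem exists_schwartz_fourierT_eq (η : SchwartzMap ℝ ℂ) :
    ∃ φ : SchwartzMap ℝ ℂ, ∀ κ, fourierT φ κ = η κ := by
  have h0 : (-(2 * Real.pi)) ≠ 0 := by have := Real.pi_pos; linarith
  let L : ℝ ≃L[ℝ] ℝ := ContinuousLinearEquiv.unitsEquivAut ℝ (Units.mk0 _ h0)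
  let ζ : SchwartzMap ℝ ℂ := SchwartzMap.compCLMOfContinuousLinearEquiv ℂ L η
  refine ⟨𝓕⁻ ζ, fun κ => ?_⟩
  have h1 : (𝓕 (𝓕⁻ ζ) : SchwartzMap ℝ ℂ) = ζ := FourierTransform.fourier_fourierInv_eq ζ
  rw [fourierT_eq_fourier, ← SchwartzMap.fourier_coe, h1]
  change η (L _) = _
  congr 1
  change (-κ / (2 * Real.pi)) * (-(2 * Real.pi)) = κ
  field_simp

open FourierTransform in
theorem invFourierT_fourierT {u : ℝ → ℂ} (hc : Continuous u) (hu : Integrable u)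
    (hv : Integrable (fourierT u)) (x : ℝ) : invFourierT (fourierT u) x = u x := by
  have hpi : (2 * Real.pi) ≠ 0 := by positivity
  have hF : Integrable (𝓕 u) := by
    have h := hv.comp_mul_right' (R := -(2 * Real.pi)) (by simp)
    refine h.congr (Eventually.of_forall fun ξ => ?_)
    simp only [fourierT_eq_fourier]
    field_simp
  have h := congrFun (hc.fourierInv_fourier_eq hu hF) x
  rw [Real.fourierInv_eq'] at h
  rw [← h, invFourierT]
  have hs' := Measure.integral_comp_mul_right
    (fun κ : ℝ => fourierT u κ * Complex.exp (-Complex.I * κ * x)) (-(2 * Real.pi))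
  have habs : |(-(2 * Real.pi))⁻¹| = 1 / (2 * Real.pi) := by
    rw [inv_neg, abs_neg, abs_of_pos (by positivity), one_div]
  rw [habs, Complex.real_smul] at hs'
  have hcast : ((1 / (2 * Real.pi) : ℝ) : ℂ) = 1 / (2 * Real.pi : ℂ) := by push_cast; rfl
  rw [hcast] at hs'
  rw [← hs']
  refine integral_congr_ae (Eventually.of_forall fun ξ => ?_)
  simp only [fourierT_eq_fourier, smul_eq_mul, RCLike.inner_apply, conj_trivial]
  rw [mul_comm]
  congr 2
  · push_cast; ring
  · field_simp

open FourierTransform in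
/-- The Riemann-Lebesgue lemma. -/
theorem tendsto_invFourierT_cocompact (v : ℝ → ℂ) :
    Tendsto (invFourierT v) (cocompact ℝ) (𝓝 0) := by
  have h := Real.zero_at_infty_fourier v
  have h2 : Tendsto (fun x : ℝ => x / (2 * Real.pi)) (cocompact ℝ) (cocompact ℝ) := by
    have h0 : (2 * Real.pi)⁻¹ ≠ 0 := by positivity
    simpa [div_eq_mul_inv] using (Homeomorph.mulRight₀ _ h0).isClosedEmbedding.tendsto_cocompact
  have h3 := (h.comp h2).const_mul (1 / (2 * Real.pi : ℂ))
  rw [mul_zero] at h3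
  exact h3.congr fun x => (invFourierT_eq_fourier v x).symm

/-- Fubini for a kernel of modulus one: the general form of the multiplication formula. -/
theorem integral_mul_integral_mul_comm {f g : ℝ → ℂ} (hf : Integrable f) (hg : Integrable g)
    {E : ℝ → ℝ → ℂ} (hE : Continuous (Function.uncurry E)) (hE1 : ∀ x κ, ‖E x κ‖ = 1) :
    ∫ x : ℝ, f x * ∫ κ : ℝ, g κ * E x κ = ∫ κ : ℝ, (∫ x, f x * E x κ) * g κ := by
  have hi : Integrable (Function.uncurry fun x κ => f x * (g κ * E x κ))
      ((volume : Measure ℝ).prod volume) := by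
    have h1 : Integrable (fun p : ℝ × ℝ => f p.1 * g p.2) ((volume : Measure ℝ).prod volume) :=
      hf.mul_prod hg
    refine (h1.mul_bdd (c := 1) (g := Function.uncurry E) hE.aestronglyMeasurable
      (Eventually.of_forall fun p => (hE1 p.1 p.2).le)).congr (Eventually.of_forall fun p => ?_)
    simp only [Function.uncurry]; ring
  calc _ = ∫ x, ∫ κ, f x * (g κ * E x κ) := by simp only [integral_const_mul]
    _ = ∫ κ, ∫ x, f x * (g κ * E x κ) := integral_integral_swap hi
    _ = _ := by
      congr 1; funext κ
      rw [← integral_mul_const]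
      congr 1; funext x; ring

theorem integral_mul_fourierT {f g : ℝ → ℂ} (hf : Integrable f) (hg : Integrable g) :
    ∫ x, f x * fourierT g x = ∫ κ, fourierT f κ * g κ := by
  have := integral_mul_integral_mul_comm hf hg
    (E := fun x κ => Complex.exp (Complex.I * x * κ)) (by fun_prop) norm_exp_I_mul
  simp only [fourierT]
  rw [this]
  congr 1; funext κ; congr 2; funext x; congr 2; ring

theorem integral_invFourierT_mul_fourierT {v : ℝ → ℂ} (hv : Integrable v)
    (φ : SchwartzMap ℝ ℂ) : ∫ x, invFourierT v x * fourierT φ x = ∫ κ, v κ * φ κ := by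
  have h := integral_mul_integral_mul_comm hv (integrable_fourierT_schwartz φ)
    (E := fun x κ => Complex.exp (-Complex.I * x * κ)) (by fun_prop) norm_exp_neg_I_mul
  calc ∫ x, invFourierT v x * fourierT φ x
      = (1 / (2 * Real.pi : ℂ)) *
        ∫ κ : ℝ, (∫ x : ℝ, v x * Complex.exp (-Complex.I * x * κ)) * fourierT φ κ := by
        rw [← integral_const_mul]
        congr 1; funext x; rw [invFourierT]; ring
    _ = ∫ κ, v κ * invFourierT (fourierT φ) κ := by
        rw [← h, ← integral_const_mul]
        congr 1; funext κ
        rw [invFourierT]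
        rw [show (fun κ_1 : ℝ => fourierT (φ : ℝ → ℂ) κ_1 * Complex.exp (-Complex.I * κ_1 * κ)) =
          fun κ_1 : ℝ => fourierT (φ : ℝ → ℂ) κ_1 * Complex.exp (-Complex.I * κ * κ_1) by
            funext z; congr 2; ring]
        ring
    _ = _ := by
        congr 1; funext κ
        rw [invFourierT_fourierT φ.continuous φ.integrable (integrable_fourierT_schwartz φ)]

theorem continuous_fourierT_schwartz (φ : SchwartzMap ℝ ℂ) : Continuous (fourierT φ) :=
  continuous_fourierT φ.integrable

theorem exists_bound_schwartz (φ : SchwartzMap ℝ ℂ) : ∃ C, ∀ x, ‖φ x‖ ≤ C := by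
  obtain ⟨C, hC⟩ := φ.decay 0 0
  exact ⟨C, fun x => by simpa using hC.2 x⟩

theorem isFourierTransform_of_integrable {f : ℝ → ℂ} (hf : Integrable f) :
    IsFourierTransform f (fourierT f) := by
  intro φ
  refine ⟨?_, ?_, integral_mul_fourierT hf φ.integrable⟩
  · exact hf.mul_bdd (c := ∫ x, ‖φ x‖) (continuous_fourierT_schwartz φ).aestronglyMeasurable
      (Eventually.of_forall fun x => norm_fourierT_le _ x)
  · exact φ.integrable.bdd_mul (c := ∫ x, ‖f x‖) (continuous_fourierT hf).aestronglyMeasurable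
      (Eventually.of_forall fun x => norm_fourierT_le _ x)

theorem isFourierTransform_invFourierT {v : ℝ → ℂ} (hv : Integrable v) :
    IsFourierTransform (invFourierT v) v := by
  intro φ
  refine ⟨?_, ?_, integral_invFourierT_mul_fourierT hv φ⟩
  · exact (integrable_fourierT_schwartz φ).bdd_mul (c := ∫ x, ‖v x‖)
      (continuous_invFourierT hv).aestronglyMeasurable
      (Eventually.of_forall fun x => norm_invFourierT_le _ x)
  · obtain ⟨C, hC⟩ := exists_bound_schwartz φ
    exact hv.mul_bdd (c := C) φ.continuous.aestronglyMeasurable (Eventually.of_forall hC)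

/-- A Schwartz function equal to `1` on `[-R, R]`. -/
theorem exists_schwartz_eq_one (R : ℝ) :
    ∃ η : SchwartzMap ℝ ℂ, ∀ x ∈ Icc (-R) R, η x = 1 := by
  let b : ContDiffBump (0 : ℝ) := ⟨|R| + 1, |R| + 2, by positivity, by linarith⟩
  have hs : HasCompactSupport (fun x => ((b x : ℝ) : ℂ)) :=
    b.hasCompactSupport.comp_left (g := fun r : ℝ => (r : ℂ)) (by simp)
  refine ⟨hs.toSchwartzMap (Complex.ofRealCLM.contDiff.comp b.contDiff), fun x hx => ?_⟩
  change ((b x : ℝ) : ℂ) = 1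
  rw [b.one_of_mem_closedBall]
  · simp
  · rw [mem_closedBall_zero_iff, Real.norm_eq_abs, abs_le]
    change -(|R| + 1) ≤ x ∧ x ≤ |R| + 1
    constructor <;> linarith [hx.1, hx.2, neg_abs_le R, le_abs_self R]

/-- A function which is integrable and has integral zero against every Schwartz function is zero
almost everywhere. -/
theorem ae_eq_zero_of_forall_schwartz {d : ℝ → ℂ}
    (hi : ∀ φ : SchwartzMap ℝ ℂ, Integrable fun x => d x * φ x)
    (h0 : ∀ φ : SchwartzMap ℝ ℂ, ∫ x, d x * φ x = 0) : ∀ᵐ x, d x = 0 := by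
  refine ae_eq_zero_of_integral_contDiff_smul_eq_zero ?_ ?_
  · rw [locallyIntegrable_iff]
    intro K hK
    obtain ⟨R, hR⟩ := hK.isBounded.subset_closedBall 0
    rw [Real.closedBall_eq_Icc, zero_sub, zero_add] at hR
    obtain ⟨η, hη⟩ := exists_schwartz_eq_one R
    refine ((hi η).integrableOn (s := K)).congr_fun (fun x hx => ?_) hK.measurableSet
    simp only [hη x (hR hx), mul_one]
  · intro g hg hgs
    have hs : HasCompactSupport (fun x => ((g x : ℝ) : ℂ)) :=
      hgs.comp_left (g := fun r : ℝ => (r : ℂ)) (by simp)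
    have := h0 (hs.toSchwartzMap (Complex.ofRealCLM.contDiff.comp hg))
    rw [← this]
    congr 1; funext x
    change _ = d x * ((g x : ℝ) : ℂ)
    rw [Complex.real_smul, mul_comm]

/-- A continuous function whose tempered transform `v` is integrable is the inverse transform
of `v` at every point. -/
theorem IsFourierTransform.eq_invFourierT {u v : ℝ → ℂ} (h : IsFourierTransform u v)
    (hu : Continuous u) (hv : Integrable v) : u = invFourierT v := by
  have hw := isFourierTransform_invFourierT hv
  have hae : ∀ᵐ x, u x - invFourierT v x = 0 := by
    refine ae_eq_zero_of_forall_schwartz (fun η => ?_) fun η => ?_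
    all_goals
      obtain ⟨φ, hφ⟩ := exists_schwartz_fourierT_eq η
      simp only [← hφ, sub_mul]
    · exact (h φ).1.sub (hw φ).1
    · rw [integral_sub (h φ).1 (hw φ).1, (h φ).2.2, (hw φ).2.2, sub_self]
  refine hu.ae_eq_iff_eq volume (continuous_invFourierT hv) |>.1 ?_
  filter_upwards [hae] with x hx
  exact sub_eq_zero.1 hx

/-! ### Mittag-Leffler functions -/

/-- `x^s ≤ e^x Γ(s+1)`, from the part of Euler's integral over `(x, ∞)`. -/
theorem rpow_le_exp_mul_Gamma {s x : ℝ} (hs : 0 ≤ s) (hx : 0 < x) :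
    x ^ s ≤ Real.exp x * Real.Gamma (s + 1) := by
  have hs1 : 0 < s + 1 := by linarith
  have hint := Real.GammaIntegral_convergent hs1
  have h1 : ∫ t in Ioi x, Real.exp (-t) * x ^ s ≤ Real.Gamma (s + 1) := by
    rw [Real.Gamma_eq_integral hs1]
    calc ∫ t in Ioi x, Real.exp (-t) * x ^ s
        ≤ ∫ t in Ioi x, Real.exp (-t) * t ^ (s + 1 - 1) := by
          refine setIntegral_mono_on ((integrableOn_exp_neg_Ioi x).mul_const _)
            (hint.mono_set (Ioi_subset_Ioi hx.le)) measurableSet_Ioi fun t ht => ?_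
          have : x ^ s ≤ t ^ s := Real.rpow_le_rpow hx.le (le_of_lt ht) hs
          rw [add_sub_cancel_right]
          gcongr
      _ ≤ _ := by
          refine setIntegral_mono_set hint ?_ (Ioi_subset_Ioi hx.le).eventuallyLE
          refine (ae_restrict_iff' measurableSet_Ioi).2 (Eventually.of_forall fun t ht => ?_)
          have : (0 : ℝ) < t := ht
          positivity
  rw [integral_mul_const, integral_exp_neg_Ioi, Real.exp_neg] at h1
  rwa [inv_mul_le_iff₀ (Real.exp_pos _)] at h1

/-- Geometric domination of the Mittag-Leffler series, with the growth `exp(3|z|^{1/a})`. -/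
theorem exists_norm_mittagLeffler_term_le {a b : ℝ} (ha : 1 ≤ a) (hb : 0 < b) :
    ∃ C : ℝ, 0 < C ∧ ∀ (z : ℂ) (k : ℕ), ‖z ^ k / (Real.Gamma (a * k + b) : ℂ)‖ ≤
      C * Real.exp (3 * ‖z‖ ^ (1 / a)) * (1 / 2) ^ k := by
  have hΓ := Real.Gamma_pos_of_pos hb
  refine ⟨2 * Real.exp 3 * (1 + 1 / Real.Gamma b), by positivity, fun z k => ?_⟩
  set r : ℝ := ‖z‖ ^ (1 / a) with hr
  have hr0 : 0 ≤ r := by positivity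
  have hza : ‖z‖ = r ^ a := by
    rw [hr, ← Real.rpow_mul (norm_nonneg z), one_div, inv_mul_cancel₀ (by linarith), Real.rpow_one]
  have hΓk : 0 < Real.Gamma (a * k + b) := Real.Gamma_pos_of_pos (by positivity)
  rw [norm_div, norm_pow, Complex.norm_real, Real.norm_of_nonneg hΓk.le]
  have hexp : 2 * Real.exp 3 * (1 + 1 / Real.Gamma b) * Real.exp (3 * r) =
      2 * (1 + 1 / Real.Gamma b) * (Real.exp (1 + r) * Real.exp (2 * (1 + r))) := by
    rw [← Real.exp_add]
    have : Real.exp (1 + r + 2 * (1 + r)) = Real.exp 3 * Real.exp (3 * r) := by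
      rw [← Real.exp_add]; congr 1; ring
    rw [this]; ring
  rw [hexp]
  have hR1 : 1 ≤ Real.exp (1 + r) := Real.one_le_exp (by positivity)
  have hR2 : 1 ≤ Real.exp (2 * (1 + r)) := Real.one_le_exp (by positivity)
  rcases Nat.eq_zero_or_pos k with rfl | hk
  · simp only [pow_zero, Nat.cast_zero, mul_zero, zero_add, mul_one]
    have h1 : 1 ≤ Real.exp (1 + r) * Real.exp (2 * (1 + r)) := one_le_mul_of_one_le_of_one_le hR1 hR2
    have h2 : 0 < 1 / Real.Gamma b := by positivity
    nlinarith
  · have hk1 : (1 : ℝ) ≤ k := by exact_mod_cast hk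
    set s : ℝ := a * k + b - 1 with hs
    have hsk : (k : ℝ) - 1 ≤ s := by nlinarith
    have hs0 : 0 ≤ s := by linarith
    have hΓs : Real.Gamma (a * k + b) = Real.Gamma (s + 1) := by rw [hs]; congr 1; ring
    -- the extra factor `2` in the base produces the geometric decay; `1 + r ≥ 1` makes all powers
    -- monotone in the exponent, so that small `r` needs no separate treatment
    have hmain := rpow_le_exp_mul_Gamma hs0 (show 0 < 2 * (1 + r) by positivity)
    rw [Real.mul_rpow (by norm_num) (by positivity)] at hmain
    have h2s : (2 : ℝ) ^ k / 2 ≤ 2 ^ s := by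
      rw [show (2 : ℝ) ^ k / 2 = 2 ^ ((k : ℝ) - 1) by
        rw [Real.rpow_sub_one (by norm_num), Real.rpow_natCast]]
      exact Real.rpow_le_rpow_of_exponent_le (by norm_num) hsk
    have hpow : ‖z‖ ^ k ≤ (1 + r) * (1 + r) ^ s := by
      rw [hza, ← Real.rpow_natCast, ← Real.rpow_mul hr0]
      calc r ^ (a * k) ≤ (1 + r) ^ (a * k) :=
            Real.rpow_le_rpow hr0 (by linarith) (by positivity)
        _ ≤ (1 + r) ^ (s + 1) := Real.rpow_le_rpow_of_exponent_le (by linarith) (by rw [hs]; linarith)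
        _ = _ := by rw [Real.rpow_add_one (by positivity)]; ring
    have hexpr : 1 + r ≤ Real.exp (1 + r) := by linarith [Real.add_one_le_exp (1 + r)]
    rw [hΓs, div_le_iff₀ (by rw [← hΓs]; exact hΓk)]
    have hG : 0 < Real.Gamma (s + 1) := by rw [← hΓs]; exact hΓk
    have h3 : (1 + r) ^ s ≤ 2 * (1 / 2) ^ k * (Real.exp (2 * (1 + r)) * Real.Gamma (s + 1)) := by
      have h4 : (2 : ℝ) ^ k / 2 * (1 + r) ^ s ≤ Real.exp (2 * (1 + r)) * Real.Gamma (s + 1) :=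
        le_trans (by gcongr) hmain
      calc (1 + r) ^ s = 2 * (1 / 2) ^ k * ((2 : ℝ) ^ k / 2 * (1 + r) ^ s) := by
            rw [one_div, inv_pow]; field_simp
        _ ≤ _ := by gcongr
    calc ‖z‖ ^ k ≤ (1 + r) * (1 + r) ^ s := hpow
      _ ≤ Real.exp (1 + r) *
          (2 * (1 / 2) ^ k * (Real.exp (2 * (1 + r)) * Real.Gamma (s + 1))) := by gcongr
      _ = 1 * (2 * (Real.exp (1 + r) * Real.exp (2 * (1 + r))) * (1 / 2) ^ k *
          Real.Gamma (s + 1)) := by ring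
      _ ≤ (1 + 1 / Real.Gamma b) * (2 * (Real.exp (1 + r) * Real.exp (2 * (1 + r))) *
          (1 / 2) ^ k * Real.Gamma (s + 1)) := by
            gcongr
            have : 0 < 1 / Real.Gamma b := by positivity
            linarith
      _ = _ := by ring

theorem summable_norm_mittagLeffler {a b : ℝ} (ha : 1 ≤ a) (hb : 0 < b) (z : ℂ) :
    Summable fun k : ℕ => ‖z ^ k / (Real.Gamma (a * k + b) : ℂ)‖ := by
  obtain ⟨C, hC, h⟩ := exists_norm_mittagLeffler_term_le ha hb
  exact Summable.of_nonneg_of_le (fun _ => norm_nonneg _) (h z)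
    ((summable_geometric_of_lt_one (by norm_num) (by norm_num)).mul_left _)

theorem exists_norm_mittagLeffler_le {a b : ℝ} (ha : 1 ≤ a) (hb : 0 < b) :
    ∃ C : ℝ, 0 < C ∧ ∀ z : ℂ, ‖mittagLeffler a b z‖ ≤ C * Real.exp (3 * ‖z‖ ^ (1 / a)) := by
  obtain ⟨C, hC, h⟩ := exists_norm_mittagLeffler_term_le ha hb
  refine ⟨C * 2, by positivity, fun z => ?_⟩
  have h1 := tsum_of_norm_bounded (hasSum_geometric_two.mul_left (C * Real.exp (3 * ‖z‖ ^ (1 / a))))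
    (h z)
  rw [mittagLeffler]
  linarith

theorem continuous_mittagLeffler {a b : ℝ} (ha : 1 ≤ a) (hb : 0 < b) :
    Continuous (mittagLeffler a b) := by
  obtain ⟨C, hC, h⟩ := exists_norm_mittagLeffler_term_le ha hb
  rw [continuous_iff_continuousAt]
  intro z₀
  have hcont : ContinuousOn (mittagLeffler a b) (Metric.ball 0 (‖z₀‖ + 1)) := by
    refine continuousOn_tsum (u := fun k => C * Real.exp (3 * (‖z₀‖ + 1) ^ (1 / a)) * (1 / 2) ^ k)
      (fun k => by fun_prop)
      ((summable_geometric_of_lt_one (by norm_num) (by norm_num)).mul_left _) ?_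
    intro k z hz
    refine (h z k).trans ?_
    have hz' : ‖z‖ ≤ ‖z₀‖ + 1 := (mem_ball_zero_iff.1 hz).le
    have ha0 : 0 ≤ 1 / a := by positivity
    gcongr
  exact hcont.continuousAt (Metric.isOpen_ball.mem_nhds (by simp))

/-- `z E_{a,b+a}(z) = E_{a,b}(z) - 1/Γ(b)`, by shifting the index of the series. -/
theorem mul_mittagLeffler_add {a b : ℝ} (ha : 1 ≤ a) (hb : 0 < b) (z : ℂ) :
    z * mittagLeffler a (b + a) z = mittagLeffler a b z - 1 / (Real.Gamma b : ℂ) := by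
  have hs := (summable_norm_mittagLeffler ha hb z).of_norm
  rw [mittagLeffler, mittagLeffler, hs.tsum_eq_zero_add, ← tsum_mul_left]
  simp only [pow_zero, Nat.cast_zero, mul_zero, zero_add, add_sub_cancel_left]
  congr 1; funext k
  rw [pow_succ']
  push_cast
  rw [show a * (k + 1) + b = a * k + (b + a) by ring]
  ring

/-- For `c = 1` the Prabhakar function is the two-parameter Mittag-Leffler function. -/
theorem mittagLeffler3_one (a b : ℝ) : mittagLeffler3 a b 1 = mittagLeffler a b := by
  funext z
  rw [mittagLeffler3, mittagLeffler]
  congr 1; funext k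
  rw [ascPochhammer_eval_one]
  have : ((k.factorial : ℝ) : ℂ) ≠ 0 := by exact_mod_cast k.factorial_ne_zero
  push_cast at this ⊢
  field_simp

theorem mittagLeffler_zero (a b : ℝ) : mittagLeffler a b 0 = 1 / (Real.Gamma b : ℂ) := by
  rw [mittagLeffler, tsum_eq_single 0]
  · simp
  · intro k hk; simp [hk]

/-! ### Power kernels and Mittag-Leffler kernels -/

/-- The kernel `s^{b-1}/Γ(b)` of the Riemann-Liouville integral of order `b`. -/
noncomputable def rlKernel (b s : ℝ) : ℂ := ((s ^ (b - 1) / Real.Gamma b : ℝ) : ℂ)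

/-- The kernel `s^{b-1} E_{a,b}(ω s^a)`; the power kernel is the case `ω = 0`. -/
noncomputable def mlKernel (a b : ℝ) (ω : ℂ) (s : ℝ) : ℂ :=
  ((s ^ (b - 1) : ℝ) : ℂ) * mittagLeffler a b (ω * ((s ^ a : ℝ) : ℂ))

theorem mlKernel_zero (a b : ℝ) : mlKernel a b 0 = rlKernel b := by
  funext s
  rw [mlKernel, rlKernel, zero_mul, mittagLeffler_zero]
  push_cast; ring

theorem exists_norm_mlKernel_le {a b : ℝ} (ha : 1 ≤ a) (hb : 0 < b) :
    ∃ C : ℝ, 0 < C ∧ ∀ (ω : ℂ) (s : ℝ), 0 < s →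
      ‖mlKernel a b ω s‖ ≤ C * Real.exp (3 * (s * ‖ω‖ ^ (1 / a))) * s ^ (b - 1) := by
  obtain ⟨C, hC, h⟩ := exists_norm_mittagLeffler_le ha hb
  refine ⟨C, hC, fun ω s hs => ?_⟩
  rw [mlKernel, norm_mul, Complex.norm_real, Real.norm_of_nonneg (by positivity), mul_comm]
  gcongr
  refine (h _).trans_eq ?_
  rw [norm_mul, Complex.norm_real, Real.norm_of_nonneg (by positivity),
    Real.mul_rpow (norm_nonneg _) (by positivity), ← Real.rpow_mul hs.le,
    mul_one_div_cancel (by linarith), Real.rpow_one, mul_comm s]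

theorem measurable_mlKernel {a b : ℝ} (ha : 1 ≤ a) (hb : 0 < b) :
    Measurable fun p : ℂ × ℝ => mlKernel a b p.1 p.2 := by
  have := (continuous_mittagLeffler ha hb).measurable
  unfold mlKernel
  fun_prop

theorem continuous_mlKernel {a b : ℝ} (ha : 1 ≤ a) (hb : 1 ≤ b) (ω : ℂ) :
    Continuous (mlKernel a b ω) := by
  have := continuous_mittagLeffler ha (show 0 < b by linarith)
  have h1 := Real.continuous_rpow_const (show 0 ≤ b - 1 by linarith)
  have h2 := Real.continuous_rpow_const (show 0 ≤ a by linarith)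
  unfold mlKernel
  fun_prop

theorem continuousOn_mlKernel {a b : ℝ} (ha : 1 ≤ a) (hb : 0 < b) (ω : ℂ) :
    ContinuousOn (mlKernel a b ω) (Ioi 0) := by
  have h3 := continuous_mittagLeffler ha hb
  have h2 := Real.continuous_rpow_const (show 0 ≤ a by linarith)
  have h1 : ContinuousOn (fun s : ℝ => s ^ (b - 1)) (Ioi 0) := fun s hs =>
    (Real.continuousAt_rpow_const s _ (Or.inl (ne_of_gt hs))).continuousWithinAt
  unfold mlKernel
  exact (Complex.continuous_ofReal.comp_continuousOn h1).mul (by fun_prop)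

/-- The resolvent identity in the form `e_b = k_b + ω e_{b+a}`. -/
theorem mlKernel_eq_add {a b : ℝ} (ha : 1 ≤ a) (hb : 0 < b) (ω : ℂ) {s : ℝ} (hs : 0 < s) :
    mlKernel a b ω s = rlKernel b s + ω * mlKernel a (b + a) ω s := by
  have h := mul_mittagLeffler_add ha hb (ω * ((s ^ a : ℝ) : ℂ))
  rw [mlKernel, mlKernel, rlKernel]
  rw [show b + a - 1 = (b - 1) + a by ring, Real.rpow_add hs]
  have h' : mittagLeffler a b (ω * ((s ^ a : ℝ) : ℂ)) = 1 / (Real.Gamma b : ℂ) +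
      ω * ((s ^ a : ℝ) : ℂ) * mittagLeffler a (b + a) (ω * ((s ^ a : ℝ) : ℂ)) := by
    rw [h]; ring
  rw [h']
  push_cast; ring

theorem hasSum_mlKernel {a b : ℝ} (ha : 1 ≤ a) (hb : 0 < b) (ω : ℂ) {s : ℝ} (hs : 0 < s) :
    HasSum (fun k : ℕ => ω ^ k * rlKernel (a * k + b) s) (mlKernel a b ω s) := by
  have h := ((summable_norm_mittagLeffler ha hb (ω * ((s ^ a : ℝ) : ℂ))).of_norm.hasSum).mul_left
    ((s ^ (b - 1) : ℝ) : ℂ)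
  rw [mlKernel]
  refine h.congr_fun fun k => ?_
  rw [rlKernel, show a * k + b - 1 = (b - 1) + a * k by ring, Real.rpow_add hs,
    Real.rpow_mul hs.le, Real.rpow_natCast]
  push_cast; ring

theorem summable_norm_mlKernel {a b : ℝ} (ha : 1 ≤ a) (hb : 0 < b) (ω : ℂ) {s : ℝ} (hs : 0 < s) :
    Summable (fun k : ℕ => ‖ω ^ k * rlKernel (a * k + b) s‖) :=
  (hasSum_mlKernel ha hb ω hs).summable.norm

/-- Euler's beta integral for power kernels: `k_p * k_q = k_{p+q}`. -/
theorem integral_rlKernel_mul_rlKernel {p q y : ℝ} (hp : 0 < p) (hq : 0 < q) (hy : 0 < y) :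
    ∫ t in (0 : ℝ)..y, rlKernel p (y - t) * rlKernel q t = rlKernel (p + q) y := by
  have hβ := Complex.betaIntegral_scaled (q : ℂ) (p : ℂ) hy
  have hΓ := Complex.Gamma_mul_Gamma_eq_betaIntegral (s := (q : ℂ)) (t := (p : ℂ))
    (by simpa using hq) (by simpa using hp)
  have hGp : (Real.Gamma p : ℂ) ≠ 0 := by exact_mod_cast (Real.Gamma_pos_of_pos hp).ne'
  have hGq : (Real.Gamma q : ℂ) ≠ 0 := by exact_mod_cast (Real.Gamma_pos_of_pos hq).ne'
  have hGpq : (Real.Gamma (q + p) : ℂ) ≠ 0 := by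
    exact_mod_cast (Real.Gamma_pos_of_pos (by linarith : 0 < q + p)).ne'
  rw [← Complex.ofReal_add, Complex.Gamma_ofReal, Complex.Gamma_ofReal, Complex.Gamma_ofReal] at hΓ
  have hc : ∫ t in (0 : ℝ)..y, rlKernel p (y - t) * rlKernel q t =
      (1 / ((Real.Gamma q : ℂ) * Real.Gamma p)) *
        ∫ x : ℝ in (0 : ℝ)..y, (x : ℂ) ^ ((q : ℂ) - 1) * ((y : ℂ) - x) ^ ((p : ℂ) - 1) := by
    rw [← intervalIntegral.integral_const_mul]
    refine intervalIntegral.integral_congr_ae (Eventually.of_forall fun t ht => ?_)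
    rw [uIoc_of_le hy.le] at ht
    rw [rlKernel, rlKernel]
    push_cast
    rw [Complex.ofReal_cpow (by linarith [ht.2]), Complex.ofReal_cpow ht.1.le]
    push_cast
    field_simp
  rw [hc, hβ, rlKernel, add_comm p q]
  push_cast
  rw [Complex.ofReal_cpow hy.le]
  push_cast
  field_simp
  rw [hΓ]
  ring

theorem rlKernel_pos {p s : ℝ} (hp : 0 < p) (hs : 0 < s) :
    rlKernel p s = ((‖rlKernel p s‖ : ℝ) : ℂ) ∧ 0 < ‖rlKernel p s‖ := by
  have : 0 < s ^ (p - 1) / Real.Gamma p := div_pos (by positivity) (Real.Gamma_pos_of_pos hp)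
  rw [rlKernel, Complex.norm_real, Real.norm_of_nonneg this.le]
  exact ⟨rfl, this⟩

theorem intervalIntegrable_rlKernel_mul {p q y : ℝ} (hp : 0 < p) (hq : 0 < q) (hy : 0 < y) :
    IntervalIntegrable (fun t => rlKernel p (y - t) * rlKernel q t) volume 0 y := by
  -- the integral is a nonzero number, hence not the junk value of a divergent one
  by_contra h
  have h0 := intervalIntegral.integral_undef h
  rw [integral_rlKernel_mul_rlKernel hp hq hy] at h0
  have := (rlKernel_pos (show 0 < p + q by linarith) hy).2
  rw [h0, norm_zero] at this
  exact lt_irrefl _ this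

theorem integral_norm_rlKernel_mul {p q y : ℝ} (hp : 0 < p) (hq : 0 < q) (hy : 0 < y) :
    ∫ t in (0 : ℝ)..y, ‖rlKernel p (y - t) * rlKernel q t‖ = ‖rlKernel (p + q) y‖ := by
  have h : ((∫ t in (0 : ℝ)..y, ‖rlKernel p (y - t) * rlKernel q t‖ : ℝ) : ℂ) =
      rlKernel (p + q) y := by
    rw [← integral_rlKernel_mul_rlKernel hp hq hy, ← intervalIntegral.integral_ofReal]
    rw [intervalIntegral.integral_of_le hy.le, intervalIntegral.integral_of_le hy.le,
      integral_Ioc_eq_integral_Ioo, integral_Ioc_eq_integral_Ioo]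
    refine setIntegral_congr_fun measurableSet_Ioo fun t ht => ?_
    simp only [norm_mul]
    push_cast
    rw [← (rlKernel_pos hp (sub_pos.2 ht.2)).1, ← (rlKernel_pos hq ht.1).1]
  rw [(rlKernel_pos (by linarith : 0 < p + q) hy).1] at h
  exact_mod_cast h

/-- `k_σ * e_b = e_{b+σ}`, by termwise integration. -/
theorem integral_rlKernel_mul_mlKernel {a b σ y : ℝ} (ha : 1 ≤ a) (hb : 0 < b) (hσ : 0 < σ)
    (ω : ℂ) (hy : 0 < y) :
    ∫ t in (0 : ℝ)..y, rlKernel σ (y - t) * mlKernel a b ω t = mlKernel a (b + σ) ω y := by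
  rw [intervalIntegral.integral_of_le hy.le]
  have hbk : ∀ k : ℕ, 0 < a * k + b := fun k => by positivity
  have hint : ∀ k : ℕ, Integrable (fun t => rlKernel σ (y - t) * (ω ^ k * rlKernel (a * k + b) t))
      (volume.restrict (Ioc 0 y)) := fun k => by
    have := ((intervalIntegrable_iff_integrableOn_Ioc_of_le hy.le).1
      (intervalIntegrable_rlKernel_mul hσ (hbk k) hy)).const_mul (ω ^ k)
    refine this.congr (Eventually.of_forall fun t => ?_)
    simp only; ring
  have hnorm : ∀ k : ℕ, ∫ t in Ioc 0 y, ‖rlKernel σ (y - t) * (ω ^ k * rlKernel (a * k + b) t)‖ =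
      ‖ω ^ k * rlKernel (a * k + (b + σ)) y‖ := fun k => by
    have := integral_norm_rlKernel_mul hσ (hbk k) hy
    rw [intervalIntegral.integral_of_le hy.le] at this
    rw [norm_mul (ω ^ k), show a * k + (b + σ) = σ + (a * k + b) by ring, ← this,
      ← integral_const_mul]
    congr 1; funext t
    simp only [norm_mul]; ring
  have h := hasSum_integral_of_summable_integral_norm hint (by
    simp only [hnorm]; exact summable_norm_mlKernel ha (by linarith) ω hy)
  have h2 : ∀ k : ℕ, ∫ t in Ioc 0 y, rlKernel σ (y - t) * (ω ^ k * rlKernel (a * k + b) t) =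
      ω ^ k * rlKernel (a * k + (b + σ)) y := fun k => by
    rw [show a * k + (b + σ) = σ + (a * k + b) by ring,
      ← integral_rlKernel_mul_rlKernel hσ (hbk k) hy,
      intervalIntegral.integral_of_le hy.le, ← integral_const_mul]
    congr 1; funext t; ring
  simp only [h2] at h
  rw [← h.unique (hasSum_mlKernel ha (by linarith) ω hy) ]
  refine setIntegral_congr_fun measurableSet_Ioc fun t ht => ?_
  rw [tsum_mul_left, (hasSum_mlKernel ha hb ω ht.1).tsum_eq]

/-! ### Convolution on the half-line -/

/-- The Volterra convolution `∫₀^y K(y-t) u(t) dt`. -/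
noncomputable def vconv (K u : ℝ → ℂ) (y : ℝ) : ℂ := ∫ t in (0 : ℝ)..y, K (y - t) * u t

theorem rlIntegral_eq_vconv {σ : ℝ} (hσ : σ ≠ 0) (u : ℝ → ℂ) :
    rlIntegral σ u = vconv (rlKernel σ) u := by
  funext y
  rw [rlIntegral, if_neg hσ, vconv, ← intervalIntegral.integral_const_mul]
  congr 1; funext t
  rw [rlKernel]; push_cast; ring

theorem rlIntegral_zero (u : ℝ → ℂ) : rlIntegral 0 u = u := by
  funext y; rw [rlIntegral, if_pos rfl]

theorem vconv_comm (K u : ℝ → ℂ) (y : ℝ) : vconv K u y = vconv u K y := by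
  have := intervalIntegral.integral_comp_sub_left (a := 0) (b := y)
    (fun t => K t * u (y - t)) y
  simp only [sub_sub_cancel, sub_self, sub_zero] at this
  rw [vconv, vconv, this]
  congr 1; funext t; ring

theorem vconv_congr {K u v : ℝ → ℂ} {y : ℝ} (hy : 0 ≤ y)
    (h : ∀ᵐ t ∂volume.restrict (Ioc 0 y), u t = v t) : vconv K u y = vconv K v y := by
  rw [vconv, vconv, intervalIntegral.integral_of_le hy, intervalIntegral.integral_of_le hy]
  refine integral_congr_ae ?_
  filter_upwards [h] with t ht
  rw [ht]

theorem vconv_congr_kernel {K L u : ℝ → ℂ} {y : ℝ} (hy : 0 ≤ y)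
    (h : ∀ t ∈ Ioi 0, K t = L t) : vconv K u y = vconv L u y := by
  rw [vconv_comm, vconv_comm L]
  refine vconv_congr hy ?_
  exact (ae_restrict_iff' measurableSet_Ioc).2 (Eventually.of_forall fun t ht => h t ht.1)

theorem vconv_congr_on {K u v : ℝ → ℂ} {y : ℝ} (hy : 0 ≤ y)
    (h : ∀ t ∈ Ioi 0, u t = v t) : vconv K u y = vconv K v y :=
  vconv_congr hy ((ae_restrict_iff' measurableSet_Ioc).2 (Eventually.of_forall fun t ht => h t ht.1))

theorem vconv_add {K u v : ℝ → ℂ} {y : ℝ} (hy : 0 ≤ y)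
    (hu : IntegrableOn (fun t => K (y - t) * u t) (Ioc 0 y))
    (hv : IntegrableOn (fun t => K (y - t) * v t) (Ioc 0 y)) :
    vconv K (fun t => u t + v t) y = vconv K u y + vconv K v y := by
  simp only [vconv, intervalIntegral.integral_of_le hy]
  rw [← integral_add hu hv]
  congr 1; funext t; ring

theorem vconv_const_mul (K u : ℝ → ℂ) (c : ℂ) (y : ℝ) :
    vconv K (fun t => c * u t) y = c * vconv K u y := by
  rw [vconv, vconv, ← intervalIntegral.integral_const_mul]
  congr 1; funext t; ring

theorem vconv_mul_const (K u : ℝ → ℂ) (c : ℂ) (y : ℝ) :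
    vconv K (fun t => u t * c) y = vconv K u y * c := by
  rw [vconv, vconv, ← intervalIntegral.integral_mul_const]
  congr 1; funext t; ring

theorem vconv_add_kernel {K L u : ℝ → ℂ} {y : ℝ} (hy : 0 ≤ y)
    (hK : IntegrableOn (fun t => K (y - t) * u t) (Ioc 0 y))
    (hL : IntegrableOn (fun t => L (y - t) * u t) (Ioc 0 y)) :
    vconv (fun t => K t + L t) u y = vconv K u y + vconv L u y := by
  simp only [vconv, intervalIntegral.integral_of_le hy]
  rw [← integral_add hK hL]
  congr 1; funext t; ring

theorem vconv_const_mul_kernel (K u : ℝ → ℂ) (c : ℂ) (y : ℝ) :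
    vconv (fun t => c * K t) u y = c * vconv K u y := by
  rw [vconv_comm, vconv_const_mul, vconv_comm]

/-- `K` is measurable and `O(s^{b-1})` on `(0, y]`; the bound is expressed through the kernel `k_b`,
so that beta integrals apply to it verbatim. -/
def KernelBound (K : ℝ → ℂ) (b y : ℝ) : Prop :=
  Measurable K ∧ ∃ C : ℝ, 0 ≤ C ∧ ∀ s ∈ Ioc 0 y, ‖K s‖ ≤ C * ‖rlKernel b s‖

theorem norm_rlKernel {b s : ℝ} (hb : 0 < b) (hs : 0 < s) :
    ‖rlKernel b s‖ = s ^ (b - 1) / Real.Gamma b := by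
  have : 0 < s ^ (b - 1) / Real.Gamma b := div_pos (by positivity) (Real.Gamma_pos_of_pos hb)
  rw [rlKernel, Complex.norm_real, Real.norm_of_nonneg this.le]

theorem kernelBound_mlKernel {a b : ℝ} (ha : 1 ≤ a) (hb : 0 < b) (ω : ℂ) (y : ℝ) :
    KernelBound (mlKernel a b ω) b y := by
  obtain ⟨C, hC, h⟩ := exists_norm_mlKernel_le ha hb
  refine ⟨(measurable_mlKernel ha hb).comp measurable_prodMk_left,
    C * Real.exp (3 * (y * ‖ω‖ ^ (1 / a))) * Real.Gamma b,
    by have := Real.Gamma_pos_of_pos hb; positivity, fun s hs => ?_⟩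
  refine (h ω s hs.1).trans ?_
  rw [norm_rlKernel hb hs.1, mul_assoc _ (Real.Gamma b),
    mul_div_cancel₀ _ (Real.Gamma_pos_of_pos hb).ne']
  have := hs.1
  have := hs.2
  gcongr

theorem kernelBound_rlKernel {b : ℝ} (hb : 0 < b) (y : ℝ) : KernelBound (rlKernel b) b y := by
  rw [← mlKernel_zero 1 b]; exact kernelBound_mlKernel le_rfl hb 0 y

theorem measurable_rlKernel (b : ℝ) : Measurable (rlKernel b) := by
  unfold rlKernel; fun_prop

theorem continuous_rlKernel {b : ℝ} (hb : 1 ≤ b) : Continuous (rlKernel b) := by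
  rw [← mlKernel_zero 1 b]; exact continuous_mlKernel le_rfl hb 0

theorem continuousOn_rlKernel {b : ℝ} (hb : 0 < b) : ContinuousOn (rlKernel b) (Ioi 0) := by
  rw [← mlKernel_zero 1 b]; exact continuousOn_mlKernel le_rfl hb 0

theorem rlKernel_one {s : ℝ} : rlKernel 1 s = 1 := by
  simp [rlKernel]

theorem rlKernel_two {s : ℝ} : rlKernel 2 s = s := by
  rw [rlKernel]; norm_num [Real.Gamma_two]

theorem rlKernel_at_zero {b : ℝ} (hb : 1 < b) : rlKernel b 0 = 0 := by
  rw [rlKernel, Real.zero_rpow (by linarith)]; simp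

theorem mlKernel_at_zero {a b : ℝ} (hb : 1 < b) (ω : ℂ) : mlKernel a b ω 0 = 0 := by
  rw [mlKernel, Real.zero_rpow (by linarith)]; simp

theorem aestronglyMeasurable_of_kernel_mul {c y : ℝ} (hc : 0 < c) {u : ℝ → ℂ}
    (hu : IntegrableOn (fun t => rlKernel c (y - t) * u t) (Ioc 0 y)) :
    AEStronglyMeasurable u (volume.restrict (Ioc 0 y)) := by
  rw [← restrict_Ioo_eq_restrict_Ioc]
  have h1 : AEStronglyMeasurable (fun t => (rlKernel c (y - t))⁻¹ * (rlKernel c (y - t) * u t))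
      (volume.restrict (Ioo 0 y)) :=
    (((measurable_rlKernel c).comp (by fun_prop)).inv.aestronglyMeasurable).mul
      (hu.mono_set Ioo_subset_Ioc_self).aestronglyMeasurable
  refine h1.congr ((ae_restrict_iff' measurableSet_Ioo).2 (Eventually.of_forall fun t ht => ?_))
  have h0 : rlKernel c (y - t) ≠ 0 := norm_pos_iff.1 (rlKernel_pos hc (sub_pos.2 ht.2)).2
  simp only
  rw [inv_mul_cancel_left₀ h0]

/-- Integrability on the triangle `0 < t < s < y` behind the associativity of convolution. -/
theorem integrable_triangle {A B u : ℝ → ℂ} {a b y : ℝ} (ha : 0 < a) (hb : 0 < b)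
    (hA : KernelBound A a y) (hB : KernelBound B b y)
    (hu : IntegrableOn (fun t => rlKernel (a + b) (y - t) * u t) (Ioc 0 y)) :
    Integrable (fun p : ℝ × ℝ => (Ioi p.2).indicator (fun s => A (y - s) * (B (s - p.2) * u p.2)) p.1)
      ((volume.restrict (Ioc 0 y)).prod (volume.restrict (Ioc 0 y))) := by
  obtain ⟨hAm, CA, hCA, hA⟩ := hA
  obtain ⟨hBm, CB, hCB, hB⟩ := hB
  have hum := aestronglyMeasurable_of_kernel_mul (by linarith : 0 < a + b) hu
  set m := volume.restrict (Ioc (0 : ℝ) y) with hm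
  have hmeas : AEStronglyMeasurable (fun p : ℝ × ℝ =>
      (Ioi p.2).indicator (fun s => A (y - s) * (B (s - p.2) * u p.2)) p.1) (m.prod m) := by
    have hS : MeasurableSet {p : ℝ × ℝ | p.2 < p.1} := measurableSet_lt measurable_snd measurable_fst
    have h1 : AEStronglyMeasurable (fun p : ℝ × ℝ => A (y - p.1) * (B (p.1 - p.2) * u p.2))
        (m.prod m) := by
      have hA' : Measurable fun p : ℝ × ℝ => A (y - p.1) := hAm.comp (by fun_prop)
      have hB' : Measurable fun p : ℝ × ℝ => B (p.1 - p.2) := hBm.comp (by fun_prop)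
      exact hA'.aestronglyMeasurable.mul (hB'.aestronglyMeasurable.mul hum.comp_snd)
    refine (h1.indicator hS).congr (Eventually.of_forall fun p => ?_)
    simp only [indicator, mem_Ioi, mem_ofPred_eq]
  -- for fixed `t`, the integrand is dominated by a translated beta integrand
  have key : ∀ t ∈ Ioo 0 y,
      IntegrableOn (fun s => CA * CB * ‖rlKernel a (y - s) * rlKernel b (s - t)‖ * ‖u t‖) (Ioc t y) ∧
      ∫ s in Ioc t y, CA * CB * ‖rlKernel a (y - s) * rlKernel b (s - t)‖ * ‖u t‖ =
        CA * CB * ‖rlKernel (a + b) (y - t) * u t‖ := by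
    intro t ht
    have hyt : 0 < y - t := sub_pos.2 ht.2
    have h1 := (intervalIntegrable_rlKernel_mul ha hb hyt).norm
    have h1' := h1.comp_sub_right t
    have h2 := integral_norm_rlKernel_mul ha hb hyt
    have h3 := intervalIntegral.integral_comp_sub_right (a := t) (b := y)
      (fun r => ‖rlKernel a (y - t - r) * rlKernel b r‖) t
    rw [sub_self, h2] at h3
    simp only [zero_add, sub_add_cancel, sub_sub_sub_cancel_right] at h1' h3
    rw [intervalIntegrable_iff_integrableOn_Ioc_of_le ht.2.le] at h1'
    rw [intervalIntegral.integral_of_le ht.2.le] at h3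
    refine ⟨(h1'.const_mul _).mul_const _, ?_⟩
    rw [integral_mul_const, integral_const_mul, h3, norm_mul]
    ring
  have dom : ∀ t ∈ Ioo 0 y, ∀ s ∈ Ioc t y, ‖A (y - s) * (B (s - t) * u t)‖ ≤
      CA * CB * ‖rlKernel a (y - s) * rlKernel b (s - t)‖ * ‖u t‖ ∨ s = y := by
    intro t ht s hs
    rcases hs.2.eq_or_lt with h | h
    · exact Or.inr h
    · left
      have e1 := hA (y - s) ⟨sub_pos.2 h, by linarith [ht.1, hs.1]⟩
      have e2 := hB (s - t) ⟨sub_pos.2 hs.1, by linarith [ht.1, hs.2]⟩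
      rw [norm_mul, norm_mul, norm_mul]
      calc ‖A (y - s)‖ * (‖B (s - t)‖ * ‖u t‖)
          ≤ (CA * ‖rlKernel a (y - s)‖) * ((CB * ‖rlKernel b (s - t)‖) * ‖u t‖) := by gcongr
        _ = _ := by ring
  have hae : ∀ᵐ s : ℝ, s ≠ y := by simp [ae_iff, measure_singleton]
  have domae : ∀ t ∈ Ioo 0 y, ∀ᵐ s ∂(volume.restrict (Ioc t y)), ‖A (y - s) * (B (s - t) * u t)‖ ≤
      CA * CB * ‖rlKernel a (y - s) * rlKernel b (s - t)‖ * ‖u t‖ := by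
    intro t ht
    rw [ae_restrict_iff' measurableSet_Ioc]
    filter_upwards [hae] with s hs hst
    exact (dom t ht s hst).resolve_right hs
  have hint : ∀ t ∈ Ioo 0 y, IntegrableOn (fun s => A (y - s) * (B (s - t) * u t)) (Ioc t y) := by
    intro t ht
    refine (key t ht).1.mono' ?_ (domae t ht)
    have hA' : Measurable fun s : ℝ => A (y - s) := hAm.comp (by fun_prop)
    have hB' : Measurable fun s : ℝ => B (s - t) := hBm.comp (by fun_prop)
    exact (hA'.mul (hB'.mul_const _)).aestronglyMeasurable
  have hset : ∀ t ∈ Ioo 0 y, Ioc 0 y ∩ Ioi t = Ioc t y := by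
    intro t ht; ext s; simp only [mem_inter_iff, mem_Ioc, mem_Ioi]
    constructor
    · rintro ⟨⟨_, h2⟩, h3⟩; exact ⟨h3, h2⟩
    · rintro ⟨h1, h2⟩; exact ⟨⟨ht.1.trans h1, h2⟩, h1⟩
  have hmem : ∀ᵐ t ∂m, t ∈ Ioo 0 y := by
    rw [hm, ← restrict_Ioo_eq_restrict_Ioc]
    exact ae_restrict_mem measurableSet_Ioo
  rw [integrable_prod_iff' hmeas]
  constructor
  · filter_upwards [hmem] with t ht
    rw [integrable_indicator_iff measurableSet_Ioi, IntegrableOn, hm,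
      Measure.restrict_restrict measurableSet_Ioi, inter_comm, hset t ht]
    exact hint t ht
  · refine (hu.norm.const_mul (CA * CB)).mono' hmeas.norm.prod_swap.integral_prod_right' ?_
    filter_upwards [hmem] with t ht
    rw [Real.norm_of_nonneg (by positivity), ← (key t ht).2]
    have : (fun s => ‖(Ioi t).indicator (fun s => A (y - s) * (B (s - t) * u t)) s‖) =
        (Ioi t).indicator (fun s => ‖A (y - s) * (B (s - t) * u t)‖) := by
      funext s; exact norm_indicator_eq_indicator_norm _ _
    simp only [this]
    rw [integral_indicator measurableSet_Ioi, hm, Measure.restrict_restrict measurableSet_Ioi,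
      inter_comm, hset t ht]
    exact integral_mono_ae (hint t ht).norm (key t ht).1 (domae t ht)

theorem integral_triangle_inner {A B u : ℝ → ℂ} {y s : ℝ} (hs : s ∈ Ioc 0 y) :
    ∫ t in Ioc 0 y, (Ioi t).indicator (fun s => A (y - s) * (B (s - t) * u t)) s =
      A (y - s) * vconv B u s := by
  have : (fun t => (Ioi t).indicator (fun s => A (y - s) * (B (s - t) * u t)) s) =
      (Iio s).indicator (fun t => A (y - s) * (B (s - t) * u t)) := by
    funext t; simp only [indicator, mem_Ioi, mem_Iio]
  have hset : Iio s ∩ Ioc 0 y = Ioo 0 s := by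
    ext t; simp only [mem_inter_iff, mem_Ioc, mem_Iio, mem_Ioo]
    constructor
    · rintro ⟨h1, h2, h3⟩; exact ⟨h2, h1⟩
    · rintro ⟨h1, h2⟩; exact ⟨h2, h1, h2.le.trans hs.2⟩
  rw [this, integral_indicator measurableSet_Iio, Measure.restrict_restrict measurableSet_Iio,
    integral_const_mul, vconv, intervalIntegral.integral_of_le hs.1.le,
    integral_Ioc_eq_integral_Ioo, hset]

theorem integrableOn_mul_vconv {A B u : ℝ → ℂ} {a b y : ℝ} (ha : 0 < a) (hb : 0 < b)
    (hA : KernelBound A a y) (hB : KernelBound B b y)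
    (hu : IntegrableOn (fun t => rlKernel (a + b) (y - t) * u t) (Ioc 0 y)) :
    IntegrableOn (fun s => A (y - s) * vconv B u s) (Ioc 0 y) := by
  refine (integrable_triangle ha hb hA hB hu).integral_prod_left.congr ?_
  refine (ae_restrict_iff' measurableSet_Ioc).2 (Eventually.of_forall fun s hs => ?_)
  exact integral_triangle_inner hs

/-- Associativity of convolution; only the absolute convergence of `k_{a+b} * u` at `y` is needed. -/
theorem vconv_assoc {A B u : ℝ → ℂ} {a b y : ℝ} (hy : 0 ≤ y) (ha : 0 < a) (hb : 0 < b)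
    (hA : KernelBound A a y) (hB : KernelBound B b y)
    (hu : IntegrableOn (fun t => rlKernel (a + b) (y - t) * u t) (Ioc 0 y)) :
    vconv A (vconv B u) y = vconv (vconv A B) u y := by
  have h := integral_integral_swap
    (f := fun s t => (Ioi t).indicator (fun s => A (y - s) * (B (s - t) * u t)) s)
    (integrable_triangle ha hb hA hB hu)
  rw [vconv, vconv, intervalIntegral.integral_of_le hy, intervalIntegral.integral_of_le hy]
  calc ∫ s in Ioc 0 y, A (y - s) * vconv B u s
      = ∫ s in Ioc 0 y, ∫ t in Ioc 0 y,
          (Ioi t).indicator (fun s => A (y - s) * (B (s - t) * u t)) s :=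
        setIntegral_congr_fun measurableSet_Ioc fun s hs => (integral_triangle_inner hs).symm
    _ = _ := h
    _ = _ := by
        refine setIntegral_congr_fun measurableSet_Ioc fun t ht => ?_
        rw [integral_indicator measurableSet_Ioi, Measure.restrict_restrict measurableSet_Ioi]
        have hset : Ioi t ∩ Ioc 0 y = Ioc t y := by
          ext s; simp only [mem_inter_iff, mem_Ioc, mem_Ioi]
          constructor
          · rintro ⟨h1, _, h3⟩; exact ⟨h1, h3⟩
          · rintro ⟨h1, h2⟩; exact ⟨h1, ht.1.trans h1, h2⟩
        rw [hset, ← intervalIntegral.integral_of_le ht.2, vconv]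
        have h3 := intervalIntegral.integral_comp_sub_right (a := t) (b := y)
          (fun r => A (y - t - r) * B r) t
        simp only [sub_self, sub_sub_sub_cancel_right] at h3
        rw [← h3, ← intervalIntegral.integral_mul_const]
        congr 1; funext s; ring

/-- `k_σ * e_b = e_{b+σ}`. -/
theorem vconv_rlKernel_mlKernel {a b σ y : ℝ} (ha : 1 ≤ a) (hb : 0 < b) (hσ : 0 < σ)
    (ω : ℂ) (hy : 0 < y) : vconv (rlKernel σ) (mlKernel a b ω) y = mlKernel a (b + σ) ω y :=
  integral_rlKernel_mul_mlKernel ha hb hσ ω hy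

theorem vconv_rlKernel_rlKernel {b σ y : ℝ} (hb : 0 < b) (hσ : 0 < σ) (hy : 0 < y) :
    vconv (rlKernel σ) (rlKernel b) y = rlKernel (b + σ) y := by
  have := vconv_rlKernel_mlKernel (a := 1) le_rfl hb hσ 0 hy
  rwa [mlKernel_zero, mlKernel_zero] at this

/-- `e_b * k_σ * u = e_{b+σ} * u`. -/
theorem vconv_mlKernel_vconv_rlKernel {a b σ y : ℝ} (ha : 1 ≤ a) (hb : 0 < b) (hσ : 0 < σ)
    (ω : ℂ) (hy : 0 < y) {u : ℝ → ℂ}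
    (hu : IntegrableOn (fun t => rlKernel (b + σ) (y - t) * u t) (Ioc 0 y)) :
    vconv (mlKernel a b ω) (vconv (rlKernel σ) u) y = vconv (mlKernel a (b + σ) ω) u y := by
  rw [vconv_assoc hy.le hb hσ (kernelBound_mlKernel ha hb ω y) (kernelBound_rlKernel hσ y) hu]
  refine vconv_congr_kernel hy.le fun t ht => ?_
  rw [vconv_comm, vconv_rlKernel_mlKernel ha hb hσ ω ht]

theorem vconv_rlKernel_vconv_mlKernel {a b σ y : ℝ} (ha : 1 ≤ a) (hb : 0 < b) (hσ : 0 < σ)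
    (ω : ℂ) (hy : 0 < y) {u : ℝ → ℂ}
    (hu : IntegrableOn (fun t => rlKernel (b + σ) (y - t) * u t) (Ioc 0 y)) :
    vconv (rlKernel σ) (vconv (mlKernel a b ω) u) y = vconv (mlKernel a (b + σ) ω) u y := by
  rw [add_comm] at hu
  rw [vconv_assoc hy.le hσ hb (kernelBound_rlKernel hσ y) (kernelBound_mlKernel ha hb ω y) hu]
  refine vconv_congr_kernel hy.le fun t ht => ?_
  rw [vconv_rlKernel_mlKernel ha hb hσ ω ht]

theorem vconv_rlKernel_vconv_rlKernel {b σ y : ℝ} (hb : 0 < b) (hσ : 0 < σ)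
    (hy : 0 < y) {u : ℝ → ℂ}
    (hu : IntegrableOn (fun t => rlKernel (b + σ) (y - t) * u t) (Ioc 0 y)) :
    vconv (rlKernel b) (vconv (rlKernel σ) u) y = vconv (rlKernel (b + σ)) u y := by
  have := vconv_mlKernel_vconv_rlKernel (a := 1) le_rfl hb hσ 0 hy hu
  rwa [mlKernel_zero, mlKernel_zero] at this

theorem integrableOn_continuous_mul {K u : ℝ → ℂ} {y : ℝ} (hK : Continuous K)
    (hu : IntegrableOn u (Ioc 0 y)) : IntegrableOn (fun t => K (y - t) * u t) (Ioc 0 y) := by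
  obtain ⟨C, hC⟩ := (isCompact_Icc (a := (0 : ℝ)) (b := y)).exists_bound_of_continuousOn
    hK.continuousOn
  refine Integrable.bdd_mul (c := C) hu (by fun_prop) ?_
  refine (ae_restrict_iff' measurableSet_Ioc).2 (Eventually.of_forall fun t ht => ?_)
  exact hC _ ⟨by linarith [ht.2], by linarith [ht.1]⟩

theorem integrableOn_rlKernel_mul {b y : ℝ} (hb : 1 ≤ b) {u : ℝ → ℂ}
    (hu : IntegrableOn u (Ioc 0 y)) :
    IntegrableOn (fun t => rlKernel b (y - t) * u t) (Ioc 0 y) :=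
  integrableOn_continuous_mul (continuous_rlKernel hb) hu

/-- Convolution with a continuous kernel vanishing at `0` is continuous. -/
theorem continuousAt_vconv {K u : ℝ → ℂ} (hK : Continuous K) (hK0 : K 0 = 0)
    (hu : ∀ Y, 0 < Y → IntegrableOn u (Ioc 0 Y)) {y : ℝ} (hy : 0 < y) :
    ContinuousAt (vconv K u) y := by
  have hY : 0 < y + 1 := by linarith
  obtain ⟨C, hC⟩ := (isCompact_Icc (a := (0 : ℝ)) (b := y + 1)).exists_bound_of_continuousOn
    hK.continuousOn
  -- as `K 0 = 0`, the kernel `K(max(z - t, 0))` vanishes for `t > z` and depends continuously on `z`,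
  -- so the domain of integration can be fixed
  have hc : ContinuousAt (fun z => ∫ t in Ioc 0 (y + 1), K (max (z - t) 0) * u t) y := by
    refine continuousAt_of_dominated (bound := fun t => C * ‖u t‖) ?_ ?_
      ((hu _ hY).norm.const_mul C) ?_
    · refine Eventually.of_forall fun z => AEStronglyMeasurable.mul ?_ (hu _ hY).1
      exact (hK.comp (by fun_prop)).aestronglyMeasurable
    · filter_upwards [Iic_mem_nhds (show y < y + 1 by linarith)] with z hz
      refine (ae_restrict_iff' measurableSet_Ioc).2 (Eventually.of_forall fun t ht => ?_)
      rw [norm_mul]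
      gcongr
      refine hC _ ⟨le_max_right _ _, max_le ?_ hY.le⟩
      have : z ≤ y + 1 := hz
      linarith [ht.1]
    · exact Eventually.of_forall fun t =>
        ((hK.comp (by fun_prop : Continuous fun z : ℝ => max (z - t) 0)).mul_const _).continuousAt
  refine hc.congr ?_
  filter_upwards [Ioo_mem_nhds hy (show y < y + 1 by linarith)] with z hz
  rw [vconv, intervalIntegral.integral_of_le hz.1.le]
  have h1 : ∀ t ∈ Ioc 0 (y + 1), K (max (z - t) 0) * u t =
      (Ioc 0 z).indicator (fun t => K (z - t) * u t) t := by
    intro t ht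
    by_cases h : t ≤ z
    · rw [indicator_of_mem (show t ∈ Ioc 0 z from ⟨ht.1, h⟩), max_eq_left (by linarith)]
    · rw [indicator_of_notMem (fun h' => h h'.2), max_eq_right (by linarith), hK0, zero_mul]
  rw [setIntegral_congr_fun measurableSet_Ioc h1, setIntegral_indicator measurableSet_Ioc,
    inter_eq_right.2 (Ioc_subset_Ioc_right hz.2.le)]

theorem measurable_vconv {K u : ℝ → ℝ → ℂ} (hK : Measurable (Function.uncurry K))
    (hu : Measurable (Function.uncurry u)) :
    Measurable fun p : ℝ × ℝ => vconv (K p.1) (u p.1) p.2 := by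
  have hF : Measurable fun q : (ℝ × ℝ) × ℝ => K q.1.1 (q.1.2 - q.2) * u q.1.1 q.2 := by
    have h1 : Measurable fun q : (ℝ × ℝ) × ℝ => K q.1.1 (q.1.2 - q.2) :=
      hK.comp (by fun_prop : Measurable fun q : (ℝ × ℝ) × ℝ => (q.1.1, q.1.2 - q.2))
    have h2 : Measurable fun q : (ℝ × ℝ) × ℝ => u q.1.1 q.2 :=
      hu.comp (by fun_prop : Measurable fun q : (ℝ × ℝ) × ℝ => (q.1.1, q.2))
    exact h1.mul h2
  have aux : ∀ S : Set ((ℝ × ℝ) × ℝ), MeasurableSet S → Measurable fun p : ℝ × ℝ =>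
      ∫ t, S.indicator (fun q : (ℝ × ℝ) × ℝ => K q.1.1 (q.1.2 - q.2) * u q.1.1 q.2) (p, t) := by
    intro S hS
    exact (StronglyMeasurable.integral_prod_right'
      (hF.indicator hS).stronglyMeasurable).measurable
  have hS1 : MeasurableSet {q : (ℝ × ℝ) × ℝ | q.2 ∈ Ioc 0 q.1.2} := by
    simp only [mem_Ioc]
    exact (measurableSet_lt measurable_const measurable_snd).inter
      (measurableSet_le measurable_snd (measurable_snd.comp measurable_fst))
  have hS2 : MeasurableSet {q : (ℝ × ℝ) × ℝ | q.2 ∈ Ioc q.1.2 0} := by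
    simp only [mem_Ioc]
    exact (measurableSet_lt (measurable_snd.comp measurable_fst) measurable_snd).inter
      (measurableSet_le measurable_snd measurable_const)
  convert (aux _ hS1).sub (aux _ hS2) using 1
  funext p
  simp only [vconv, intervalIntegral, ← integral_indicator measurableSet_Ioc, Pi.sub_apply]
  rfl

/-! ### Functions with an integrable power singularity at `0` -/

theorem integrableOn_rpow_neg {b y : ℝ} (hb : b < 1) (hy : 0 < y) :
    IntegrableOn (fun t : ℝ => t ^ (-b)) (Ioc 0 y) := by
  rw [← intervalIntegrable_iff_integrableOn_Ioc_of_le hy.le]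
  exact intervalIntegral.intervalIntegrable_rpow' (by linarith)

theorem rpow_neg_eq_rlKernel {b t : ℝ} (hb : b < 1) (ht : 0 < t) :
    t ^ (-b) = Real.Gamma (1 - b) * ‖rlKernel (1 - b) t‖ := by
  have h1 : 0 < 1 - b := by linarith
  rw [norm_rlKernel h1 ht, mul_div_cancel₀ _ (Real.Gamma_pos_of_pos h1).ne']
  congr 1; ring

theorem integrableOn_rlKernel_mul_rpow_neg {σ b y : ℝ} (hσ : 0 < σ) (hb : b < 1) (hy : 0 < y) :
    IntegrableOn (fun t => ‖rlKernel σ (y - t)‖ * t ^ (-b)) (Ioc 0 y) := by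
  have h := ((intervalIntegrable_iff_integrableOn_Ioc_of_le hy.le).1
    (intervalIntegrable_rlKernel_mul hσ (show 0 < 1 - b by linarith) hy)).norm.const_mul
      (Real.Gamma (1 - b))
  refine h.congr ((ae_restrict_iff' measurableSet_Ioc).2 (Eventually.of_forall fun t ht => ?_))
  simp only
  rw [rpow_neg_eq_rlKernel hb ht.1, norm_mul]; ring

theorem integral_rlKernel_mul_rpow_neg {σ b y : ℝ} (hσ : 0 < σ) (hb : b < 1) (hy : 0 < y) :
    ∫ t in Ioc 0 y, ‖rlKernel σ (y - t)‖ * t ^ (-b) =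
      Real.Gamma (1 - b) / Real.Gamma (1 - b + σ) * y ^ (-(b - σ)) := by
  have h := integral_norm_rlKernel_mul hσ (show 0 < 1 - b by linarith) hy
  rw [intervalIntegral.integral_of_le hy.le] at h
  have h1 : 0 < σ + (1 - b) := by linarith
  rw [norm_rlKernel h1 hy, add_comm σ] at h
  rw [div_mul_eq_mul_div, show -(b - σ) = 1 - b + σ - 1 by ring, ← mul_div_assoc', ← h,
    ← integral_const_mul]
  refine setIntegral_congr_fun measurableSet_Ioc fun t ht => ?_
  rw [rpow_neg_eq_rlKernel hb ht.1, norm_mul]; ring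

theorem integrableOn_of_norm_le_rpow {u : ℝ → ℂ} {M b y : ℝ} (hb : b < 1) (hy : 0 < y)
    (hm : AEStronglyMeasurable u (volume.restrict (Ioc 0 y)))
    (h : ∀ t ∈ Ioc 0 y, ‖u t‖ ≤ M * t ^ (-b)) : IntegrableOn u (Ioc 0 y) :=
  ((integrableOn_rpow_neg hb hy).const_mul M).mono' hm
    ((ae_restrict_iff' measurableSet_Ioc).2 (Eventually.of_forall h))

theorem integrableOn_rlKernel_mul_of_norm_le_rpow {u : ℝ → ℂ} {M b y σ : ℝ} (hσ : 0 < σ)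
    (hb : b < 1) (hy : 0 < y) (hm : AEStronglyMeasurable u (volume.restrict (Ioc 0 y)))
    (h : ∀ t ∈ Ioc 0 y, ‖u t‖ ≤ M * t ^ (-b)) :
    IntegrableOn (fun t => rlKernel σ (y - t) * u t) (Ioc 0 y) := by
  refine ((integrableOn_rlKernel_mul_rpow_neg hσ hb hy).const_mul M).mono'
    (((measurable_rlKernel σ).comp (by fun_prop)).aestronglyMeasurable.mul hm)
    ((ae_restrict_iff' measurableSet_Ioc).2 (Eventually.of_forall fun t ht => ?_))
  rw [norm_mul]
  calc ‖rlKernel σ (y - t)‖ * ‖u t‖ ≤ ‖rlKernel σ (y - t)‖ * (M * t ^ (-b)) := by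
        gcongr; exact h t ht
    _ = _ := by ring

/-- The primitive of a function that is integrable near `0` and continuous on `(0, ∞)`. -/
theorem hasDerivAt_primitive {h : ℝ → ℂ} (hc : ContinuousOn h (Ioi 0))
    (hi : ∀ Y, 0 < Y → IntegrableOn h (Ioc 0 Y)) {y : ℝ} (hy : 0 < y) :
    HasDerivAt (fun z => ∫ t in (0 : ℝ)..z, h t) (h y) y :=
  intervalIntegral.integral_hasDerivAt_right
    ((intervalIntegrable_iff_integrableOn_Ioc_of_le hy.le).2 (hi y hy))
    (hc.stronglyMeasurableAtFilter isOpen_Ioi y hy) (hc.continuousAt (Ioi_mem_nhds hy))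

theorem tendsto_primitive_zero {h : ℝ → ℂ} (hi : ∀ Y, 0 < Y → IntegrableOn h (Ioc 0 Y)) :
    Tendsto (fun z => ∫ t in (0 : ℝ)..z, h t) (𝓝[>] 0) (𝓝 0) := by
  have hint : IntegrableOn h (uIcc 0 1) := by
    rw [uIcc_of_le zero_le_one, integrableOn_Icc_iff_integrableOn_Ioc]; exact hi 1 one_pos
  have hc := intervalIntegral.continuousOn_primitive_interval hint
  have h0 := (hc 0 left_mem_uIcc)
  rw [ContinuousWithinAt, intervalIntegral.integral_same, uIcc_of_le zero_le_one] at h0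
  refine h0.mono_left ?_
  rw [← nhdsWithin_Ioo_eq_nhdsGT (show (0 : ℝ) < 1 by norm_num)]
  exact nhdsWithin_mono _ Ioo_subset_Icc_self

theorem vconv_rlKernel_one (u : ℝ → ℂ) : vconv (rlKernel 1) u = fun y => ∫ t in (0 : ℝ)..y, u t := by
  funext y; simp only [vconv, rlKernel_one, one_mul]

theorem vconv_rlKernel_one_apply (u : ℝ → ℂ) (y : ℝ) :
    vconv (rlKernel 1) u y = ∫ t in (0 : ℝ)..y, u t := by
  rw [vconv_rlKernel_one]

/-! ### The Hilfer equation at a fixed point of the line -/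

theorem integrableOn_rlKernel_mul_vconv {b c y : ℝ} (hb : 0 < b) (hc : 0 < c) (hbc : 1 ≤ b + c)
    {u : ℝ → ℂ} (hu : IntegrableOn u (Ioc 0 y)) :
    IntegrableOn (fun t => rlKernel b (y - t) * vconv (rlKernel c) u t) (Ioc 0 y) :=
  integrableOn_mul_vconv hb hc (kernelBound_rlKernel hb y) (kernelBound_rlKernel hc y)
    (integrableOn_rlKernel_mul hbc hu)

theorem integrableOn_rlKernel {b y : ℝ} (hb : 0 < b) (hy : 0 < y) :
    IntegrableOn (rlKernel b) (Ioc 0 y) := by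
  have := (intervalIntegrable_iff_integrableOn_Ioc_of_le hy.le).1
    (intervalIntegrable_rlKernel_mul one_pos hb hy)
  simpa only [rlKernel_one, one_mul] using this

theorem integrableOn_rlKernel_mul_rlKernel {b c y : ℝ} (hb : 0 < b) (hc : 0 < c) (hy : 0 < y) :
    IntegrableOn (fun t => rlKernel b (y - t) * rlKernel c t) (Ioc 0 y) :=
  (intervalIntegrable_iff_integrableOn_Ioc_of_le hy.le).1 (intervalIntegrable_rlKernel_mul hb hc hy)

/-- `k_b * (k_c A + k_d B + k_e * q) = k_{c+b} A + k_{d+b} B + k_{b+e} * q`. -/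
theorem vconv_rlKernel_sum {b c d e y : ℝ} (hb : 0 < b) (hc : 0 < c) (hd : 0 < d) (he : 0 < e)
    (hbe : 1 ≤ b + e) (hy : 0 < y) (A B : ℂ) {q : ℝ → ℂ} (hq : IntegrableOn q (Ioc 0 y)) :
    vconv (rlKernel b) (fun t => rlKernel c t * A + rlKernel d t * B + vconv (rlKernel e) q t) y =
      rlKernel (c + b) y * A + rlKernel (d + b) y * B + vconv (rlKernel (b + e)) q y := by
  have i1 := (integrableOn_rlKernel_mul_rlKernel hb hc hy).mul_const A
  have i2 := (integrableOn_rlKernel_mul_rlKernel hb hd hy).mul_const B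
  have i3 := integrableOn_rlKernel_mul_vconv hb he hbe hq
  simp only [mul_assoc] at i1 i2
  rw [vconv_add hy.le ?_ i3, vconv_add hy.le i1 i2, vconv_mul_const, vconv_mul_const,
    vconv_rlKernel_rlKernel hc hb hy, vconv_rlKernel_rlKernel hd hb hy,
    vconv_rlKernel_vconv_rlKernel hb he hy (integrableOn_rlKernel_mul hbe hq)]
  exact (i1.add i2).congr (Eventually.of_forall fun t => by simp only [Pi.add_apply]; ring)

theorem integrableOn_vconv_rlKernel {b y : ℝ} (hb : 0 < b) {u : ℝ → ℂ}
    (hu : IntegrableOn u (Ioc 0 y)) : IntegrableOn (vconv (rlKernel b) u) (Ioc 0 y) := by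
  simpa only [rlKernel_one, one_mul] using
    integrableOn_rlKernel_mul_vconv one_pos hb (by linarith) hu

/-- A function whose Hilfer derivative is the locally integrable function `q` solves the
corresponding Volterra equation. -/
theorem eq_volterra_of_hilfer {γ δ μ : ℝ} (hγ0 : 0 ≤ γ) (hγ1 : γ < 1) (hδ : 0 ≤ δ)
    (hμ : 1 < μ) (hsum : γ + δ = 2 - μ) {u q : ℝ → ℂ} {A B : ℂ}
    (huc : ContinuousOn u (Ioi 0)) (hui : ∀ Y, 0 < Y → IntegrableOn u (Ioc 0 Y))
    (hqi : ∀ Y, 0 < Y → IntegrableOn q (Ioc 0 Y))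
    (hd0 : ∀ y, 0 < y → DifferentiableAt ℝ (rlIntegral γ u) y)
    (hd1 : ∀ y, 0 < y → DifferentiableAt ℝ (deriv (rlIntegral γ u)) y)
    (hconv : ∀ y, 0 < y → RLConverges δ (deriv (deriv (rlIntegral γ u))) y)
    (heq : ∀ y, 0 < y → rlIntegral δ (deriv (deriv (rlIntegral γ u))) y = q y)
    (hA : Tendsto (rlIntegral γ u) (𝓝[>] 0) (𝓝 A))
    (hB : Tendsto (deriv (rlIntegral γ u)) (𝓝[>] 0) (𝓝 B)) {y : ℝ} (hy : 0 < y) :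
    u y = rlKernel (1 - γ) y * A + rlKernel (2 - γ) y * B + vconv (rlKernel μ) q y := by
  set w := rlIntegral γ u with hw
  set h := deriv (deriv w) with hh
  -- the second derivative is integrable up to the origin
  have hhi : ∀ Y, 0 < Y → IntegrableOn h (Ioc 0 Y) := by
    intro Y hY
    rcases hδ.eq_or_lt with h0 | h0
    · refine (hqi Y hY).congr_fun (fun t ht => ?_) measurableSet_Ioc
      rw [← heq t ht.1, ← h0, rlIntegral_zero]
    · have hc := (hconv Y hY).resolve_left h0.ne'
      rw [intervalIntegrable_iff_integrableOn_Ioc_of_le hY.le] at hc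
      have hc1 := hc.const_mul ((Real.Gamma δ : ℂ)⁻¹)
      refine (integrableOn_rlKernel_mul (b := 2 - δ) (by linarith) hc1 |>.const_mul
        ((Real.Gamma δ : ℂ) * Real.Gamma (2 - δ))).congr ?_
      have hae : ∀ᵐ t : ℝ, t ≠ Y := by simp [ae_iff, measure_singleton]
      rw [EventuallyEq, ae_restrict_iff' measurableSet_Ioc]
      filter_upwards [hae] with t htY ht
      have hpos : 0 < Y - t := sub_pos.2 (lt_of_le_of_ne ht.2 htY)
      have e1 : ((Y - t) ^ (2 - δ - 1) : ℝ) * (Y - t) ^ (δ - 1) = 1 := by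
        rw [← Real.rpow_add hpos]; ring_nf; exact Real.rpow_zero _
      have e2 : (((Y - t) ^ (2 - δ - 1) : ℝ) : ℂ) * (((Y - t) ^ (δ - 1) : ℝ) : ℂ) = 1 := by
        exact_mod_cast e1
      have g1 : (Real.Gamma δ : ℂ) ≠ 0 := by exact_mod_cast (Real.Gamma_pos_of_pos h0).ne'
      have g2 : (Real.Gamma (2 - δ) : ℂ) ≠ 0 := by
        exact_mod_cast (Real.Gamma_pos_of_pos (show 0 < 2 - δ by linarith)).ne'
      rw [rlKernel]
      push_cast
      field_simp
      linear_combination h t * e2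
  have hdw : ∀ y, 0 < y → HasDerivAt (deriv w) (h y) y := fun y hy => (hd1 y hy).hasDerivAt
  have hw1 : ∀ y, 0 < y → deriv w y = B + ∫ t in (0 : ℝ)..y, h t := by
    intro y hy
    have := intervalIntegral.integral_eq_sub_of_hasDerivAt_of_tendsto hy
      (fun x hx => hdw x hx.1)
      ((intervalIntegrable_iff_integrableOn_Ioc_of_le hy.le).2 (hhi y hy)) hB
      ((hdw y hy).continuousAt.tendsto.mono_left nhdsWithin_le_nhds)
    rw [this]; ring
  have hw0 : ∀ y, 0 < y → w y = rlKernel 1 y * A + rlKernel 2 y * B + vconv (rlKernel 2) h y := by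
    intro y hy
    have hi1 : IntegrableOn (vconv (rlKernel 1) h) (Ioc 0 y) := integrableOn_vconv_rlKernel one_pos (hhi y hy)
    have hi2 : IntegrableOn (fun _ : ℝ => B) (Ioc 0 y) := by simp
    have hi : IntegrableOn (deriv w) (Ioc 0 y) := by
      refine (hi2.add hi1).congr_fun (fun t ht => ?_) measurableSet_Ioc
      rw [hw1 t ht.1, vconv_rlKernel_one]; rfl
    have := intervalIntegral.integral_eq_sub_of_hasDerivAt_of_tendsto hy
      (fun x hx => (hd0 x hx.1).hasDerivAt)
      ((intervalIntegrable_iff_integrableOn_Ioc_of_le hy.le).2 hi) hA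
      ((hd0 y hy).continuousAt.tendsto.mono_left nhdsWithin_le_nhds)
    have h2 : ∫ t in (0 : ℝ)..y, deriv w t = y * B + vconv (rlKernel 2) h y := by
      have e := vconv_rlKernel_vconv_rlKernel (b := 1) (σ := 1) one_pos one_pos hy
        (integrableOn_rlKernel_mul (by norm_num) (hhi y hy))
      rw [one_add_one_eq_two] at e
      rw [← e, vconv_rlKernel_one_apply (vconv _ _)]
      rw [intervalIntegral.integral_of_le hy.le, intervalIntegral.integral_of_le hy.le]
      rw [setIntegral_congr_fun measurableSet_Ioc
        (fun t ht => by rw [hw1 t ht.1, vconv_rlKernel_one] :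
          EqOn (deriv w) (fun t => B + vconv (rlKernel 1) h t) (Ioc 0 y)),
        integral_add hi2 hi1]
      simp [hy.le]
    rw [rlKernel_one, rlKernel_two, one_mul, add_assoc, ← h2, this]
    ring
  -- `I^{1-γ}` turns `w = I^γ u` into the primitive of `u`, and `I^{3-γ} h` into `I^{1+μ} q`
  have hprim : ∀ y, 0 < y → ∫ t in (0 : ℝ)..y, u t = ∫ t in (0 : ℝ)..y,
      (rlKernel (1 - γ) t * A + rlKernel (2 - γ) t * B + vconv (rlKernel μ) q t) := by
    intro y hy
    have hL : vconv (rlKernel (1 - γ)) w y = ∫ t in (0 : ℝ)..y, u t := by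
      rcases hγ0.eq_or_lt with h0 | h0
      · rw [hw, ← h0, rlIntegral_zero, sub_zero, vconv_rlKernel_one_apply]
      · rw [hw, rlIntegral_eq_vconv h0.ne', vconv_rlKernel_vconv_rlKernel (by linarith) h0 hy
          (integrableOn_rlKernel_mul (by linarith) (hui y hy)), sub_add_cancel, vconv_rlKernel_one_apply]
    have hR : vconv (rlKernel (1 - γ)) w y = rlKernel (1 + (1 - γ)) y * A +
        rlKernel (2 + (1 - γ)) y * B + vconv (rlKernel (1 - γ + 2)) h y := by
      rw [vconv_congr_on hy.le (fun t ht => hw0 t ht)]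
      exact vconv_rlKernel_sum (by linarith) one_pos two_pos two_pos (by linarith) hy A B (hhi y hy)
    have hhq : vconv (rlKernel (1 - γ + 2)) h y = vconv (rlKernel (1 + μ)) q y := by
      rcases hδ.eq_or_lt with h0 | h0
      · rw [show 1 - γ + 2 = 1 + μ by linarith]
        refine vconv_congr_on hy.le fun t ht => ?_
        rw [← heq t ht, ← h0, rlIntegral_zero]
      · rw [vconv_congr_on hy.le (fun t ht => (heq t ht).symm), rlIntegral_eq_vconv h0.ne',
          vconv_rlKernel_vconv_rlKernel (by linarith) h0 hy
            (integrableOn_rlKernel_mul (by linarith) (hhi y hy))]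
        rw [show 1 - γ + 2 = 1 + μ + δ by linarith]
    have hR2 := vconv_rlKernel_sum (b := 1) (c := 1 - γ) (d := 2 - γ) (e := μ) one_pos
      (by linarith) (by linarith) (by linarith) (by linarith) hy A B (hqi y hy)
    rw [vconv_rlKernel_one_apply] at hR2
    rw [hR2, ← hL, hR, hhq, show 1 + (1 - γ) = 1 - γ + 1 by ring,
      show 2 + (1 - γ) = 2 - γ + 1 by ring]
  -- differentiate the equality of primitives
  have hRc : ContinuousOn (fun t => rlKernel (1 - γ) t * A + rlKernel (2 - γ) t * B +
      vconv (rlKernel μ) q t) (Ioi 0) := by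
    refine (((continuousOn_rlKernel (by linarith)).mul continuousOn_const).add
      ((continuousOn_rlKernel (by linarith)).mul continuousOn_const)).add fun t ht => ?_
    exact (continuousAt_vconv (continuous_rlKernel hμ.le) (rlKernel_at_zero hμ) hqi
      ht).continuousWithinAt
  have hRi : ∀ Y, 0 < Y → IntegrableOn (fun t => rlKernel (1 - γ) t * A + rlKernel (2 - γ) t * B +
      vconv (rlKernel μ) q t) (Ioc 0 Y) := fun Y hY =>
    (((integrableOn_rlKernel (by linarith) hY).mul_const A).add
      ((integrableOn_rlKernel (by linarith) hY).mul_const B)).add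
        (integrableOn_vconv_rlKernel (by linarith) (hqi Y hY))
  refine (hasDerivAt_primitive huc hui hy).unique
    ((hasDerivAt_primitive hRc hRi hy).congr_of_eventuallyEq ?_)
  filter_upwards [Ioi_mem_nhds hy] with z hz
  exact hprim z hz

/-- Two derivatives of `A + y B + I²H`. -/
theorem second_primitive_spec {w H : ℝ → ℂ} {A B : ℂ} (hHc : ContinuousOn H (Ioi 0))
    (hHi : ∀ Y, 0 < Y → IntegrableOn H (Ioc 0 Y))
    (hw : ∀ y, 0 < y → w y = A + y * B + vconv (rlKernel 2) H y) :
    (∀ y, 0 < y → DifferentiableAt ℝ w y) ∧ (∀ y, 0 < y → DifferentiableAt ℝ (deriv w) y) ∧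
    (∀ y, 0 < y → deriv (deriv w) y = H y) ∧ Tendsto w (𝓝[>] 0) (𝓝 A) ∧
    Tendsto (deriv w) (𝓝[>] 0) (𝓝 B) := by
  have hI1c : ContinuousOn (fun z => ∫ t in (0 : ℝ)..z, H t) (Ioi 0) := fun z hz =>
    (hasDerivAt_primitive hHc hHi hz).continuousAt.continuousWithinAt
  have hI1i : ∀ Y, 0 < Y → IntegrableOn (fun z => ∫ t in (0 : ℝ)..z, H t) (Ioc 0 Y) := fun Y hY => by
    rw [← vconv_rlKernel_one]; exact integrableOn_vconv_rlKernel one_pos (hHi Y hY)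
  have hw' : ∀ y, 0 < y → w y = A + y * B + ∫ s in (0 : ℝ)..y, ∫ t in (0 : ℝ)..s, H t := by
    intro y hy
    have e := vconv_rlKernel_vconv_rlKernel (b := 1) (σ := 1) one_pos one_pos hy
      (integrableOn_rlKernel_mul (by norm_num) (hHi y hy))
    rw [one_add_one_eq_two, vconv_rlKernel_one, vconv_rlKernel_one] at e
    rw [hw y hy, ← e]
  have hd : ∀ y, 0 < y → HasDerivAt w (B + ∫ t in (0 : ℝ)..y, H t) y := by
    intro y hy
    have h1 : HasDerivAt (fun y : ℝ => A + y * B) B y := by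
      have := ((Complex.ofRealCLM.hasDerivAt (x := y)).mul_const B).const_add A
      simpa using this
    refine (h1.add (hasDerivAt_primitive hI1c hI1i hy)).congr_of_eventuallyEq ?_
    filter_upwards [Ioi_mem_nhds hy] with z hz
    exact hw' z hz
  have hd1 : ∀ y, 0 < y → HasDerivAt (deriv w) (H y) y := by
    intro y hy
    refine ((hasDerivAt_primitive hHc hHi hy).const_add B).congr_of_eventuallyEq ?_
    filter_upwards [Ioi_mem_nhds hy] with z hz
    exact (hd z hz).deriv
  refine ⟨fun y hy => (hd y hy).differentiableAt, fun y hy => (hd1 y hy).differentiableAt,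
    fun y hy => (hd1 y hy).deriv, ?_, ?_⟩
  · have h1 : Tendsto (fun y : ℝ => A + y * B) (𝓝[>] 0) (𝓝 A) := by
      have : Continuous fun y : ℝ => A + y * B := by fun_prop
      simpa using (this.tendsto 0).mono_left nhdsWithin_le_nhds
    have := h1.add (tendsto_primitive_zero hI1i)
    rw [add_zero] at this
    refine this.congr' ?_
    filter_upwards [self_mem_nhdsWithin] with y hy
    exact (hw' y hy).symm
  · have := (tendsto_primitive_zero hHi).const_add B
    rw [add_zero] at this
    refine this.congr' ?_
    filter_upwards [self_mem_nhdsWithin] with y hy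
    exact (hd y hy).deriv.symm

/-- The Volterra equation `n = k_c A + k_d B + k_μ * (F + ω n)` is solved by convolving with the
resolvent kernel `e_μ`, because `ω e_μ * k_b = e_b - k_b`. -/
theorem eq_mlKernel_of_volterra {μ c d y : ℝ} (hμ : 1 ≤ μ) (hc : 0 < c) (hd : 0 < d) (hy : 0 < y)
    {ω A B : ℂ} {n F : ℝ → ℂ} (hn : IntegrableOn n (Ioc 0 y)) (hF : IntegrableOn F (Ioc 0 y))
    (hae : ∀ᵐ t ∂volume.restrict (Ioc 0 y), n t = rlKernel c t * A + rlKernel d t * B +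
      vconv (rlKernel μ) (fun s => F s + ω * n s) t)
    (hpt : n y = rlKernel c y * A + rlKernel d y * B +
      vconv (rlKernel μ) (fun s => F s + ω * n s) y) :
    n y = mlKernel μ c ω y * A + mlKernel μ d ω y * B + vconv (mlKernel μ μ ω) F y := by
  have hμ0 : 0 < μ := by linarith
  have hq : IntegrableOn (fun s => F s + ω * n s) (Ioc 0 y) := hF.add (hn.const_mul ω)
  have hk := kernelBound_mlKernel hμ hμ0 ω y
  have cont := continuous_mlKernel hμ hμ ω
  -- `e * n`, computed in two ways
  have i1 := (integrableOn_continuous_mul cont (integrableOn_rlKernel hc hy)).mul_const A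
  have i2 := (integrableOn_continuous_mul cont (integrableOn_rlKernel hd hy)).mul_const B
  have i3 := integrableOn_continuous_mul cont (integrableOn_vconv_rlKernel hμ0 hq)
  simp only [mul_assoc] at i1 i2
  have hen : vconv (mlKernel μ μ ω) n y = mlKernel μ (μ + c) ω y * A + mlKernel μ (μ + d) ω y * B +
      vconv (mlKernel μ (μ + μ) ω) (fun s => F s + ω * n s) y := by
    rw [vconv_congr hy.le hae, vconv_add hy.le ?_ i3, vconv_add hy.le i1 i2, vconv_mul_const,
      vconv_mul_const, vconv_comm _ (rlKernel c), vconv_comm _ (rlKernel d),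
      vconv_rlKernel_mlKernel hμ hμ0 hc ω hy, vconv_rlKernel_mlKernel hμ hμ0 hd ω hy,
      vconv_mlKernel_vconv_rlKernel hμ hμ0 hμ0 ω hy (integrableOn_rlKernel_mul (by linarith) hq)]
    exact (i1.add i2).congr (Eventually.of_forall fun t => by simp only [Pi.add_apply]; ring)
  have cont2 := continuous_mlKernel hμ (show 1 ≤ μ + μ by linarith) ω
  have contk := continuous_rlKernel hμ
  have split : ∀ K : ℝ → ℂ, Continuous K → vconv K (fun s => F s + ω * n s) y =
      vconv K F y + ω * vconv K n y := fun K hK => by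
    rw [vconv_add hy.le (integrableOn_continuous_mul hK hF)
      (integrableOn_continuous_mul hK (hn.const_mul ω)), vconv_const_mul]
  have res : ∀ v : ℝ → ℂ, IntegrableOn v (Ioc 0 y) → vconv (mlKernel μ μ ω) v y =
      vconv (rlKernel μ) v y + ω * vconv (mlKernel μ (μ + μ) ω) v y := fun v hv => by
    have cont3 : Continuous fun t => ω * mlKernel μ (μ + μ) ω t := continuous_const.mul cont2
    have e1 := vconv_congr_kernel (u := v) hy.le (fun t ht => mlKernel_eq_add hμ hμ0 ω ht)
    have e2 := vconv_add_kernel hy.le (integrableOn_continuous_mul contk hv)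
      (integrableOn_continuous_mul cont3 hv)
    have e3 := vconv_const_mul_kernel (mlKernel μ (μ + μ) ω) v ω y
    exact e1.trans (e2.trans (congrArg _ e3))
  have hrn := res n hn
  have hrF := res F hF
  rw [split _ cont2] at hen
  rw [hpt, split _ contk, mlKernel_eq_add hμ hc ω hy, mlKernel_eq_add hμ hd ω hy, hrF,
    add_comm c μ, add_comm d μ]
  linear_combination ω * hen - ω * hrn

/-! ### Functions on the strip and their partial Fourier transforms -/

theorem measurable_psi (α θ : ℝ) : Measurable (psi α θ) := by
  have : Measurable Real.sign := by
    unfold Real.sign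
    exact Measurable.ite measurableSet_Iio measurable_const
      (Measurable.ite measurableSet_Ioi measurable_const measurable_const)
  unfold psi
  fun_prop

theorem norm_psi (α θ κ : ℝ) : ‖psi α θ κ‖ = |κ| ^ α := by
  have h := norm_exp_I_mul (Real.sign κ) (θ * Real.pi / 2)
  push_cast at h
  rw [psi, norm_mul, h, mul_one, Complex.norm_real, Real.norm_of_nonneg (by positivity)]

theorem restrict_strip (s : Set ℝ) :
    (volume : Measure (ℝ × ℝ)).restrict (univ ×ˢ s) = volume.prod (volume.restrict s) := by
  rw [Measure.volume_eq_prod, ← Measure.prod_restrict, Measure.restrict_univ]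

theorem ae_restrict_Ioi_iff {p : ℝ → Prop} :
    (∀ᵐ t ∂volume.restrict (Ioi (0 : ℝ)), p t) ↔
      ∀ Y, 0 < Y → ∀ᵐ t ∂volume.restrict (Ioc 0 Y), p t := by
  constructor
  · intro h Y _
    exact ae_restrict_of_ae_restrict_of_subset Ioc_subset_Ioi_self h
  · intro h
    have hU : Ioi (0 : ℝ) = ⋃ k : ℕ, Ioc 0 ((k : ℝ) + 1) := by
      ext t
      simp only [mem_Ioi, mem_iUnion, mem_Ioc]
      constructor
      · intro ht
        obtain ⟨k, hk⟩ := exists_nat_ge t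
        exact ⟨k, ht, by linarith⟩
      · rintro ⟨_, h, _⟩; exact h
    rw [hU, ae_restrict_iUnion_iff]
    exact fun k => h _ (by positivity)

/-- `W` is integrable on each rectangle `[-R, R] × (0, Y]`. -/
def LocIntegrableStrip (W : ℝ → ℝ → ℂ) : Prop :=
  ∀ R Y : ℝ, 0 < R → 0 < Y → IntegrableOn (Function.uncurry W) (Icc (-R) R ×ˢ Ioc 0 Y)

theorem locIntegrableStrip_of_schwartz {W : ℝ → ℝ → ℂ}
    (h : ∀ Y : ℝ, 0 < Y → ∀ φ : SchwartzMap ℝ ℂ,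
      IntegrableOn (fun p : ℝ × ℝ => W p.1 p.2 * φ p.1) (univ ×ˢ Ioc 0 Y)) :
    LocIntegrableStrip W := by
  intro R Y _ hY
  obtain ⟨η, hη⟩ := exists_schwartz_eq_one R
  refine ((h Y hY η).mono_set (prod_mono_left (subset_univ _))).congr_fun (fun p hp => ?_)
    (measurableSet_Icc.prod measurableSet_Ioc)
  simp only [hη p.1 hp.1, mul_one]
  rfl

theorem locIntegrableStrip_of_fourierT {W : ℝ → ℝ → ℂ}
    (h : ∀ Y : ℝ, 0 < Y → ∀ φ : SchwartzMap ℝ ℂ,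
      IntegrableOn (fun p : ℝ × ℝ => W p.1 p.2 * fourierT φ p.1) (univ ×ˢ Ioc 0 Y)) :
    LocIntegrableStrip W := by
  refine locIntegrableStrip_of_schwartz fun Y hY η => ?_
  obtain ⟨φ, hφ⟩ := exists_schwartz_fourierT_eq η
  simpa only [hφ] using h Y hY φ

theorem LocIntegrableStrip.ae_integrableOn {W : ℝ → ℝ → ℂ} (h : LocIntegrableStrip W) :
    ∀ᵐ x, ∀ Y, 0 < Y → IntegrableOn (W x) (Ioc 0 Y) := by
  have h1 : ∀ k : ℕ, ∀ᵐ x, x ∈ Icc (-((k : ℝ) + 1)) ((k : ℝ) + 1) →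
      IntegrableOn (W x) (Ioc 0 ((k : ℝ) + 1)) := by
    intro k
    have := h (k + 1) (k + 1) (by positivity) (by positivity)
    rw [IntegrableOn, Measure.volume_eq_prod, ← Measure.prod_restrict] at this
    exact (ae_restrict_iff' measurableSet_Icc).1 this.prod_right_ae
  filter_upwards [ae_all_iff.2 h1] with x hx Y hY
  obtain ⟨k, hk⟩ := exists_nat_ge (max |x| Y)
  refine (hx k ?_).mono_set (Ioc_subset_Ioc_right (by linarith [le_max_right |x| Y]))
  have : |x| ≤ (k : ℝ) + 1 := by linarith [le_max_left |x| Y]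
  exact abs_le.1 this

theorem LocIntegrableStrip.aestronglyMeasurable {W : ℝ → ℝ → ℂ} (h : LocIntegrableStrip W) :
    AEStronglyMeasurable (Function.uncurry W)
      ((volume : Measure ℝ).prod (volume.restrict (Ioi 0))) := by
  have hU : (univ ×ˢ Ioi (0 : ℝ) : Set (ℝ × ℝ)) =
      ⋃ k : ℕ, Icc (-((k : ℝ) + 1)) ((k : ℝ) + 1) ×ˢ Ioc 0 ((k : ℝ) + 1) := by
    ext p
    simp only [mem_prod, mem_univ, true_and, mem_Ioi, mem_iUnion, mem_Icc, mem_Ioc]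
    constructor
    · intro hp
      obtain ⟨k, hk⟩ := exists_nat_ge (max |p.1| p.2)
      have h1 : |p.1| ≤ (k : ℝ) + 1 := by linarith [le_max_left |p.1| p.2]
      exact ⟨k, abs_le.1 h1, hp, by linarith [le_max_right |p.1| p.2]⟩
    · rintro ⟨_, _, h, _⟩; exact h
  rw [← restrict_strip, hU, aestronglyMeasurable_iUnion_iff]
  exact fun k => (h _ _ (by positivity) (by positivity)).aestronglyMeasurable

/-- A jointly measurable representative, on almost every line in either direction. -/
theorem LocIntegrableStrip.exists_measurable {W : ℝ → ℝ → ℂ} (h : LocIntegrableStrip W) :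
    ∃ W' : ℝ → ℝ → ℂ, Measurable (Function.uncurry W') ∧
      (∀ᵐ x, ∀ᵐ t ∂volume.restrict (Ioi 0), W x t = W' x t) ∧
      ∀ᵐ t ∂volume.restrict (Ioi 0), ∀ᵐ x, W x t = W' x t := by
  obtain ⟨F, hF, hWF⟩ := h.aestronglyMeasurable
  refine ⟨fun x t => F (x, t), hF.measurable, Measure.ae_ae_of_ae_prod hWF, ?_⟩
  exact Measure.ae_ae_of_ae_prod ((Measure.measurePreserving_swap
    (μ := volume.restrict (Ioi (0 : ℝ)))
    (ν := (volume : Measure ℝ))).quasiMeasurePreserving.ae hWF)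

/-- The pairing property of a partial Fourier transform on `ℝ × (0, y]`, required for almost every
height only. -/
def IsPairedOn (y : ℝ) (U v : ℝ → ℝ → ℂ) : Prop :=
  ∀ φ : SchwartzMap ℝ ℂ,
    IntegrableOn (fun p : ℝ × ℝ => U p.1 p.2 * fourierT φ p.1) (univ ×ˢ Ioc 0 y) ∧
    IntegrableOn (fun p : ℝ × ℝ => v p.1 p.2 * φ p.1) (univ ×ˢ Ioc 0 y) ∧
    ∀ᵐ t ∂volume.restrict (Ioc 0 y), ∫ x, U x t * fourierT φ x = ∫ κ, v κ t * φ κ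

theorem IsPartialFourierTransform.isPairedOn {U v : ℝ → ℝ → ℂ}
    (h : IsPartialFourierTransform U v) {y : ℝ} (hy : 0 < y) : IsPairedOn y U v := fun φ =>
  ⟨(h.2 y hy φ).1, (h.2 y hy φ).2, (ae_restrict_iff' measurableSet_Ioc).2
    (Eventually.of_forall fun t ht => (h.1 t ht.1 φ).2.2)⟩

theorem IsPairedOn.sub {U v U' v' : ℝ → ℝ → ℂ} {y : ℝ} (h : IsPairedOn y U v)
    (h' : IsPairedOn y U' v') :
    IsPairedOn y (fun x t => U x t - U' x t) (fun κ t => v κ t - v' κ t) := by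
  intro φ
  obtain ⟨h1, h2, h3⟩ := h φ
  obtain ⟨h1', h2', h3'⟩ := h' φ
  simp only [sub_mul]
  refine ⟨h1.sub h1', h2.sub h2', ?_⟩
  rw [IntegrableOn, restrict_strip] at h1 h2 h1' h2'
  filter_upwards [h3, h3', h1.prod_left_ae, h2.prod_left_ae, h1'.prod_left_ae, h2'.prod_left_ae]
    with t e e' i1 i2 i1' i2'
  rw [integral_sub i1 i1', integral_sub i2 i2', e, e']

/-- Convolution in `y` commutes with the Fourier transform in `x`, at every height. -/
theorem IsPairedOn.isFourierTransform_vconv {U v : ℝ → ℝ → ℂ} {y : ℝ} (hy : 0 ≤ y) (h : IsPairedOn y U v)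
    {K : ℝ → ℂ} (hK : Continuous K) :
    IsFourierTransform (fun x => vconv K (U x) y) (fun κ => vconv K (v κ) y) := by
  intro φ
  obtain ⟨h1, h2, h3⟩ := h φ
  rw [IntegrableOn, restrict_strip] at h1 h2
  obtain ⟨C, hC⟩ := (isCompact_Icc (a := (0 : ℝ)) (b := y)).exists_bound_of_continuousOn
    hK.continuousOn
  have hbd : ∀ᵐ p : ℝ × ℝ ∂((volume : Measure ℝ).prod (volume.restrict (Ioc 0 y))),
      ‖K (y - p.2)‖ ≤ C := by
    refine Measure.quasiMeasurePreserving_snd.ae (p := fun t : ℝ => ‖K (y - t)‖ ≤ C) ?_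
    exact (ae_restrict_iff' measurableSet_Ioc).2 (Eventually.of_forall fun t ht =>
      hC _ ⟨by linarith [ht.2], by linarith [ht.1]⟩)
  have hKm : AEStronglyMeasurable (fun p : ℝ × ℝ => K (y - p.2))
      ((volume : Measure ℝ).prod (volume.restrict (Ioc 0 y))) := by
    exact (hK.comp (by fun_prop : Continuous fun p : ℝ × ℝ => y - p.2)).aestronglyMeasurable
  have g1 := h1.bdd_mul (c := C) hKm hbd
  have g2 := h2.bdd_mul (c := C) hKm hbd
  have e1 : ∀ x, vconv K (U x) y * fourierT φ x =
      ∫ t in Ioc 0 y, K (y - t) * (U x t * fourierT φ x) := fun x => by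
    rw [vconv, intervalIntegral.integral_of_le hy, ← integral_mul_const]
    congr 1; funext t; ring
  have e2 : ∀ κ, vconv K (v κ) y * φ κ =
      ∫ t in Ioc 0 y, K (y - t) * (v κ t * φ κ) := fun x => by
    rw [vconv, intervalIntegral.integral_of_le hy, ← integral_mul_const]
    congr 1; funext t; ring
  simp only [e1, e2]
  refine ⟨g1.integral_prod_left, g2.integral_prod_left, ?_⟩
  refine (integral_integral_swap (f := fun x t => K (y - t) * (U x t * fourierT φ x)) g1).trans
    (Eq.trans ?_
      (integral_integral_swap (f := fun κ t => K (y - t) * (v κ t * φ κ)) g2).symm)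
  refine integral_congr_ae ?_
  filter_upwards [h3] with t ht
  rw [integral_const_mul, integral_const_mul, ht]

theorem isPairedOn_of_integrable {Φ : ℝ → ℝ → ℂ} {y : ℝ}
    (hΦ : IntegrableOn (fun p : ℝ × ℝ => Φ p.1 p.2) (univ ×ˢ Ioc 0 y)) :
    IsPairedOn y Φ (fun κ t => fourierT (fun x => Φ x t) κ) := by
  have hΦ' := hΦ
  rw [IntegrableOn, restrict_strip] at hΦ
  set m := volume.restrict (Ioc 0 y) with hm
  have hsl := hΦ.prod_left_ae
  -- joint measurability of the transform, through a measurable representative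
  have hmeas : AEStronglyMeasurable (fun p : ℝ × ℝ => fourierT (fun x => Φ x p.2) p.1)
      ((volume : Measure ℝ).prod m) := by
    obtain ⟨F, hF, hΦF⟩ := hΦ.1
    have h1 : StronglyMeasurable (fun p : ℝ × ℝ => fourierT (fun x => F (x, p.2)) p.1) := by
      have h2 : StronglyMeasurable (fun q : (ℝ × ℝ) × ℝ =>
          F (q.2, q.1.2) * Complex.exp (Complex.I * q.1.1 * q.2)) :=
        (hF.comp_measurable (by fun_prop : Measurable fun q : (ℝ × ℝ) × ℝ => (q.2, q.1.2))).mul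
          (by fun_prop : Measurable fun q : (ℝ × ℝ) × ℝ =>
            Complex.exp (Complex.I * q.1.1 * q.2)).stronglyMeasurable
      exact h2.integral_prod_right'
    refine ⟨_, h1, ?_⟩
    have h3 : ∀ᵐ t ∂m, ∀ᵐ x, Φ x t = F (x, t) :=
      Measure.ae_ae_of_ae_prod ((Measure.measurePreserving_swap (μ := m)
        (ν := (volume : Measure ℝ))).quasiMeasurePreserving.ae hΦF)
    have h4 : ∀ᵐ t ∂m, ∀ κ, fourierT (fun x => Φ x t) κ = fourierT (fun x => F (x, t)) κ := by
      filter_upwards [h3] with t ht κ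
      refine integral_congr_ae ?_
      filter_upwards [ht] with x hx
      rw [hx]
    filter_upwards [Measure.quasiMeasurePreserving_snd.ae h4] with p hp
    exact hp p.1
  intro φ
  refine ⟨?_, ?_, ?_⟩
  · refine Integrable.mul_bdd (c := ∫ x, ‖φ x‖) hΦ'
      ((continuous_fourierT_schwartz φ).comp continuous_fst).aestronglyMeasurable
      (Eventually.of_forall fun p => norm_fourierT_le _ _)
  · rw [IntegrableOn, restrict_strip, ← hm]
    have hdom : Integrable (fun p : ℝ × ℝ => ‖φ p.1‖ * ∫ x, ‖Φ x p.2‖)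
        ((volume : Measure ℝ).prod m) := φ.integrable.norm.mul_prod hΦ.norm.integral_prod_right
    refine hdom.mono' (hmeas.mul (φ.continuous.comp continuous_fst).aestronglyMeasurable) ?_
    refine Eventually.of_forall fun p => ?_
    rw [norm_mul, mul_comm]
    gcongr
    exact norm_fourierT_le _ _
  · filter_upwards [hsl] with t ht
    exact integral_mul_fourierT ht φ.integrable

theorem IsFourierTransform.congr {u u' v v' : ℝ → ℂ} (h : IsFourierTransform u v)
    (hu : u =ᵐ[volume] u') (hv : v =ᵐ[volume] v') : IsFourierTransform u' v' := by
  intro φ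
  obtain ⟨h1, h2, h3⟩ := h φ
  have e1 : (fun x => u x * fourierT φ x) =ᵐ[volume] fun x => u' x * fourierT φ x := by
    filter_upwards [hu] with x hx; rw [hx]
  have e2 : (fun x => v x * φ x) =ᵐ[volume] fun x => v' x * φ x := by
    filter_upwards [hv] with x hx; rw [hx]
  exact ⟨h1.congr e1, h2.congr e2, by rw [← integral_congr_ae e1, h3, integral_congr_ae e2]⟩

theorem IsFourierTransform.add {u u' v v' : ℝ → ℂ} (h : IsFourierTransform u v)
    (h' : IsFourierTransform u' v') :
    IsFourierTransform (fun x => u x + u' x) (fun κ => v κ + v' κ) := by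
  intro φ
  obtain ⟨h1, h2, h3⟩ := h φ
  obtain ⟨h1', h2', h3'⟩ := h' φ
  simp only [add_mul]
  exact ⟨h1.add h1', h2.add h2', by rw [integral_add h1 h1', integral_add h2 h2', h3, h3']⟩

theorem IsFourierTransform.const_mul {u v : ℝ → ℂ} (c : ℂ) (h : IsFourierTransform u v) :
    IsFourierTransform (fun x => c * u x) (fun κ => c * v κ) := by
  intro φ
  obtain ⟨h1, h2, h3⟩ := h φ
  simp only [mul_assoc]
  exact ⟨h1.const_mul c, h2.const_mul c, by rw [integral_const_mul, integral_const_mul, h3]⟩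

theorem IsFourierTransform.ae_unique {u v v' : ℝ → ℂ} (h : IsFourierTransform u v)
    (h' : IsFourierTransform u v') : v =ᵐ[volume] v' := by
  have := ae_eq_zero_of_forall_schwartz (d := fun κ => v κ - v' κ)
    (fun φ => by simp only [sub_mul]; exact (h φ).2.1.sub (h' φ).2.1)
    (fun φ => by
      simp only [sub_mul]
      rw [integral_sub (h φ).2.1 (h' φ).2.1, ← (h φ).2.2, ← (h' φ).2.2, sub_self])
  filter_upwards [this] with κ hκ
  exact sub_eq_zero.1 hκ

/-! ### The representation of solutions -/

theorem natCeil_eq_two {μ : ℝ} (hμ1 : 1 < μ) (hμ2 : μ ≤ 2) : ⌈μ⌉₊ = 2 := by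
  rw [Nat.ceil_eq_iff (by norm_num)]
  exact ⟨by push_cast; linarith, by exact_mod_cast hμ2⟩

theorem iteratedDeriv_two_eq (w : ℝ → ℂ) : iteratedDeriv 2 w = deriv (deriv w) := by
  rw [show (2 : ℕ) = 1 + 1 from rfl, iteratedDeriv_succ, iteratedDeriv_one]

theorem termF_eq (α θ μ ν : ℝ) (f : ℝ → ℂ) (y κ : ℝ) :
    ((y ^ (-((1 - ν) * (2 - μ))) : ℝ) : ℂ) * termF α θ μ ν f y κ =
      mlKernel μ (1 - (1 - ν) * (2 - μ)) (psi α θ κ) y * fourierT f κ := by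
  rw [termF, mlKernel, show 1 - (1 - ν) * (2 - μ) - 1 = -((1 - ν) * (2 - μ)) by ring,
    mul_comm (psi α θ κ), mul_assoc]

theorem termG_eq (α θ μ ν : ℝ) (g : ℝ → ℂ) (y κ : ℝ) :
    ((y ^ (1 - (1 - ν) * (2 - μ)) : ℝ) : ℂ) * termG α θ μ ν g y κ =
      mlKernel μ (2 - (1 - ν) * (2 - μ)) (psi α θ κ) y * fourierT g κ := by
  rw [termG, mlKernel, show 2 - (1 - ν) * (2 - μ) - 1 = 1 - (1 - ν) * (2 - μ) by ring,
    mul_comm (psi α θ κ), mul_assoc]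

theorem termPhi_eq (α θ μ : ℝ) (Φ : ℝ → ℝ → ℂ) (y κ : ℝ) :
    termPhi α θ μ Φ y κ =
      vconv (mlKernel μ μ (psi α θ κ)) (fun ξ => fourierT (fun x => Φ x ξ) κ) y := by
  simp only [termPhi, prabhakar, vconv, mlKernel, mittagLeffler3_one]

/-- The transform of a solution satisfies, at every height, the Volterra equation for almost every
frequency. -/
theorem transform_volterra {α θ μ ν : ℝ} (hμ1 : 1 < μ) (hμ2 : μ ≤ 2) (hν0 : 0 ≤ ν) (hν1 : ν ≤ 1)
    {f g : ℝ → ℂ} {Φ : ℝ → ℝ → ℂ} (hf : Integrable f) (hg : Integrable g)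
    (hΦ : ∀ Y : ℝ, 0 < Y → IntegrableOn (fun p : ℝ × ℝ => Φ p.1 p.2) (univ ×ˢ Ioc 0 Y))
    {N V n : ℝ → ℝ → ℂ} (hN : IsSolution α θ μ ν f g Φ N)
    (hNn : IsPartialFourierTransform N n)
    (hVn : IsPartialFourierTransform V (fun κ y => -psi α θ κ * n κ y))
    (heq : ∀ x y : ℝ, 0 < y → V x y + hilferDeriv μ ν (N x) y = Φ x y) {y : ℝ} (hy : 0 < y) :
    ∀ᵐ κ, n κ y = rlKernel (1 - (1 - ν) * (2 - μ)) y * fourierT f κ +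
      rlKernel (2 - (1 - ν) * (2 - μ)) y * fourierT g κ +
      vconv (rlKernel μ) (fun t => fourierT (fun x => Φ x t) κ + psi α θ κ * n κ t) y := by
  have hγ0 : 0 ≤ (1 - ν) * (2 - μ) := mul_nonneg (by linarith) (by linarith)
  have hδ0 : 0 ≤ ν * (2 - μ) := mul_nonneg hν0 (by linarith)
  have hsum : (1 - ν) * (2 - μ) + ν * (2 - μ) = 2 - μ := by ring
  have hγ1 : (1 - ν) * (2 - μ) < 1 := by linarith
  have hceil := natCeil_eq_two hμ1 hμ2
  have hLN := (locIntegrableStrip_of_fourierT fun Y hY φ => (hNn.2 Y hY φ).1).ae_integrableOn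
  have hLV := (locIntegrableStrip_of_fourierT fun Y hY φ => (hVn.2 Y hY φ).1).ae_integrableOn
  have hLΦ := (locIntegrableStrip_of_fourierT fun Y hY φ =>
    (isPairedOn_of_integrable (hΦ Y hY) φ).1).ae_integrableOn
  -- the Volterra equation for almost every `x`, at every height
  have hx : ∀ᵐ x, rlKernel (1 - (1 - ν) * (2 - μ)) y * f x +
      rlKernel (2 - (1 - ν) * (2 - μ)) y * g x +
      vconv (rlKernel μ) (fun t => Φ x t - V x t) y = N x y := by
    filter_upwards [hLN, hLV, hLΦ] with x h1 h2 h3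
    have hd := hN.differentiable x
    simp only [HilferDifferentiable, hceil, Nat.cast_ofNat] at hd
    have he := heq x
    simp only [hilferDeriv, hceil, Nat.cast_ofNat, iteratedDeriv_two_eq] at he
    have huc : ContinuousOn (N x) (Ioi 0) :=
      hN.continuous.comp (f := fun t : ℝ => (x, t)) (by fun_prop) fun t ht => ⟨mem_univ _, ht⟩
    symm
    refine eq_volterra_of_hilfer hγ0 hγ1 hδ0 hμ1 hsum huc h1
      (q := fun t => Φ x t - V x t) (fun Y hY => (h3 Y hY).sub (h2 Y hY)) (fun z hz => ?_) (fun z hz => ?_) (fun z hz => ?_)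
      (fun z hz => ?_) (hN.boundary_f x) (hN.boundary_g x) hy
    · simpa using (hd z hz).2.1 0 (by norm_num)
    · simpa using (hd z hz).2.1 1 (by norm_num)
    · have := (hd z hz).2.2
      rwa [iteratedDeriv_two_eq] at this
    · rw [← he z hz]; ring
  have hpair := (isPairedOn_of_integrable (hΦ y hy)).sub (hVn.isPairedOn hy)
  have hFT := (((isFourierTransform_of_integrable hf).const_mul
    (rlKernel (1 - (1 - ν) * (2 - μ)) y)).add ((isFourierTransform_of_integrable hg).const_mul
    (rlKernel (2 - (1 - ν) * (2 - μ)) y))).add (hpair.isFourierTransform_vconv hy.le (continuous_rlKernel hμ1.le))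
  have hfin := (hNn.1 y hy).ae_unique (hFT.congr hx (EventuallyEq.refl _ _))
  filter_upwards [hfin] with κ hκ
  rw [hκ]
  congr 2
  funext t
  ring

/-- The Fourier transform of a solution, at every height. -/
theorem isFourierTransform_of_isSolution {α θ μ ν : ℝ} (hμ1 : 1 < μ) (hμ2 : μ ≤ 2) (hν0 : 0 ≤ ν)
    (hν1 : ν ≤ 1) {f g : ℝ → ℂ} {Φ : ℝ → ℝ → ℂ} (hf : Integrable f) (hg : Integrable g)
    (hΦ : ∀ Y : ℝ, 0 < Y → IntegrableOn (fun p : ℝ × ℝ => Φ p.1 p.2) (univ ×ˢ Ioc 0 Y))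
    {N : ℝ → ℝ → ℂ} (hN : IsSolution α θ μ ν f g Φ N) {y : ℝ} (hy : 0 < y) :
    IsFourierTransform (fun x => N x y) (fun κ =>
      ((y ^ (-((1 - ν) * (2 - μ))) : ℝ) : ℂ) * termF α θ μ ν f y κ +
      ((y ^ (1 - (1 - ν) * (2 - μ)) : ℝ) : ℂ) * termG α θ μ ν g y κ + termPhi α θ μ Φ y κ) := by
  obtain ⟨V, ⟨n, hNn, hVn⟩, heq⟩ := hN.equation
  have hδ0 : 0 ≤ ν * (2 - μ) := mul_nonneg hν0 (by linarith)
  have hγ1 : (1 - ν) * (2 - μ) < 1 := by nlinarith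
  have hvol := fun {t : ℝ} (ht : 0 < t) =>
    transform_volterra hμ1 hμ2 hν0 hν1 hf hg hΦ hN hNn hVn heq ht
  have hLn := locIntegrableStrip_of_schwartz fun Y hY φ => (hNn.2 Y hY φ).2
  have hLF := locIntegrableStrip_of_schwartz
      (W := fun κ t => fourierT (fun x => Φ x t) κ) fun Y hY φ =>
    (isPairedOn_of_integrable (hΦ Y hY) φ).2.1
  obtain ⟨n', hn'm, hn'1, hn'2⟩ := hLn.exists_measurable
  obtain ⟨F', hF'm, hF'1, -⟩ := hLF.exists_measurable
  have hfm : Measurable (fourierT f) := (continuous_fourierT hf).measurable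
  have hgm : Measurable (fourierT g) := (continuous_fourierT hg).measurable
  -- exchange "for every height, almost every frequency" with "for almost every frequency, almost
  -- every height", which needs measurable representatives
  have hset : MeasurableSet {p : ℝ × ℝ | n' p.1 p.2 =
      rlKernel (1 - (1 - ν) * (2 - μ)) p.2 * fourierT f p.1 +
      rlKernel (2 - (1 - ν) * (2 - μ)) p.2 * fourierT g p.1 +
      vconv (rlKernel μ) (fun t => F' p.1 t + psi α θ p.1 * n' p.1 t) p.2} := by
    refine measurableSet_eq_fun hn'm (((((measurable_rlKernel _).comp measurable_snd).mul
      (hfm.comp measurable_fst)).add (((measurable_rlKernel _).comp measurable_snd).mul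
      (hgm.comp measurable_fst))).add ?_)
    refine measurable_vconv (K := fun _ => rlKernel μ)
      (u := fun κ t => F' κ t + psi α θ κ * n' κ t)
      ((measurable_rlKernel μ).comp measurable_snd) ?_
    exact hF'm.add (((measurable_psi α θ).comp measurable_fst).mul hn'm)
  have hrep : ∀ᵐ κ, ∀ t, 0 < t →
      vconv (rlKernel μ) (fun t => fourierT (fun x => Φ x t) κ + psi α θ κ * n κ t) t =
      vconv (rlKernel μ) (fun t => F' κ t + psi α θ κ * n' κ t) t := by
    filter_upwards [hn'1, hF'1] with κ h1 h2 t ht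
    refine vconv_congr ht.le ?_
    filter_upwards [ae_restrict_Ioi_iff.1 h1 t ht, ae_restrict_Ioi_iff.1 h2 t ht] with s e1 e2
    rw [e1, e2]
  have hswap := (Measure.ae_ae_comm (μ := (volume : Measure ℝ))
    (ν := volume.restrict (Ioi (0 : ℝ)))
    (p := fun κ t => n' κ t = rlKernel (1 - (1 - ν) * (2 - μ)) t * fourierT f κ +
      rlKernel (2 - (1 - ν) * (2 - μ)) t * fourierT g κ +
      vconv (rlKernel μ) (fun t => F' κ t + psi α θ κ * n' κ t) t) hset).2 (by
    filter_upwards [hn'2, ae_restrict_mem measurableSet_Ioi] with t h1 ht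
    filter_upwards [h1, hvol ht, hrep] with κ e1 e2 e3
    rw [← e1, e2, e3 t ht])
  refine (hNn.1 y hy).congr (EventuallyEq.refl _ _) ?_
  filter_upwards [hvol hy, hswap, hn'1, hrep, hLn.ae_integrableOn, hLF.ae_integrableOn]
    with κ e1 e2 e3 e4 i1 i2
  rw [termF_eq, termG_eq, termPhi_eq]
  refine eq_mlKernel_of_volterra hμ1.le (by linarith) (by linarith) hy (i1 y hy) (i2 y hy) ?_ e1
  filter_upwards [ae_restrict_Ioi_iff.1 e2 y hy, ae_restrict_Ioi_iff.1 e3 y hy,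
    ae_restrict_mem measurableSet_Ioc] with t a1 a2 ht
  rw [a2, a1, e4 t ht.1]

theorem formula_eq_formulaPrabhakar (α θ μ ν : ℝ) (f g : ℝ → ℂ) (Φ : ℝ → ℝ → ℂ) (x y : ℝ) :
    formula α θ μ ν f g Φ x y = formulaPrabhakar α θ μ ν f g Φ x y := by
  rw [formula, formulaPrabhakar]
  congr 1
  · congr 1 <;> simp only [invFourierT, termF, termG] <;> ring
  · rw [invFourierT]
    congr 2
    funext κ
    rw [termPhi_eq, vconv, ← intervalIntegral.integral_mul_const]
    congr 1; funext ξ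
    rw [mlKernel, mul_comm (psi α θ κ)]

theorem invFourierT_add {u v : ℝ → ℂ} (hu : Integrable u) (hv : Integrable v) (x : ℝ) :
    invFourierT (fun κ => u κ + v κ) x = invFourierT u x + invFourierT v x := by
  have hE : AEStronglyMeasurable (fun κ : ℝ => Complex.exp (-Complex.I * κ * x)) volume :=
    Continuous.aestronglyMeasurable (by fun_prop)
  have hb : ∀ᵐ κ : ℝ, ‖Complex.exp (-Complex.I * κ * x)‖ ≤ 1 :=
    Eventually.of_forall fun κ => (norm_exp_neg_I_mul κ x).le
  simp only [invFourierT, add_mul]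
  rw [integral_add (hu.mul_bdd hE hb) (hv.mul_bdd hE hb), mul_add]

theorem invFourierT_const_mul (c : ℂ) (u : ℝ → ℂ) (x : ℝ) :
    invFourierT (fun κ => c * u κ) x = c * invFourierT u x := by
  simp only [invFourierT, mul_assoc]
  rw [integral_const_mul]
  ring

theorem formulaPrabhakar_eq_invFourierT {α θ μ ν : ℝ} {f g : ℝ → ℂ} {Φ : ℝ → ℝ → ℂ} {y : ℝ}
    (h : FormulaConverges α θ μ ν f g Φ y) (x : ℝ) :
    formulaPrabhakar α θ μ ν f g Φ x y = invFourierT (fun κ =>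
      ((y ^ (-((1 - ν) * (2 - μ))) : ℝ) : ℂ) * termF α θ μ ν f y κ +
      ((y ^ (1 - (1 - ν) * (2 - μ)) : ℝ) : ℂ) * termG α θ μ ν g y κ + termPhi α θ μ Φ y κ) x := by
  have i1 := h.1.const_mul ((y ^ (-((1 - ν) * (2 - μ))) : ℝ) : ℂ)
  have i2 := h.2.1.const_mul ((y ^ (1 - (1 - ν) * (2 - μ)) : ℝ) : ℂ)
  rw [formulaPrabhakar, ← invFourierT_const_mul, ← invFourierT_const_mul, ← invFourierT_add i1 i2]
  exact (invFourierT_add (i1.add i2) h.2.2 x).symm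

/-- A solution is given by the formula wherever the formula converges. -/
theorem eq_formulaPrabhakar_of_isSolution {α θ μ ν : ℝ} (hμ1 : 1 < μ) (hμ2 : μ ≤ 2) (hν0 : 0 ≤ ν)
    (hν1 : ν ≤ 1) {f g : ℝ → ℂ} {Φ : ℝ → ℝ → ℂ} (hf : Integrable f) (hg : Integrable g)
    (hΦ : ∀ Y : ℝ, 0 < Y → IntegrableOn (fun p : ℝ × ℝ => Φ p.1 p.2) (univ ×ˢ Ioc 0 Y))
    {N : ℝ → ℝ → ℂ} (hN : IsSolution α θ μ ν f g Φ N) {y : ℝ} (hy : 0 < y)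
    (hc : FormulaConverges α θ μ ν f g Φ y) (x : ℝ) :
    N x y = formulaPrabhakar α θ μ ν f g Φ x y := by
  have hcont : Continuous fun x => N x y :=
    hN.continuous.comp_continuous (by fun_prop : Continuous fun x : ℝ => (x, y))
      fun x => ⟨mem_univ _, hy⟩
  rw [formulaPrabhakar_eq_invFourierT hc]
  exact congrFun ((isFourierTransform_of_isSolution hμ1 hμ2 hν0 hν1 hf hg hΦ hN hy).eq_invFourierT
    hcont (((hc.1.const_mul _).add (hc.2.1.const_mul _)).add hc.2.2)) x

/-! ### Families with an integrable singularity at `y = 0` -/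

/-- A measurable family `u(·, y)` of integrable functions with `L¹`-norm `O(y^{-b})`, `b < 1`, as
`y → 0`. -/
structure TameFamily (u : ℝ → ℝ → ℂ) : Prop where
  measurable : Measurable (Function.uncurry u)
  bound : ∀ Y : ℝ, 0 < Y → ∃ M b : ℝ, 0 ≤ M ∧ b < 1 ∧ ∀ y ∈ Ioc 0 Y,
    Integrable (fun κ => u κ y) ∧ ∫ κ, ‖u κ y‖ ≤ M * y ^ (-b)

theorem TameFamily.integrable_slice {u : ℝ → ℝ → ℂ} (hu : TameFamily u) {y : ℝ} (hy : 0 < y) :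
    Integrable fun κ => u κ y := by
  obtain ⟨M, b, -, -, h⟩ := hu.bound y hy
  exact (h y ⟨hy, le_rfl⟩).1

theorem TameFamily.integrable_prod {u : ℝ → ℝ → ℂ} (hu : TameFamily u) {y : ℝ} (hy : 0 < y)
    {k : ℝ → ℂ} (hk : Measurable k)
    (hki : ∀ b : ℝ, b < 1 → IntegrableOn (fun t => ‖k t‖ * t ^ (-b)) (Ioc 0 y)) :
    Integrable (fun p : ℝ × ℝ => k p.2 * u p.1 p.2)
      ((volume : Measure ℝ).prod (volume.restrict (Ioc 0 y))) := by
  obtain ⟨M, b, hM, hb, h⟩ := hu.bound y hy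
  have hm : Measurable fun p : ℝ × ℝ => k p.2 * u p.1 p.2 :=
    (hk.comp measurable_snd).mul hu.measurable
  rw [integrable_prod_iff' hm.aestronglyMeasurable]
  constructor
  · refine (ae_restrict_iff' measurableSet_Ioc).2 (Eventually.of_forall fun t ht => ?_)
    exact (h t ht).1.const_mul (k t)
  · refine ((hki b hb).const_mul M).mono'
      hm.aestronglyMeasurable.norm.prod_swap.integral_prod_right' ?_
    refine (ae_restrict_iff' measurableSet_Ioc).2 (Eventually.of_forall fun t ht => ?_)
    rw [Real.norm_of_nonneg (integral_nonneg fun _ => norm_nonneg _)]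
    simp only [norm_mul]
    rw [integral_const_mul]
    calc ‖k t‖ * ∫ κ, ‖u κ t‖ ≤ ‖k t‖ * (M * t ^ (-b)) := by gcongr; exact (h t ht).2
      _ = _ := by ring

theorem TameFamily.integrable_strip {u : ℝ → ℝ → ℂ} (hu : TameFamily u) {y : ℝ} (hy : 0 < y) :
    Integrable (fun p : ℝ × ℝ => u p.1 p.2)
      ((volume : Measure ℝ).prod (volume.restrict (Ioc 0 y))) := by
  have := hu.integrable_prod hy (k := fun _ => 1) measurable_const (fun b hb => by
    simpa using integrableOn_rpow_neg hb hy)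
  simpa only [one_mul] using this

/-- Riemann-Liouville integration commutes with integration over the other variable. -/
theorem TameFamily.vconv_integral {u : ℝ → ℝ → ℂ} (hu : TameFamily u) {σ y : ℝ} (hσ : 0 < σ)
    (hy : 0 < y) {E : ℝ → ℂ} (hE : Continuous E) (hE1 : ∀ κ, ‖E κ‖ = 1) :
    IntegrableOn (fun t => rlKernel σ (y - t) * ∫ κ, u κ t * E κ) (Ioc 0 y) ∧
    Integrable (fun κ => vconv (rlKernel σ) (u κ) y) ∧
    vconv (rlKernel σ) (fun t => ∫ κ, u κ t * E κ) y =
      ∫ κ, vconv (rlKernel σ) (u κ) y * E κ := by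
  have h0 := hu.integrable_prod hy (k := fun t => rlKernel σ (y - t))
    ((measurable_rlKernel σ).comp (by fun_prop))
    (fun b hb => integrableOn_rlKernel_mul_rpow_neg hσ hb hy)
  have h1 : Integrable (fun p : ℝ × ℝ => rlKernel σ (y - p.2) * (u p.1 p.2 * E p.1))
      ((volume : Measure ℝ).prod (volume.restrict (Ioc 0 y))) := by
    refine (h0.mul_bdd (c := 1) (hE.comp continuous_fst).aestronglyMeasurable
      (Eventually.of_forall fun p => (hE1 p.1).le)).congr (Eventually.of_forall fun p => ?_)
    simp only [Function.comp]; ring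
  have e1 : ∀ t, ∫ κ, rlKernel σ (y - t) * (u κ t * E κ) =
      rlKernel σ (y - t) * ∫ κ, u κ t * E κ := fun t => integral_const_mul _ _
  have e2 : ∀ κ, ∫ t in Ioc 0 y, rlKernel σ (y - t) * (u κ t * E κ) =
      vconv (rlKernel σ) (u κ) y * E κ := fun κ => by
    rw [vconv, intervalIntegral.integral_of_le hy.le, ← integral_mul_const]
    congr 1; funext t; ring
  refine ⟨?_, ?_, ?_⟩
  · refine h1.integral_prod_right.congr (Eventually.of_forall fun t => ?_)
    exact e1 t
  · refine h0.integral_prod_left.congr (Eventually.of_forall fun κ => ?_)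
    simp only [vconv, intervalIntegral.integral_of_le hy.le]
  · have := integral_integral_swap (f := fun κ t => rlKernel σ (y - t) * (u κ t * E κ)) h1
    simp only [e1, e2] at this
    rw [this, vconv, intervalIntegral.integral_of_le hy.le]

theorem TameFamily.measurable_invFourierT {u : ℝ → ℝ → ℂ} (hu : TameFamily u) :
    Measurable fun p : ℝ × ℝ => invFourierT (fun κ => u κ p.2) p.1 := by
  have h2 : StronglyMeasurable (fun q : (ℝ × ℝ) × ℝ =>
      u q.2 q.1.2 * Complex.exp (-Complex.I * q.2 * q.1.1)) :=
    ((hu.measurable.comp (by fun_prop : Measurable fun q : (ℝ × ℝ) × ℝ => (q.2, q.1.2))).mul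
      (by fun_prop : Measurable fun q : (ℝ × ℝ) × ℝ =>
        Complex.exp (-Complex.I * q.2 * q.1.1))).stronglyMeasurable
  exact (h2.integral_prod_right'.measurable).const_mul _

theorem TameFamily.norm_invFourierT_le {u : ℝ → ℝ → ℂ} (hu : TameFamily u) {Y : ℝ} (hY : 0 < Y) :
    ∃ M b : ℝ, 0 ≤ M ∧ b < 1 ∧ ∀ x, ∀ y ∈ Ioc 0 Y,
      ‖invFourierT (fun κ => u κ y) x‖ ≤ M * y ^ (-b) := by
  obtain ⟨M, b, hM, hb, h⟩ := hu.bound Y hY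
  exact ⟨M, b, hM, hb, fun x y hy => (FracPoisson.norm_invFourierT_le _ _).trans (h y hy).2⟩

theorem TameFamily.integrableOn_invFourierT {u : ℝ → ℝ → ℂ} (hu : TameFamily u) (x : ℝ) {Y : ℝ}
    (hY : 0 < Y) : IntegrableOn (fun y => invFourierT (fun κ => u κ y) x) (Ioc 0 Y) := by
  obtain ⟨M, b, -, hb, h⟩ := hu.norm_invFourierT_le hY
  exact integrableOn_of_norm_le_rpow hb hY
    (hu.measurable_invFourierT.comp measurable_prodMk_left).aestronglyMeasurable (h x)

theorem TameFamily.integrableOn_rlKernel_mul_invFourierT {u : ℝ → ℝ → ℂ} (hu : TameFamily u)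
    (x : ℝ) {σ y : ℝ} (hσ : 0 < σ) (hy : 0 < y) :
    IntegrableOn (fun t => rlKernel σ (y - t) * invFourierT (fun κ => u κ t) x) (Ioc 0 y) := by
  obtain ⟨M, b, -, hb, h⟩ := hu.norm_invFourierT_le hy
  exact integrableOn_rlKernel_mul_of_norm_le_rpow hσ hb hy
    (hu.measurable_invFourierT.comp measurable_prodMk_left).aestronglyMeasurable (h x)

theorem TameFamily.vconv_invFourierT {u : ℝ → ℝ → ℂ} (hu : TameFamily u) (x : ℝ) {σ y : ℝ}
    (hσ : 0 < σ) (hy : 0 < y) :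
    vconv (rlKernel σ) (fun t => invFourierT (fun κ => u κ t) x) y =
      invFourierT (fun κ => vconv (rlKernel σ) (u κ) y) x := by
  have := (hu.vconv_integral hσ hy (E := fun κ : ℝ => Complex.exp (-Complex.I * κ * x))
    (by fun_prop) (fun κ => norm_exp_neg_I_mul κ x)).2.2
  simp only [invFourierT]
  rw [vconv_const_mul, this]

theorem TameFamily.isPartialFourierTransform {u U : ℝ → ℝ → ℂ} (hu : TameFamily u)
    (hU : ∀ x y, 0 < y → U x y = invFourierT (fun κ => u κ y) x) :
    IsPartialFourierTransform U u := by
  refine ⟨fun y hy => ?_, fun Y hY φ => ⟨?_, ?_⟩⟩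
  · rw [show (fun x => U x y) = invFourierT (fun κ => u κ y) from funext fun x => hU x y hy]
    exact isFourierTransform_invFourierT (hu.integrable_slice hy)
  · obtain ⟨M, b, hM, hb, h⟩ := hu.norm_invFourierT_le hY
    have hi : IntegrableOn (fun p : ℝ × ℝ => invFourierT (fun κ => u κ p.2) p.1 *
        fourierT φ p.1) (univ ×ˢ Ioc 0 Y) := by
      rw [IntegrableOn, restrict_strip]
      have hdom := (integrable_fourierT_schwartz φ).norm.mul_prod
        ((integrableOn_rpow_neg hb hY).const_mul M)
      refine hdom.mono' (hu.measurable_invFourierT.mul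
        ((continuous_fourierT_schwartz φ).measurable.comp measurable_fst)).aestronglyMeasurable ?_
      have hae : ∀ᵐ t ∂volume.restrict (Ioc 0 Y), t ∈ Ioc 0 Y := ae_restrict_mem measurableSet_Ioc
      filter_upwards [Measure.quasiMeasurePreserving_snd.ae hae] with p hp
      rw [norm_mul, mul_comm]
      gcongr
      exact h p.1 p.2 hp
    refine hi.congr_fun (fun p hp => ?_) (MeasurableSet.univ.prod measurableSet_Ioc)
    simp only [hU p.1 p.2 hp.2.1]
  · obtain ⟨C, hC⟩ := exists_bound_schwartz φ
    rw [IntegrableOn, restrict_strip]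
    exact (hu.integrable_strip hY).mul_bdd (c := C)
      (φ.continuous.comp continuous_fst).aestronglyMeasurable
      (Eventually.of_forall fun p => hC p.1)

/-! ### Exponentially weighted families -/

/-- The weight `exp(c |ω(κ)|^{1/a})`, which dominates the growth of Mittag-Leffler factors. -/
noncomputable def expWeight (a : ℝ) (ω : ℝ → ℂ) (c κ : ℝ) : ℝ := Real.exp (c * ‖ω κ‖ ^ (1 / a))

theorem expWeight_add (a : ℝ) (ω : ℝ → ℂ) (c d κ : ℝ) :
    expWeight a ω (c + d) κ = expWeight a ω c κ * expWeight a ω d κ := by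
  rw [expWeight, expWeight, expWeight, ← Real.exp_add, add_mul]

theorem expWeight_pos (a : ℝ) (ω : ℝ → ℂ) (c κ : ℝ) : 0 < expWeight a ω c κ := Real.exp_pos _

theorem one_le_expWeight (a : ℝ) (ω : ℝ → ℂ) {c : ℝ} (hc : 0 ≤ c) (κ : ℝ) :
    1 ≤ expWeight a ω c κ := Real.one_le_exp (by positivity)

theorem measurable_expWeight (a : ℝ) {ω : ℝ → ℂ} (hω : Measurable ω) (c : ℝ) :
    Measurable (expWeight a ω c) := by
  unfold expWeight; fun_prop

/-- The symbol itself is absorbed by an increase of the weight. -/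
theorem exists_norm_le_expWeight {a : ℝ} (ha : 1 ≤ a) (ω : ℝ → ℂ) :
    ∃ C : ℝ, 0 < C ∧ ∀ κ, ‖ω κ‖ ≤ C * expWeight a ω 1 κ := by
  refine ⟨Real.Gamma (a + 1), Real.Gamma_pos_of_pos (by linarith), fun κ => ?_⟩
  have hG := Real.Gamma_pos_of_pos (show 0 < a + 1 by linarith)
  rcases (norm_nonneg (ω κ)).eq_or_lt with h | h
  · rw [← h]; exact (mul_pos hG (expWeight_pos _ _ _ _)).le
  · have := rpow_le_exp_mul_Gamma (s := a) (x := ‖ω κ‖ ^ (1 / a)) (by linarith) (by positivity)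
    rw [← Real.rpow_mul (norm_nonneg _), one_div_mul_cancel (by linarith), Real.rpow_one] at this
    rw [expWeight, one_mul, mul_comm]
    exact this

/-- Absolutely integrable with every exponential weight. -/
structure WeightedData (a : ℝ) (ω F : ℝ → ℂ) : Prop where
  measurable : Measurable F
  integrable : ∀ c : ℝ, 0 < c → Integrable fun κ => expWeight a ω c κ * ‖F κ‖

/-- A family as in `TameFamily`, with every exponential weight. -/
structure WeightedFamily (a : ℝ) (ω : ℝ → ℂ) (u : ℝ → ℝ → ℂ) : Prop where
  measurable : Measurable (Function.uncurry u)
  bound : ∀ c Y : ℝ, 0 < c → 0 < Y → ∃ M b : ℝ, 0 ≤ M ∧ b < 1 ∧ ∀ y ∈ Ioc 0 Y,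
    Integrable (fun κ => expWeight a ω c κ * ‖u κ y‖) ∧
    ∫ κ, expWeight a ω c κ * ‖u κ y‖ ≤ M * y ^ (-b)

section WeightedFamily

variable {a : ℝ} {ω : ℝ → ℂ}

theorem WeightedFamily.tameFamily {u : ℝ → ℝ → ℂ} (hu : WeightedFamily a ω u) : TameFamily u := by
  refine ⟨hu.measurable, fun Y hY => ?_⟩
  obtain ⟨M, b, hM, hb, h⟩ := hu.bound 1 Y one_pos hY
  refine ⟨M, b, hM, hb, fun y hy => ?_⟩
  obtain ⟨h1, h2⟩ := h y hy
  have hle : ∀ κ, ‖u κ y‖ ≤ expWeight a ω 1 κ * ‖u κ y‖ := fun κ =>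
    le_mul_of_one_le_left (norm_nonneg _) (one_le_expWeight a ω zero_le_one κ)
  have hi : Integrable fun κ => u κ y :=
    h1.mono' (hu.measurable.comp measurable_prodMk_right).aestronglyMeasurable
      (Eventually.of_forall hle)
  exact ⟨hi, (integral_mono hi.norm h1 hle).trans h2⟩

theorem rpow_neg_le_mul_rpow_neg {b₁ b y Y : ℝ} (hb : b₁ ≤ b) (hy : y ∈ Ioc 0 Y) :
    y ^ (-b₁) ≤ Y ^ (b - b₁) * y ^ (-b) := by
  rw [show -b₁ = (b - b₁) + -b by ring, Real.rpow_add hy.1]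
  have := Real.rpow_le_rpow hy.1.le hy.2 (show 0 ≤ b - b₁ by linarith)
  have := hy.1
  gcongr

theorem WeightedFamily.add (hω : Measurable ω) {u v : ℝ → ℝ → ℂ} (hu : WeightedFamily a ω u)
    (hv : WeightedFamily a ω v) : WeightedFamily a ω (fun κ y => u κ y + v κ y) := by
  refine ⟨hu.measurable.add hv.measurable, fun c Y hc hY => ?_⟩
  obtain ⟨M₁, b₁, hM₁, hb₁, h₁⟩ := hu.bound c Y hc hY
  obtain ⟨M₂, b₂, hM₂, hb₂, h₂⟩ := hv.bound c Y hc hY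
  refine ⟨M₁ * Y ^ (max b₁ b₂ - b₁) + M₂ * Y ^ (max b₁ b₂ - b₂), max b₁ b₂, by positivity,
    max_lt hb₁ hb₂, fun y hy => ?_⟩
  obtain ⟨i₁, l₁⟩ := h₁ y hy
  obtain ⟨i₂, l₂⟩ := h₂ y hy
  have hle : ∀ κ, expWeight a ω c κ * ‖u κ y + v κ y‖ ≤
      expWeight a ω c κ * ‖u κ y‖ + expWeight a ω c κ * ‖v κ y‖ := fun κ => by
    rw [← mul_add]
    have := (expWeight_pos a ω c κ).le
    gcongr
    exact norm_add_le _ _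
  have hw : AEStronglyMeasurable (fun κ => expWeight a ω c κ * ‖u κ y + v κ y‖) volume :=
    ((measurable_expWeight a hω c).mul
      ((hu.measurable.add hv.measurable).comp measurable_prodMk_right).norm).aestronglyMeasurable
  have hi := (i₁.add i₂).mono' hw (Eventually.of_forall fun κ => by
    rw [Real.norm_of_nonneg (mul_nonneg (expWeight_pos a ω c κ).le (norm_nonneg _))]
    exact hle κ)
  refine ⟨hi, (integral_mono hi (i₁.add i₂) hle).trans ?_⟩
  simp only [Pi.add_apply]
  rw [integral_add i₁ i₂]
  have r₁ := rpow_neg_le_mul_rpow_neg (le_max_left b₁ b₂) hy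
  have r₂ := rpow_neg_le_mul_rpow_neg (le_max_right b₁ b₂) hy
  calc _ ≤ M₁ * y ^ (-b₁) + M₂ * y ^ (-b₂) := add_le_add l₁ l₂
    _ ≤ M₁ * (Y ^ (max b₁ b₂ - b₁) * y ^ (-max b₁ b₂)) +
        M₂ * (Y ^ (max b₁ b₂ - b₂) * y ^ (-max b₁ b₂)) := by gcongr
    _ = _ := by ring

theorem WeightedFamily.symbol_mul (ha : 1 ≤ a) (hω : Measurable ω) {u : ℝ → ℝ → ℂ}
    (hu : WeightedFamily a ω u) : WeightedFamily a ω (fun κ y => ω κ * u κ y) := by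
  obtain ⟨C, hC, hle⟩ := exists_norm_le_expWeight ha ω
  refine ⟨(hω.comp measurable_fst).mul hu.measurable, fun c Y hc hY => ?_⟩
  obtain ⟨M, b, hM, hb, h⟩ := hu.bound (c + 1) Y (by linarith) hY
  refine ⟨C * M, b, by positivity, hb, fun y hy => ?_⟩
  obtain ⟨i, l⟩ := h y hy
  have hd : ∀ κ, expWeight a ω c κ * ‖ω κ * u κ y‖ ≤
      C * (expWeight a ω (c + 1) κ * ‖u κ y‖) := fun κ => by
    rw [norm_mul, expWeight_add]
    have := expWeight_pos a ω c κ
    calc expWeight a ω c κ * (‖ω κ‖ * ‖u κ y‖)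
        ≤ expWeight a ω c κ * ((C * expWeight a ω 1 κ) * ‖u κ y‖) := by gcongr; exact hle κ
      _ = _ := by ring
  have hi : Integrable fun κ => expWeight a ω c κ * ‖ω κ * u κ y‖ :=
    (i.const_mul C).mono' ((measurable_expWeight a hω c).mul
      (hω.mul (hu.measurable.comp measurable_prodMk_right)).norm).aestronglyMeasurable
      (Eventually.of_forall fun κ => by
        rw [Real.norm_of_nonneg (mul_nonneg (expWeight_pos a ω c κ).le (norm_nonneg _))]
        exact hd κ)
  refine ⟨hi, (integral_mono hi (i.const_mul C) hd).trans ?_⟩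
  rw [integral_const_mul, mul_assoc]
  gcongr

theorem measurable_mlKernel_symbol {b : ℝ} (ha : 1 ≤ a) (hb : 0 < b) (hω : Measurable ω) :
    Measurable (Function.uncurry fun κ s => mlKernel a b (ω κ) s) :=
  (measurable_mlKernel ha hb).comp ((hω.comp measurable_fst).prodMk measurable_snd)

/-- The growth of a Mittag-Leffler kernel on `(0, Y]`, in terms of the weight. -/
theorem exists_norm_mlKernel_le_expWeight {b : ℝ} (ha : 1 ≤ a) (hb : 0 < b) (ω : ℝ → ℂ) :
    ∃ C : ℝ, 0 < C ∧ ∀ Y κ s, s ∈ Ioc 0 Y →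
      ‖mlKernel a b (ω κ) s‖ ≤ C * expWeight a ω (3 * Y) κ * ‖rlKernel b s‖ := by
  obtain ⟨C, hC, h⟩ := exists_norm_mlKernel_le ha hb
  have hG := Real.Gamma_pos_of_pos hb
  refine ⟨C * Real.Gamma b, by positivity, fun Y κ s hs => (h (ω κ) s hs.1).trans ?_⟩
  rw [norm_rlKernel hb hs.1, expWeight]
  have e : C * Real.Gamma b * Real.exp (3 * Y * ‖ω κ‖ ^ (1 / a)) * (s ^ (b - 1) / Real.Gamma b) =
      C * Real.exp (3 * (Y * ‖ω κ‖ ^ (1 / a))) * s ^ (b - 1) := by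
    rw [mul_assoc 3]; field_simp
  rw [e]
  have := hs.1
  have := hs.2
  gcongr

theorem WeightedData.mlKernel_mul {b : ℝ} (ha : 1 ≤ a) (hb : 0 < b) (hω : Measurable ω)
    {F : ℝ → ℂ} (hF : WeightedData a ω F) :
    WeightedFamily a ω (fun κ y => mlKernel a b (ω κ) y * F κ) := by
  obtain ⟨C, hC, hle⟩ := exists_norm_mlKernel_le_expWeight ha hb ω
  have hG := Real.Gamma_pos_of_pos hb
  have hmeas : Measurable (Function.uncurry fun κ y => mlKernel a b (ω κ) y * F κ) :=
    (measurable_mlKernel_symbol ha hb hω).mul (hF.measurable.comp measurable_fst)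
  refine ⟨hmeas, fun c Y hc hY => ?_⟩
  have i := hF.integrable (c + 3 * Y) (by positivity)
  have hI : 0 ≤ ∫ κ, expWeight a ω (c + 3 * Y) κ * ‖F κ‖ :=
    integral_nonneg fun κ => mul_nonneg (expWeight_pos _ _ _ _).le (norm_nonneg _)
  refine ⟨C / Real.Gamma b * ∫ κ, expWeight a ω (c + 3 * Y) κ * ‖F κ‖, 1 - b, by positivity,
    by linarith, fun y hy => ?_⟩
  have hd : ∀ κ, expWeight a ω c κ * ‖mlKernel a b (ω κ) y * F κ‖ ≤
      (C * ‖rlKernel b y‖) * (expWeight a ω (c + 3 * Y) κ * ‖F κ‖) := fun κ => by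
    rw [norm_mul, expWeight_add]
    have := expWeight_pos a ω c κ
    calc expWeight a ω c κ * (‖mlKernel a b (ω κ) y‖ * ‖F κ‖)
        ≤ expWeight a ω c κ * ((C * expWeight a ω (3 * Y) κ * ‖rlKernel b y‖) * ‖F κ‖) := by
          gcongr; exact hle Y κ y hy
      _ = _ := by ring
  have hi : Integrable fun κ => expWeight a ω c κ * ‖mlKernel a b (ω κ) y * F κ‖ :=
    (i.const_mul _).mono' ((measurable_expWeight a hω c).mul
      (hmeas.comp measurable_prodMk_right).norm).aestronglyMeasurable
      (Eventually.of_forall fun κ => by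
        rw [Real.norm_of_nonneg (mul_nonneg (expWeight_pos a ω c κ).le (norm_nonneg _))]
        exact hd κ)
  refine ⟨hi, (integral_mono hi (i.const_mul _) hd).trans_eq ?_⟩
  rw [integral_const_mul, norm_rlKernel hb hy.1, neg_sub]
  ring

theorem WeightedFamily.integrable_prod (hω : Measurable ω) {u : ℝ → ℝ → ℂ}
    (hu : WeightedFamily a ω u) {c y : ℝ} (hc : 0 < c) (hy : 0 < y) {k : ℝ → ℝ}
    (hk : Measurable k) (hk0 : ∀ t, 0 ≤ k t)
    (hki : ∀ b : ℝ, b < 1 → IntegrableOn (fun t => k t * t ^ (-b)) (Ioc 0 y)) :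
    Integrable (fun p : ℝ × ℝ => k p.2 * (expWeight a ω c p.1 * ‖u p.1 p.2‖))
      ((volume : Measure ℝ).prod (volume.restrict (Ioc 0 y))) := by
  obtain ⟨M, b, hM, hb, h⟩ := hu.bound c y hc hy
  have hm : Measurable fun p : ℝ × ℝ => k p.2 * (expWeight a ω c p.1 * ‖u p.1 p.2‖) :=
    (hk.comp measurable_snd).mul
      (((measurable_expWeight a hω c).comp measurable_fst).mul hu.measurable.norm)
  rw [integrable_prod_iff' hm.aestronglyMeasurable]
  constructor
  · refine (ae_restrict_iff' measurableSet_Ioc).2 (Eventually.of_forall fun t ht => ?_)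
    exact (h t ht).1.const_mul (k t)
  · refine ((hki b hb).const_mul M).mono'
      hm.aestronglyMeasurable.norm.prod_swap.integral_prod_right' ?_
    refine (ae_restrict_iff' measurableSet_Ioc).2 (Eventually.of_forall fun t ht => ?_)
    rw [Real.norm_of_nonneg (integral_nonneg fun _ => norm_nonneg _)]
    have : ∀ κ, ‖k t * (expWeight a ω c κ * ‖u κ t‖)‖ = k t * (expWeight a ω c κ * ‖u κ t‖) :=
      fun κ => Real.norm_of_nonneg (mul_nonneg (hk0 t)
        (mul_nonneg (expWeight_pos a ω c κ).le (norm_nonneg _)))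
    simp only [this]
    rw [integral_const_mul]
    have hkt := hk0 t
    calc k t * ∫ κ, expWeight a ω c κ * ‖u κ t‖ ≤ k t * (M * t ^ (-b)) := by
          gcongr; exact (h t ht).2
      _ = _ := by ring

theorem WeightedFamily.vconv_mlKernel {d : ℝ} (ha : 1 ≤ a) (hd : 0 < d) (hω : Measurable ω)
    {u : ℝ → ℝ → ℂ} (hu : WeightedFamily a ω u) :
    WeightedFamily a ω (fun κ y => vconv (mlKernel a d (ω κ)) (u κ) y) := by
  obtain ⟨C, hC, hle⟩ := exists_norm_mlKernel_le_expWeight ha hd ω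
  have hmeas : Measurable (Function.uncurry fun κ y => vconv (mlKernel a d (ω κ)) (u κ) y) :=
    measurable_vconv (measurable_mlKernel_symbol ha hd hω) hu.measurable
  refine ⟨hmeas, fun c Y hc hY => ?_⟩
  obtain ⟨M, b, hM, hb, h⟩ := hu.bound (c + 3 * Y) Y (by positivity) hY
  have hG1 := Real.Gamma_pos_of_pos (show 0 < 1 - b by linarith)
  have hG2 := Real.Gamma_pos_of_pos (show 0 < 1 - b + d by linarith)
  refine ⟨C * (M * (Real.Gamma (1 - b) / Real.Gamma (1 - b + d))), b - d, by positivity,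
    by linarith, fun y hy => ?_⟩
  have hy0 := hy.1
  have hprod := hu.integrable_prod hω (c := c + 3 * Y) (by positivity) hy0
    (k := fun t => ‖rlKernel d (y - t)‖) (((measurable_rlKernel d).comp (by fun_prop)).norm)
    (fun _ => norm_nonneg _) (fun b hb => integrableOn_rlKernel_mul_rpow_neg hd hb hy0)
  -- the weighted norm of the convolution is dominated by an integral over `t` ...
  have hae : ∀ᵐ t : ℝ, t ≠ y := by simp [ae_iff, measure_singleton]
  have hdom : ∀ᵐ κ, expWeight a ω c κ * ‖vconv (mlKernel a d (ω κ)) (u κ) y‖ ≤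
      C * ∫ t in Ioc 0 y, ‖rlKernel d (y - t)‖ * (expWeight a ω (c + 3 * Y) κ * ‖u κ t‖) := by
    filter_upwards [hprod.prod_right_ae] with κ hκ
    have hw := expWeight_pos a ω c κ
    rw [vconv, intervalIntegral.integral_of_le hy0.le, ← integral_const_mul]
    have e1 : expWeight a ω c κ * ‖∫ t in Ioc 0 y, mlKernel a d (ω κ) (y - t) * u κ t‖ =
        ‖∫ t in Ioc 0 y, (expWeight a ω c κ : ℂ) * (mlKernel a d (ω κ) (y - t) * u κ t)‖ := by
      rw [integral_const_mul, norm_mul, Complex.norm_real, Real.norm_of_nonneg hw.le]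
    rw [e1]
    refine norm_integral_le_of_norm_le (hκ.const_mul C) ?_
    rw [ae_restrict_iff' measurableSet_Ioc]
    filter_upwards [hae] with t hty ht
    have hyt : y - t ∈ Ioc 0 Y :=
      ⟨sub_pos.2 (lt_of_le_of_ne ht.2 hty), by linarith [ht.1, hy.2]⟩
    rw [norm_mul, norm_mul, Complex.norm_real, Real.norm_of_nonneg hw.le, expWeight_add]
    calc expWeight a ω c κ * (‖mlKernel a d (ω κ) (y - t)‖ * ‖u κ t‖)
        ≤ expWeight a ω c κ *
          ((C * expWeight a ω (3 * Y) κ * ‖rlKernel d (y - t)‖) * ‖u κ t‖) := by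
          gcongr; exact hle Y κ _ hyt
      _ = _ := by ring
  have hi : Integrable fun κ => expWeight a ω c κ * ‖vconv (mlKernel a d (ω κ)) (u κ) y‖ :=
    (hprod.integral_prod_left.const_mul C).mono' ((measurable_expWeight a hω c).mul
      (hmeas.comp measurable_prodMk_right).norm).aestronglyMeasurable (by
        filter_upwards [hdom] with κ hκ
        rw [Real.norm_of_nonneg (mul_nonneg (expWeight_pos a ω c κ).le (norm_nonneg _))]
        exact hκ)
  refine ⟨hi, (integral_mono_ae hi (hprod.integral_prod_left.const_mul C) hdom).trans ?_⟩
  -- ... whose integral over `κ` is a beta integral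
  have hswap := integral_integral_swap (f := fun κ t => ‖rlKernel d (y - t)‖ *
    (expWeight a ω (c + 3 * Y) κ * ‖u κ t‖)) hprod
  rw [integral_const_mul, hswap]
  have hle2 : ∫ t in Ioc 0 y, ∫ κ, ‖rlKernel d (y - t)‖ *
      (expWeight a ω (c + 3 * Y) κ * ‖u κ t‖) ≤
      M * (Real.Gamma (1 - b) / Real.Gamma (1 - b + d) * y ^ (-(b - d))) := by
    rw [← integral_rlKernel_mul_rpow_neg hd hb hy0, ← integral_const_mul]
    refine setIntegral_mono_on hprod.integral_prod_right
      ((integrableOn_rlKernel_mul_rpow_neg hd hb hy0).const_mul M) measurableSet_Ioc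
      fun t ht => ?_
    rw [integral_const_mul]
    calc _ ≤ ‖rlKernel d (y - t)‖ * (M * t ^ (-b)) := by
          gcongr; exact (h t ⟨ht.1, ht.2.trans hy.2⟩).2
      _ = _ := by ring
  calc _ ≤ C * (M * (Real.Gamma (1 - b) / Real.Gamma (1 - b + d) * y ^ (-(b - d)))) :=
        mul_le_mul_of_nonneg_left hle2 hC.le
    _ = _ := by ring

/-! ### Domination and continuity away from `y = 0` -/

/-- On each `[y₀, Y] ⊂ (0, ∞)` the family is dominated by one integrable function, with every
exponential weight. -/
def LocDominated (a : ℝ) (ω : ℝ → ℂ) (u : ℝ → ℝ → ℂ) : Prop :=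
  ∀ c y₀ Y : ℝ, 0 < c → 0 < y₀ → y₀ ≤ Y → ∃ G : ℝ → ℝ, Integrable G ∧
    ∀ᵐ κ, ∀ y ∈ Icc y₀ Y, expWeight a ω c κ * ‖u κ y‖ ≤ G κ

theorem LocDominated.add {u v : ℝ → ℝ → ℂ} (hu : LocDominated a ω u) (hv : LocDominated a ω v) :
    LocDominated a ω (fun κ y => u κ y + v κ y) := by
  intro c y₀ Y hc hy hY
  obtain ⟨G, hG, h⟩ := hu c y₀ Y hc hy hY
  obtain ⟨G', hG', h'⟩ := hv c y₀ Y hc hy hY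
  refine ⟨_, hG.add hG', ?_⟩
  filter_upwards [h, h'] with κ e e' y hy
  have := expWeight_pos a ω c κ
  calc expWeight a ω c κ * ‖u κ y + v κ y‖
      ≤ expWeight a ω c κ * (‖u κ y‖ + ‖v κ y‖) := by gcongr; exact norm_add_le _ _
    _ = expWeight a ω c κ * ‖u κ y‖ + expWeight a ω c κ * ‖v κ y‖ := by ring
    _ ≤ _ := add_le_add (e y hy) (e' y hy)

theorem LocDominated.symbol_mul (ha : 1 ≤ a) {u : ℝ → ℝ → ℂ}
    (hu : LocDominated a ω u) : LocDominated a ω (fun κ y => ω κ * u κ y) := by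
  obtain ⟨C, hC, hle⟩ := exists_norm_le_expWeight ha ω
  intro c y₀ Y hc hy hY
  obtain ⟨G, hG, h⟩ := hu (c + 1) y₀ Y (by linarith) hy hY
  refine ⟨_, hG.const_mul C, ?_⟩
  filter_upwards [h] with κ e y hy
  have := expWeight_pos a ω c κ
  have e := e y hy
  rw [expWeight_add] at e
  calc expWeight a ω c κ * ‖ω κ * u κ y‖
      = expWeight a ω c κ * (‖ω κ‖ * ‖u κ y‖) := by rw [norm_mul]
    _ ≤ expWeight a ω c κ * ((C * expWeight a ω 1 κ) * ‖u κ y‖) := by gcongr; exact hle κ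
    _ = C * (expWeight a ω c κ * expWeight a ω 1 κ * ‖u κ y‖) := by ring
    _ ≤ _ := by gcongr

theorem WeightedData.locDominated {b : ℝ} (ha : 1 ≤ a) (hb : 0 < b)
    {F : ℝ → ℂ} (hF : WeightedData a ω F) :
    LocDominated a ω (fun κ y => mlKernel a b (ω κ) y * F κ) := by
  obtain ⟨C, hC, hle⟩ := exists_norm_mlKernel_le_expWeight ha hb ω
  intro c y₀ Y hc hy₀ hY
  obtain ⟨K, hK⟩ := (isCompact_Icc (a := y₀) (b := Y)).exists_bound_of_continuousOn
    ((continuousOn_rlKernel hb).mono fun t ht => lt_of_lt_of_le hy₀ ht.1)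
  have hY0 : 0 < Y := by linarith
  refine ⟨_, (hF.integrable (c + 3 * Y) (by positivity)).const_mul (C * K), ?_⟩
  refine Eventually.of_forall fun κ y hy => ?_
  have hw := expWeight_pos a ω c κ
  have hw' := expWeight_pos a ω (3 * Y) κ
  rw [norm_mul, expWeight_add]
  calc expWeight a ω c κ * (‖mlKernel a b (ω κ) y‖ * ‖F κ‖)
      ≤ expWeight a ω c κ * ((C * expWeight a ω (3 * Y) κ * K) * ‖F κ‖) := by
        gcongr
        refine (hle Y κ y ⟨by linarith [hy.1], hy.2⟩).trans ?_
        gcongr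
        exact hK y hy
    _ = _ := by ring

theorem WeightedFamily.locDominated_vconv {d : ℝ} (ha : 1 ≤ a) (hd : 1 ≤ d) (hω : Measurable ω)
    {u : ℝ → ℝ → ℂ} (hu : WeightedFamily a ω u) :
    LocDominated a ω (fun κ y => vconv (mlKernel a d (ω κ)) (u κ) y) := by
  have hd0 : 0 < d := by linarith
  obtain ⟨C, hC, hle⟩ := exists_norm_mlKernel_le_expWeight ha hd0 ω
  intro c y₀ Y hc hy₀ hY
  have hY0 : 0 < Y := by linarith
  obtain ⟨K, hK⟩ := (isCompact_Icc (a := (0 : ℝ)) (b := Y)).exists_bound_of_continuousOn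
    (continuous_rlKernel hd).continuousOn
  have hK0 : 0 ≤ K := (norm_nonneg _).trans (hK 0 ⟨le_rfl, hY0.le⟩)
  have hprod := hu.integrable_prod hω (c := c + 3 * Y) (by positivity) hY0
    (k := fun _ => 1) measurable_const (fun _ => zero_le_one)
    (fun b hb => by simpa using integrableOn_rpow_neg hb hY0)
  simp only [one_mul] at hprod
  have hae : ∀ y : ℝ, ∀ᵐ t : ℝ, t ≠ y := fun y => by simp [ae_iff, measure_singleton]
  refine ⟨_, hprod.integral_prod_left.const_mul (C * K), ?_⟩
  filter_upwards [hprod.prod_right_ae] with κ hκ y hy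
  have hy0 : 0 < y := by linarith [hy.1]
  have hw := expWeight_pos a ω c κ
  have hw' := expWeight_pos a ω (3 * Y) κ
  rw [vconv, intervalIntegral.integral_of_le hy0.le]
  have e1 : expWeight a ω c κ * ‖∫ t in Ioc 0 y, mlKernel a d (ω κ) (y - t) * u κ t‖ =
      ‖∫ t in Ioc 0 y, (expWeight a ω c κ : ℂ) * (mlKernel a d (ω κ) (y - t) * u κ t)‖ := by
    rw [integral_const_mul, norm_mul, Complex.norm_real, Real.norm_of_nonneg hw.le]
  have hsub : Ioc 0 y ⊆ Ioc 0 Y := Ioc_subset_Ioc_right hy.2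
  have hκ' : Integrable (fun t => expWeight a ω (c + 3 * Y) κ * ‖u κ t‖)
      (volume.restrict (Ioc 0 Y)) := hκ
  calc _ = _ := e1
    _ ≤ ∫ t in Ioc 0 y, C * K * (expWeight a ω (c + 3 * Y) κ * ‖u κ t‖) := by
        refine norm_integral_le_of_norm_le ((IntegrableOn.mono_set hκ' hsub).const_mul (C * K)) ?_
        rw [ae_restrict_iff' measurableSet_Ioc]
        filter_upwards [hae y] with t hty ht
        have hyt : y - t ∈ Ioc 0 Y :=
          ⟨sub_pos.2 (lt_of_le_of_ne ht.2 hty), by linarith [ht.1, hy.2]⟩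
        rw [norm_mul, norm_mul, Complex.norm_real, Real.norm_of_nonneg hw.le, expWeight_add]
        calc expWeight a ω c κ * (‖mlKernel a d (ω κ) (y - t)‖ * ‖u κ t‖)
            ≤ expWeight a ω c κ * ((C * expWeight a ω (3 * Y) κ * K) * ‖u κ t‖) := by
              gcongr
              refine (hle Y κ _ hyt).trans ?_
              gcongr
              exact hK _ ⟨hyt.1.le, hyt.2⟩
          _ = _ := by ring
    _ = C * K * ∫ t in Ioc 0 y, expWeight a ω (c + 3 * Y) κ * ‖u κ t‖ := integral_const_mul _ _
    _ ≤ C * K * ∫ t in Ioc 0 Y, expWeight a ω (c + 3 * Y) κ * ‖u κ t‖ := by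
        refine mul_le_mul_of_nonneg_left (setIntegral_mono_set hκ' ?_ hsub.eventuallyLE)
          (mul_nonneg hC.le hK0)
        exact Eventually.of_forall fun t => mul_nonneg (expWeight_pos _ _ _ _).le (norm_nonneg _)

/-- Joint continuity of the inverse transform of a dominated family that is continuous in `y`. -/
theorem LocDominated.continuousOn_invFourierT {u : ℝ → ℝ → ℂ} (hu : LocDominated a ω u)
    (hm : Measurable (Function.uncurry u)) (hc : ∀ κ, ContinuousOn (u κ) (Ioi 0)) :
    ContinuousOn (fun p : ℝ × ℝ => invFourierT (fun κ => u κ p.2) p.1) (univ ×ˢ Ioi 0) := by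
  intro p hp
  have hp2 : 0 < p.2 := hp.2
  obtain ⟨G, hG, h⟩ := hu 1 (p.2 / 2) (2 * p.2) one_pos (by positivity) (by linarith)
  refine ContinuousAt.continuousWithinAt (ContinuousAt.mul continuousAt_const ?_)
  refine continuousAt_of_dominated (bound := G) ?_ ?_ hG ?_
  · refine Eventually.of_forall fun q => ?_
    have h1 : Measurable fun κ : ℝ => Complex.exp (-Complex.I * κ * q.1) := by fun_prop
    exact ((hm.comp measurable_prodMk_right).mul h1).aestronglyMeasurable
  · have hnhds : {q : ℝ × ℝ | q.2 ∈ Icc (p.2 / 2) (2 * p.2)} ∈ 𝓝 p :=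
      continuous_snd.continuousAt.preimage_mem_nhds
        (Icc_mem_nhds (by linarith) (by linarith))
    filter_upwards [hnhds] with q hq
    filter_upwards [h] with κ hκ
    rw [norm_mul, norm_exp_neg_I_mul, mul_one]
    exact (le_mul_of_one_le_left (norm_nonneg _) (one_le_expWeight a ω zero_le_one κ)).trans
      (hκ q.2 hq)
  · refine Eventually.of_forall fun κ => ?_
    have h1 : ContinuousAt (fun q : ℝ × ℝ => u κ q.2) p :=
      ((hc κ).continuousAt (Ioi_mem_nhds hp2)).comp continuous_snd.continuousAt
    exact h1.mul (Continuous.continuousAt (by fun_prop))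

end WeightedFamily

/-! ### The solution in Fourier space -/

section SpectralSum

variable {a : ℝ} {ω F G : ℝ → ℂ} {X : ℝ → ℝ → ℂ} {b c d y : ℝ}

/-- The family `e_b F + e_c G + e_d * X`, where `e_b` is the Mittag-Leffler kernel of index `b` with
parameter `ω(κ)`. Riemann-Liouville integration shifts all three indices. -/
noncomputable def spectralSum (a : ℝ) (ω F G : ℝ → ℂ) (X : ℝ → ℝ → ℂ) (b c d κ y : ℝ) : ℂ :=
  mlKernel a b (ω κ) y * F κ + mlKernel a c (ω κ) y * G κ + vconv (mlKernel a d (ω κ)) (X κ) y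

theorem weightedFamily_spectralSum (ha : 1 ≤ a) (hω : Measurable ω) (hF : WeightedData a ω F)
    (hG : WeightedData a ω G) (hX : WeightedFamily a ω X) (hb : 0 < b) (hc : 0 < c) (hd : 0 < d) :
    WeightedFamily a ω (spectralSum a ω F G X b c d) :=
  ((hF.mlKernel_mul ha hb hω).add hω (hG.mlKernel_mul ha hc hω)).add hω
    (hX.vconv_mlKernel ha hd hω)

theorem locDominated_spectralSum (ha : 1 ≤ a) (hω : Measurable ω) (hF : WeightedData a ω F)
    (hG : WeightedData a ω G) (hX : WeightedFamily a ω X) (hb : 0 < b) (hc : 0 < c) (hd : 1 ≤ d) :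
    LocDominated a ω (spectralSum a ω F G X b c d) :=
  ((hF.locDominated ha hb).add (hG.locDominated ha hc)).add (hX.locDominated_vconv ha hd hω)

theorem continuousOn_spectralSum (ha : 1 ≤ a) (hb : 0 < b) (hc : 0 < c) (hd : 1 < d) {κ : ℝ}
    (hX : ∀ Y, 0 < Y → IntegrableOn (X κ) (Ioc 0 Y)) :
    ContinuousOn (spectralSum a ω F G X b c d κ) (Ioi 0) :=
  (((continuousOn_mlKernel ha hb _).mul continuousOn_const).add
    ((continuousOn_mlKernel ha hc _).mul continuousOn_const)).add fun _ ht =>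
      (continuousAt_vconv (continuous_mlKernel ha hd.le _) (mlKernel_at_zero hd _) hX
        ht).continuousWithinAt

theorem KernelBound.integrableOn {K : ℝ → ℂ} {σ : ℝ} (hσ : 0 < σ) (hb : 0 < b) (hy : 0 < y)
    (hK : KernelBound K b y) : IntegrableOn (fun t => rlKernel σ (y - t) * K t) (Ioc 0 y) := by
  obtain ⟨hm, C, hC, h⟩ := hK
  refine ((integrableOn_rlKernel_mul_rlKernel hσ hb hy).norm.const_mul C).mono'
    (((measurable_rlKernel σ).comp (by fun_prop)).mul hm).aestronglyMeasurable
    ((ae_restrict_iff' measurableSet_Ioc).2 (Eventually.of_forall fun t ht => ?_))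
  rw [norm_mul, norm_mul]
  calc ‖rlKernel σ (y - t)‖ * ‖K t‖ ≤ ‖rlKernel σ (y - t)‖ * (C * ‖rlKernel b t‖) := by
        gcongr; exact h t ht
    _ = _ := by ring

theorem spectralSum_integrable_aux (ha : 1 ≤ a) (hb : 0 < b) (hc : 0 < c) (hd : 1 ≤ d) (hy : 0 < y)
    {σ κ : ℝ} (hσ : 0 < σ) (hX : IntegrableOn (X κ) (Ioc 0 y)) :
    IntegrableOn (fun t => rlKernel σ (y - t) * (mlKernel a b (ω κ) t * F κ)) (Ioc 0 y) ∧
    IntegrableOn (fun t => rlKernel σ (y - t) * (mlKernel a c (ω κ) t * G κ)) (Ioc 0 y) ∧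
    IntegrableOn (fun t => rlKernel σ (y - t) * vconv (mlKernel a d (ω κ)) (X κ) t) (Ioc 0 y) := by
  refine ⟨?_, ?_, ?_⟩
  · have := ((kernelBound_mlKernel ha hb (ω κ) y).integrableOn hσ hb hy).mul_const (F κ)
    simp only [mul_assoc] at this
    exact this
  · have := ((kernelBound_mlKernel ha hc (ω κ) y).integrableOn hσ hc hy).mul_const (G κ)
    simp only [mul_assoc] at this
    exact this
  · exact integrableOn_mul_vconv hσ (by linarith) (kernelBound_rlKernel hσ y)
      (kernelBound_mlKernel ha (by linarith) (ω κ) y) (integrableOn_rlKernel_mul (by linarith) hX)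

theorem integrableOn_rlKernel_mul_spectralSum (ha : 1 ≤ a) (hb : 0 < b) (hc : 0 < c) (hd : 1 ≤ d)
    (hy : 0 < y) {σ κ : ℝ} (hσ : 0 < σ) (hX : IntegrableOn (X κ) (Ioc 0 y)) :
    IntegrableOn (fun t => rlKernel σ (y - t) * spectralSum a ω F G X b c d κ t) (Ioc 0 y) := by
  obtain ⟨i1, i2, i3⟩ := spectralSum_integrable_aux (ω := ω) (F := F) (G := G) ha hb hc hd hy hσ hX
  refine ((i1.add i2).add i3).congr (Eventually.of_forall fun t => ?_)
  simp only [Pi.add_apply, spectralSum]; ring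

theorem vconv_rlKernel_spectralSum (ha : 1 ≤ a) (hb : 0 < b) (hc : 0 < c) (hd : 1 ≤ d)
    (hy : 0 < y) {σ κ : ℝ} (hσ : 0 < σ) (hX : IntegrableOn (X κ) (Ioc 0 y)) :
    vconv (rlKernel σ) (spectralSum a ω F G X b c d κ) y =
      spectralSum a ω F G X (b + σ) (c + σ) (d + σ) κ y := by
  obtain ⟨i1, i2, i3⟩ := spectralSum_integrable_aux (ω := ω) (F := F) (G := G) ha hb hc hd hy hσ hX
  have i12 := i1.add i2
  have e := vconv_add hy.le (K := rlKernel σ)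
    (u := fun t => mlKernel a b (ω κ) t * F κ + mlKernel a c (ω κ) t * G κ)
    (i12.congr (Eventually.of_forall fun t => by simp only [Pi.add_apply]; ring)) i3
  refine e.trans ?_
  rw [vconv_add hy.le i1 i2, vconv_mul_const, vconv_mul_const,
    vconv_rlKernel_mlKernel ha hb hσ _ hy, vconv_rlKernel_mlKernel ha hc hσ _ hy,
    vconv_rlKernel_vconv_mlKernel ha (by linarith) hσ _ hy
      (integrableOn_rlKernel_mul (by linarith) hX), spectralSum]

/-- The resolvent identity for the family: the index shift by `a` inverts multiplication by `ω`. -/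
theorem spectralSum_eq (ha : 1 ≤ a) (hb : 0 < b) (hc : 0 < c) (hd : 1 ≤ d) (hy : 0 < y) {κ : ℝ}
    (hX : IntegrableOn (X κ) (Ioc 0 y)) :
    spectralSum a ω F G X b c d κ y =
      rlKernel b y * F κ + rlKernel c y * G κ + vconv (rlKernel d) (X κ) y +
        ω κ * spectralSum a ω F G X (b + a) (c + a) (d + a) κ y := by
  have hcont : Continuous fun t => ω κ * mlKernel a (d + a) (ω κ) t :=
    continuous_const.mul (continuous_mlKernel ha (by linarith) _)
  have e1 := vconv_congr_kernel (u := X κ) hy.le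
    (fun t ht => mlKernel_eq_add ha (show 0 < d by linarith) (ω κ) ht)
  have e2 := vconv_add_kernel hy.le (integrableOn_rlKernel_mul hd hX)
    (integrableOn_continuous_mul hcont hX)
  have e3 := vconv_const_mul_kernel (mlKernel a (d + a) (ω κ)) (X κ) (ω κ) y
  rw [spectralSum, spectralSum, mlKernel_eq_add ha hb _ hy, mlKernel_eq_add ha hc _ hy,
    e1.trans (e2.trans (congrArg _ e3))]
  ring

/-- With `m = e_{a-1} F + e_a G + e_a * X`, one has
`e_1 F + e_2 G + e_2 * X = F + y G + I²(X + ω m)`. -/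
theorem spectralSum_one_two (ha : 1 < a) (hy : 0 < y) {κ : ℝ} (hX : IntegrableOn (X κ) (Ioc 0 y)) :
    spectralSum a ω F G X 1 2 2 κ y = F κ + y * G κ +
      vconv (rlKernel 2) (fun t => X κ t + ω κ * spectralSum a ω F G X (a - 1) a a κ t) y := by
  have h1 := vconv_rlKernel_spectralSum (ω := ω) (F := F) (G := G) ha.le
    (show 0 < a - 1 by linarith) (show 0 < a by linarith) ha.le hy two_pos hX
  have i := integrableOn_rlKernel_mul_spectralSum (ω := ω) (F := F) (G := G) ha.le
    (show 0 < a - 1 by linarith) (show 0 < a by linarith) ha.le hy two_pos hX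
  have i2 : IntegrableOn (fun t => rlKernel 2 (y - t) *
      (ω κ * spectralSum a ω F G X (a - 1) a a κ t)) (Ioc 0 y) :=
    (i.const_mul (ω κ)).congr (Eventually.of_forall fun t => by ring)
  rw [spectralSum_eq ha.le one_pos two_pos one_le_two hy hX, rlKernel_one, rlKernel_two, one_mul,
    vconv_add hy.le (integrableOn_rlKernel_mul one_le_two hX) i2, vconv_const_mul, h1,
    show a - 1 + 2 = 1 + a by ring, add_comm a 2]
  ring

end SpectralSum

/-! ### Admissible data -/

theorem norm_psi_rpow {α θ μ : ℝ} (κ : ℝ) : ‖psi α θ κ‖ ^ (1 / μ) = |κ| ^ (α / μ) := by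
  rw [norm_psi, ← Real.rpow_mul (abs_nonneg _), mul_one_div]

theorem norm_weight_mul (α θ μ c κ : ℝ) (z : ℂ) :
    ‖(Real.exp (c * |κ| ^ (α / μ)) : ℂ) * z‖ = expWeight μ (psi α θ) c κ * ‖z‖ := by
  rw [norm_mul, Complex.norm_real, Real.norm_of_nonneg (Real.exp_pos _).le,
    expWeight, norm_psi_rpow]

theorem weightedData_fourierT {α θ μ : ℝ} {f : ℝ → ℂ} (hf : Integrable f)
    (h : ∀ c : ℝ, 0 < c →
      Integrable (fun κ : ℝ => (Real.exp (c * |κ| ^ (α / μ)) : ℂ) * fourierT f κ)) :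
    WeightedData μ (psi α θ) (fourierT f) := by
  refine ⟨(continuous_fourierT hf).measurable, fun c hc => ?_⟩
  simpa only [norm_weight_mul α θ μ] using (h c hc).norm

theorem WeightedData.integrable_self {a : ℝ} {ω F : ℝ → ℂ} (h : WeightedData a ω F) :
    Integrable F :=
  (h.integrable 1 one_pos).mono' h.measurable.aestronglyMeasurable (Eventually.of_forall fun κ =>
    le_mul_of_one_le_left (norm_nonneg _) (one_le_expWeight a ω zero_le_one κ))

theorem measurable_fourierT_slices {u : ℝ → ℝ → ℂ} (hu : Measurable (Function.uncurry u)) :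
    Measurable (Function.uncurry fun κ y => fourierT (fun x => u x y) κ) := by
  have h2 : StronglyMeasurable (fun q : (ℝ × ℝ) × ℝ =>
      u q.2 q.1.2 * Complex.exp (Complex.I * q.1.1 * q.2)) :=
    ((hu.comp (by fun_prop : Measurable fun q : (ℝ × ℝ) × ℝ => (q.2, q.1.2))).mul
      (by fun_prop : Measurable fun q : (ℝ × ℝ) × ℝ =>
        Complex.exp (Complex.I * q.1.1 * q.2))).stronglyMeasurable
  exact h2.integral_prod_right'.measurable

theorem TameFamily.integrableOn_fourierT {u : ℝ → ℝ → ℂ} (hu : TameFamily u) (κ : ℝ) {Y : ℝ}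
    (hY : 0 < Y) : IntegrableOn (fun y => fourierT (fun x => u x y) κ) (Ioc 0 Y) := by
  obtain ⟨M, b, -, hb, h⟩ := hu.bound Y hY
  exact integrableOn_of_norm_le_rpow hb hY
    ((measurable_fourierT_slices hu.measurable).comp measurable_prodMk_left).aestronglyMeasurable
    fun t ht => (norm_fourierT_le _ _).trans (h t ht).2

theorem TameFamily.fourierT_rlIntegral {u : ℝ → ℝ → ℂ} (hu : TameFamily u) (κ : ℝ) {δ y : ℝ}
    (hδ : 0 ≤ δ) (hy : 0 < y) : fourierT (fun x => rlIntegral δ (u x) y) κ =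
      rlIntegral δ (fun t => fourierT (fun x => u x t) κ) y := by
  rcases hδ.eq_or_lt with h | h
  · rw [← h]; simp only [rlIntegral_zero]
  · simp only [rlIntegral_eq_vconv h.ne']
    exact (hu.vconv_integral h hy (E := fun x : ℝ => Complex.exp (Complex.I * κ * x))
      (by fun_prop) (fun x => norm_exp_I_mul κ x)).2.2.symm

/-- The density `χ` of an admissible source, extended by zero to `y ≤ 0`, and its transform. -/
theorem AdmissibleData.exists_density {α μ ν : ℝ} {f g : ℝ → ℂ} {Φ : ℝ → ℝ → ℂ}
    (h : AdmissibleData α μ ν f g Φ) (θ : ℝ) :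
    ∃ χ : ℝ → ℝ → ℂ, TameFamily χ ∧
      WeightedFamily μ (psi α θ) (fun κ y => fourierT (fun x => χ x y) κ) ∧
      (∀ x, ContinuousOn (χ x) (Ioi 0)) ∧
      (∀ x y, 0 < y → invFourierT (fun κ => fourierT (fun x => χ x y) κ) x = χ x y) ∧
      ∀ x y, 0 < y → Φ x y = rlIntegral (ν * (2 - μ)) (χ x) y := by
  obtain ⟨χ, hc, hΦ, hb⟩ := h.source
  have hcx : ∀ x, ContinuousOn (χ x) (Ioi 0) := fun x =>
    hc.comp (f := fun t : ℝ => (x, t)) (by fun_prop) fun t ht => ⟨mem_univ _, ht⟩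
  have hcy : ∀ y, 0 < y → Continuous fun x => χ x y := fun y hy =>
    hc.comp_continuous (by fun_prop : Continuous fun x : ℝ => (x, y)) fun x => ⟨mem_univ _, hy⟩
  set χ' : ℝ → ℝ → ℂ := fun x y => if 0 < y then χ x y else 0 with hχ'
  have heq : ∀ x y, 0 < y → χ' x y = χ x y := fun x y hy => if_pos hy
  have heqf : ∀ y, 0 < y → (fun x => χ' x y) = fun x => χ x y := fun y hy =>
    funext fun x => heq x y hy
  have hm : Measurable (Function.uncurry χ') := by
    classical
    have hS : MeasurableSet (univ ×ˢ Ioi 0 : Set (ℝ × ℝ)) := MeasurableSet.univ.prod measurableSet_Ioi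
    have := hc.measurable_piecewise (g := fun _ => 0) continuousOn_const hS
    convert this using 1
    funext p
    simp [piecewise, Function.uncurry, hχ']
  have hb' : ∀ c Y : ℝ, 0 < c → 0 < Y → ∃ M b : ℝ, 0 ≤ M ∧ b < 1 ∧ ∀ y ∈ Ioc 0 Y,
      (Integrable (fun x => χ' x y) ∧ ∫ x, ‖χ' x y‖ ≤ M * y ^ (-b)) ∧
      Integrable (fun κ => expWeight μ (psi α θ) c κ * ‖fourierT (fun x => χ' x y) κ‖) ∧
      ∫ κ, expWeight μ (psi α θ) c κ * ‖fourierT (fun x => χ' x y) κ‖ ≤ M * y ^ (-b) := by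
    intro c Y hc hY
    obtain ⟨M, b, hb1, h⟩ := hb c Y hc hY
    refine ⟨|M|, b, abs_nonneg M, hb1, fun y hy => ?_⟩
    obtain ⟨h1, h2, h3, h4⟩ := h y hy
    have hy0 := hy.1
    have hM : M * y ^ (-b) ≤ |M| * y ^ (-b) := by gcongr; exact le_abs_self M
    simp only [heq _ y hy.1]
    have h3' := h3.norm
    simp only [norm_weight_mul α θ μ] at h3' h4
    exact ⟨⟨h1, h2.trans hM⟩, h3', h4.trans hM⟩
  have hT : TameFamily χ' := by
    refine ⟨hm, fun Y hY => ?_⟩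
    obtain ⟨M, b, hM, hb, h⟩ := hb' 1 Y one_pos hY
    exact ⟨M, b, hM, hb, fun y hy => (h y hy).1⟩
  have hW : WeightedFamily μ (psi α θ) (fun κ y => fourierT (fun x => χ' x y) κ) := by
    refine ⟨measurable_fourierT_slices hm, fun c Y hc hY => ?_⟩
    obtain ⟨M, b, hM, hb, h⟩ := hb' c Y hc hY
    exact ⟨M, b, hM, hb, fun y hy => (h y hy).2⟩
  refine ⟨χ', hT, hW, fun x => (hcx x).congr fun y hy => heq x y hy, fun x y hy => ?_,
    fun x y hy => ?_⟩
  · exact invFourierT_fourierT (by rw [heqf y hy]; exact hcy y hy) (hT.integrable_slice hy)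
      (hW.tameFamily.integrable_slice hy) x
  · rw [hΦ x y hy]
    by_cases hδ : ν * (2 - μ) = 0
    · rw [hδ, rlIntegral_zero, rlIntegral_zero, heq x y hy]
    · rw [rlIntegral_eq_vconv hδ, rlIntegral_eq_vconv hδ]
      exact vconv_congr_on hy.le fun t ht => (heq x t ht).symm

/-- Riemann-Liouville integration of order `ν(2-μ)` of the source shifts the index of the kernel. -/
theorem termPhi_eq_vconv {α θ μ ν : ℝ} (hμ1 : 1 < μ) (hμ2 : μ ≤ 2) (hν0 : 0 ≤ ν)
    {Φ χ : ℝ → ℝ → ℂ} (hχ : TameFamily χ)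
    (hΦ : ∀ x y, 0 < y → Φ x y = rlIntegral (ν * (2 - μ)) (χ x) y) {y : ℝ} (hy : 0 < y) (κ : ℝ) :
    termPhi α θ μ Φ y κ = vconv (mlKernel μ (μ + ν * (2 - μ)) (psi α θ κ))
      (fun t => fourierT (fun x => χ x t) κ) y := by
  have hδ0 : 0 ≤ ν * (2 - μ) := mul_nonneg hν0 (by linarith)
  rw [termPhi_eq, vconv_congr_on hy.le (v := rlIntegral (ν * (2 - μ))
    (fun t => fourierT (fun x => χ x t) κ)) fun t ht => by
      rw [← hχ.fourierT_rlIntegral κ hδ0 ht]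
      congr 1; funext x; exact hΦ x t ht]
  rcases hδ0.eq_or_lt with h | h
  · rw [← h, rlIntegral_zero, add_zero]
  · rw [rlIntegral_eq_vconv h.ne', vconv_mlKernel_vconv_rlKernel hμ1.le (by linarith) h _ hy
      (integrableOn_rlKernel_mul (by linarith) (hχ.integrableOn_fourierT κ hy))]

/-- The exponential weights on the data absorb the Mittag-Leffler factors. -/
theorem formulaConverges_of_admissible {α θ μ ν : ℝ} (hμ1 : 1 < μ) (hμ2 : μ ≤ 2) (hν0 : 0 ≤ ν)
    {f g : ℝ → ℂ} {Φ : ℝ → ℝ → ℂ} (hf : Integrable f) (hg : Integrable g)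
    (h : AdmissibleData α μ ν f g Φ) {y : ℝ} (hy : 0 < y) :
    FormulaConverges α θ μ ν f g Φ y := by
  obtain ⟨χ, hT, hW, -, -, hΦ⟩ := h.exists_density θ
  have hω := measurable_psi α θ
  have hδ0 : 0 ≤ ν * (2 - μ) := mul_nonneg hν0 (by linarith)
  have hsum : (1 - ν) * (2 - μ) + ν * (2 - μ) = 2 - μ := by ring
  have hF := weightedData_fourierT (θ := θ) hf h.weight_f
  have hG := weightedData_fourierT (θ := θ) hg h.weight_g
  have undo : ∀ (r : ℝ) (T : ℝ → ℂ), Integrable (fun κ => ((y ^ r : ℝ) : ℂ) * T κ) →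
      Integrable T := fun r T hT => by
    have h0 : ((y ^ r : ℝ) : ℂ) ≠ 0 := by exact_mod_cast (Real.rpow_pos_of_pos hy r).ne'
    refine (hT.const_mul ((y ^ r : ℝ) : ℂ)⁻¹).congr (Eventually.of_forall fun κ => ?_)
    simp only
    rw [inv_mul_cancel_left₀ h0]
  refine ⟨undo (-((1 - ν) * (2 - μ))) _ ?_, undo (1 - (1 - ν) * (2 - μ)) _ ?_, ?_⟩
  · simp only [termF_eq]
    exact (hF.mlKernel_mul hμ1.le (by linarith) hω).tameFamily.integrable_slice hy
  · simp only [termG_eq]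
    exact (hG.mlKernel_mul hμ1.le (by linarith) hω).tameFamily.integrable_slice hy
  · refine ((hW.vconv_mlKernel (d := μ + ν * (2 - μ)) hμ1.le (by linarith)
      hω).tameFamily.integrable_slice hy).congr (Eventually.of_forall fun κ => ?_)
    exact (termPhi_eq_vconv hμ1 hμ2 hν0 hT hΦ hy κ).symm

/-- For admissible data the formula defines a solution. -/
theorem isSolution_of_formula {α θ μ ν : ℝ} (hμ1 : 1 < μ) (hμ2 : μ ≤ 2) (hν0 : 0 ≤ ν)
    (hν1 : ν ≤ 1) {f g : ℝ → ℂ} {Φ : ℝ → ℝ → ℂ} (hf : Integrable f) (hg : Integrable g)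
    (h : AdmissibleData α μ ν f g Φ) {N : ℝ → ℝ → ℂ}
    (hN : ∀ x y : ℝ, 0 < y → N x y = formulaPrabhakar α θ μ ν f g Φ x y) :
    IsSolution α θ μ ν f g Φ N := by
  obtain ⟨χ, hT, hW, hχc, hinv, hΦ⟩ := h.exists_density θ
  set δ := ν * (2 - μ) with hδ
  set γ := (1 - ν) * (2 - μ) with hγ
  have hδ0 : 0 ≤ δ := mul_nonneg hν0 (by linarith)
  have hγ0 : 0 ≤ γ := mul_nonneg (by linarith) (by linarith)
  have hsum : γ + δ = 2 - μ := by rw [hγ, hδ]; ring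
  have hceil := natCeil_eq_two hμ1 hμ2
  have hω := measurable_psi α θ
  set ω := psi α θ with hωdef
  have hF := weightedData_fourierT (θ := θ) hf h.weight_f
  have hG := weightedData_fourierT (θ := θ) hg h.weight_g
  rw [← hωdef] at hF hG
  set X : ℝ → ℝ → ℂ := fun κ y => fourierT (fun x => χ x y) κ with hX
  have hXi : ∀ κ Y, 0 < Y → IntegrableOn (X κ) (Ioc 0 Y) := fun κ Y hY =>
    hT.integrableOn_fourierT κ hY
  set S := spectralSum μ ω (fourierT f) (fourierT g) X with hS
  -- `n` is the transform of `N`, and `m` satisfies `n = I^δ m`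
  set n := S (1 - γ) (2 - γ) (μ + δ) with hn
  set m := S (μ - 1) μ μ with hm
  have hnW : WeightedFamily μ ω n := weightedFamily_spectralSum hμ1.le hω hF hG hW
    (by linarith) (by linarith) (by linarith)
  have hmW : WeightedFamily μ ω m := weightedFamily_spectralSum hμ1.le hω hF hG hW
    (by linarith) (by linarith) (by linarith)
  have hωn := hnW.symbol_mul hμ1.le hω
  have hωm := hmW.symbol_mul hμ1.le hω
  have hnD : LocDominated μ ω n := locDominated_spectralSum hμ1.le hω hF hG hW
    (by linarith) (by linarith) (by linarith)
  have hmD : LocDominated μ ω m := locDominated_spectralSum hμ1.le hω hF hG hW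
    (by linarith) (by linarith) (by linarith)
  have hNn : ∀ x y, 0 < y → N x y = invFourierT (fun κ => n κ y) x := by
    intro x y hy
    rw [hN x y hy, formulaPrabhakar_eq_invFourierT
      (formulaConverges_of_admissible hμ1 hμ2 hν0 hf hg h hy)]
    congr 1; funext κ
    rw [termF_eq, termG_eq, termPhi_eq_vconv hμ1 hμ2 hν0 hT hΦ hy]
    rfl
  -- the density of the second derivative
  set H : ℝ → ℝ → ℂ := fun x t => χ x t + invFourierT (fun κ => ω κ * m κ t) x with hH
  have hhW : WeightedFamily μ ω (fun κ t => X κ t + ω κ * m κ t) := hW.add hω hωm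
  have hHinv : ∀ x t, 0 < t → H x t = invFourierT (fun κ => X κ t + ω κ * m κ t) x := by
    intro x t ht
    rw [invFourierT_add (hW.tameFamily.integrable_slice ht) (hωm.tameFamily.integrable_slice ht),
      hinv x t ht]
  have hHc : ∀ x, ContinuousOn (H x) (Ioi 0) := by
    intro x
    refine (hχc x).add ?_
    exact ((hmD.symbol_mul hμ1.le).continuousOn_invFourierT hωm.measurable (fun κ =>
      continuousOn_const.mul (continuousOn_spectralSum hμ1.le (by linarith) (by linarith)
        (by linarith) (hXi κ)))).comp (f := fun t : ℝ => (x, t)) (by fun_prop)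
        fun t ht => ⟨mem_univ _, ht⟩
  have hHi : ∀ x Y, 0 < Y → IntegrableOn (H x) (Ioc 0 Y) := fun x Y hY =>
    (hhW.tameFamily.integrableOn_invFourierT x hY).congr_fun
      (fun t ht => (hHinv x t ht.1).symm) measurableSet_Ioc
  -- `I^γ N = f + y g + I² H`
  have hw : ∀ x y, 0 < y → rlIntegral γ (N x) y = f x + y * g x + vconv (rlKernel 2) (H x) y := by
    intro x y hy
    have e1 : rlIntegral γ (N x) y = invFourierT (fun κ => S 1 2 2 κ y) x := by
      rcases hγ0.eq_or_lt with h0 | h0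
      · rw [← h0, rlIntegral_zero, hNn x y hy, hn, ← h0, sub_zero, sub_zero,
          show μ + δ = 2 by linarith]
      · rw [rlIntegral_eq_vconv h0.ne', vconv_congr_on hy.le fun t ht => hNn x t ht,
          hnW.tameFamily.vconv_invFourierT x h0 hy]
        congr 1; funext κ
        rw [hn, hS, vconv_rlKernel_spectralSum hμ1.le (by linarith) (by linarith) (by linarith)
          hy h0 (hXi κ y hy), sub_add_cancel, sub_add_cancel, show μ + δ + γ = 2 by linarith]
    have hfy := hF.integrable_self
    have hgy := hG.integrable_self.const_mul (y : ℂ)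
    have hfgy : Integrable fun κ => fourierT f κ + y * fourierT g κ := hfy.add hgy
    have hh := (hhW.tameFamily.vconv_integral (σ := 2) two_pos hy (E := fun _ => 1)
      continuous_const (fun _ => by simp)).2.1
    have e2 : (fun κ => S 1 2 2 κ y) = fun κ => (fourierT f κ + y * fourierT g κ) +
        vconv (rlKernel 2) (fun t => X κ t + ω κ * m κ t) y :=
      funext fun κ => spectralSum_one_two hμ1 hy (hXi κ y hy)
    rw [e1, e2, invFourierT_add hfgy hh, invFourierT_add hfy hgy, invFourierT_const_mul,
      invFourierT_fourierT h.continuous_f hf hfy,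
      invFourierT_fourierT h.continuous_g hg hG.integrable_self,
      ← hhW.tameFamily.vconv_invFourierT x two_pos hy,
      vconv_congr_on hy.le fun t ht => (hHinv x t ht).symm]
  have hspec := fun x => second_primitive_spec (hHc x) (hHi x) (hw x)
  -- `I^δ H = Φ + ℱ⁻¹[ψ n]`
  have hIH : ∀ x y, 0 < y → rlIntegral δ (H x) y = Φ x y + invFourierT (fun κ => ω κ * n κ y) x := by
    intro x y hy
    rcases hδ0.eq_or_lt with h0 | h0
    · rw [hΦ x y hy, ← h0, rlIntegral_zero, rlIntegral_zero, hn, ← h0, add_zero,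
        show 1 - γ = μ - 1 by linarith, show 2 - γ = μ by linarith]
    · have i1 := hW.tameFamily.integrableOn_rlKernel_mul_invFourierT x h0 hy
      have i2 := hωm.tameFamily.integrableOn_rlKernel_mul_invFourierT x h0 hy
      have i1' : IntegrableOn (fun t => rlKernel δ (y - t) * χ x t) (Ioc 0 y) :=
        i1.congr_fun (fun t ht => by simp only; rw [hinv x t ht.1]) measurableSet_Ioc
      rw [hΦ x y hy, rlIntegral_eq_vconv h0.ne', rlIntegral_eq_vconv h0.ne',
        vconv_add hy.le i1' i2, hωm.tameFamily.vconv_invFourierT x h0 hy]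
      congr 2; funext κ
      rw [vconv_const_mul, hm, hS, vconv_rlKernel_spectralSum hμ1.le (by linarith) (by linarith)
        hμ1.le hy h0 (hXi κ y hy), hn, hS, show μ - 1 + δ = 1 - γ by linarith,
        show 2 - γ = μ + δ by linarith]
  refine ⟨?_, ?_, ?_, ?_, ?_, ?_, ?_⟩
  · refine (hnD.continuousOn_invFourierT hnW.measurable (fun κ =>
      continuousOn_spectralSum hμ1.le (by linarith) (by linarith) (by linarith) (hXi κ))).congr ?_
    exact fun p hp => hNn p.1 p.2 hp.2
  · intro x y hy
    simp only [hceil, Nat.cast_ofNat, iteratedDeriv_two_eq]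
    obtain ⟨s1, s2, s3, -, -⟩ := hspec x
    have conv : ∀ (σ : ℝ) (u : ℝ → ℂ), 0 ≤ σ →
        (0 < σ → IntegrableOn (fun t => rlKernel σ (y - t) * u t) (Ioc 0 y)) →
        RLConverges σ u y := by
      intro σ u hσ hi
      rcases hσ.eq_or_lt with h0 | h0
      · exact Or.inl h0.symm
      · refine Or.inr ((intervalIntegrable_iff_integrableOn_Ioc_of_le hy.le).2 ?_)
        have g1 : (Real.Gamma σ : ℂ) ≠ 0 := by exact_mod_cast (Real.Gamma_pos_of_pos h0).ne'
        refine ((hi h0).const_mul (Real.Gamma σ : ℂ)).congr (Eventually.of_forall fun t => ?_)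
        simp only [rlKernel]
        push_cast
        field_simp
    refine ⟨conv γ _ hγ0 fun h0 => ?_, fun k hk => ?_, conv δ _ hδ0 fun h0 => ?_⟩
    · refine (hnW.tameFamily.integrableOn_rlKernel_mul_invFourierT x h0 hy).congr_fun
        (fun t ht => ?_) measurableSet_Ioc
      simp only [hNn x t ht.1]
    · interval_cases k
      · simpa using s1 y hy
      · simpa using s2 y hy
    · refine (hhW.tameFamily.integrableOn_rlKernel_mul_invFourierT x h0 hy).congr_fun
        (fun t ht => ?_) measurableSet_Ioc
      simp only
      rw [s3 t ht.1, hHinv x t ht.1]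
  · refine ⟨fun x y => invFourierT (fun κ => -ω κ * n κ y) x, ⟨n, ?_, ?_⟩, fun x y hy => ?_⟩
    · exact hnW.tameFamily.isPartialFourierTransform hNn
    · have : WeightedFamily μ ω (fun κ y => -ω κ * n κ y) := by
        refine ⟨?_, ?_⟩
        · have e : (Function.uncurry fun κ y => -ω κ * n κ y) =
              -Function.uncurry fun κ y => ω κ * n κ y := by
            funext p; simp [Function.uncurry]
          rw [e]; exact hωn.measurable.neg
        simpa only [neg_mul, norm_neg] using hωn.bound
      exact this.tameFamily.isPartialFourierTransform fun x y _ => rfl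
    · simp only [hilferDeriv, hceil, Nat.cast_ofNat, iteratedDeriv_two_eq]
      have e : rlIntegral δ (deriv (deriv (rlIntegral γ (N x)))) y = rlIntegral δ (H x) y := by
        rcases hδ0.eq_or_lt with h0 | h0
        · rw [← h0, rlIntegral_zero, rlIntegral_zero, (hspec x).2.2.1 y hy]
        · rw [rlIntegral_eq_vconv h0.ne', rlIntegral_eq_vconv h0.ne']
          exact vconv_congr_on hy.le fun t ht => (hspec x).2.2.1 t ht
      have e2 : invFourierT (fun κ => -ω κ * n κ y) x = -invFourierT (fun κ => ω κ * n κ y) x := by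
        rw [← neg_one_mul (invFourierT _ x), ← invFourierT_const_mul]
        congr 1; funext κ; ring
      rw [e, hIH x y hy, e2]
      ring
  · exact fun x => (hspec x).2.2.2.1
  · exact fun x => (hspec x).2.2.2.2
  · intro y hy
    simp only [hNn _ y hy]
    exact (tendsto_invFourierT_cocompact _).mono_left atTop_le_cocompact
  · intro y hy
    simp only [hNn _ y hy]
    exact (tendsto_invFourierT_cocompact _).mono_left atBot_le_cocompact

end FracPoisson

theorem theorem1 (α θ μ ν : ℝ) (hα1 : 1 < α) (hα2 : α ≤ 2) (hθ : |θ| ≤ min α (2 - α))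
    (hμ1 : 1 < μ) (hμ2 : μ ≤ 2) (hν0 : 0 ≤ ν) (hν1 : ν ≤ 1)
    (f g : ℝ → ℂ) (Φ : ℝ → ℝ → ℂ) (hf : Integrable f) (hg : Integrable g)
    (hΦ : ∀ Y : ℝ, 0 < Y →
      IntegrableOn (fun p : ℝ × ℝ => Φ p.1 p.2) (univ ×ˢ Ioc 0 Y)) :
    (∀ N : ℝ → ℝ → ℂ, FracPoisson.IsSolution α θ μ ν f g Φ N → ∀ y : ℝ, 0 < y →
      FracPoisson.IsFourierTransform (fun x => N x y)
        (fun κ =>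
          ((y ^ (-((1 - ν) * (2 - μ))) : ℝ) : ℂ) * FracPoisson.termF α θ μ ν f y κ +
          ((y ^ (1 - (1 - ν) * (2 - μ)) : ℝ) : ℂ) * FracPoisson.termG α θ μ ν g y κ +
          FracPoisson.termPhi α θ μ Φ y κ) ∧
      (FracPoisson.FormulaConverges α θ μ ν f g Φ y → ∀ x : ℝ,
        N x y = FracPoisson.formula α θ μ ν f g Φ x y ∧
        N x y = FracPoisson.formulaPrabhakar α θ μ ν f g Φ x y)) ∧
    (FracPoisson.AdmissibleData α μ ν f g Φ →
      (∀ y : ℝ, 0 < y → FracPoisson.FormulaConverges α θ μ ν f g Φ y) ∧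
      (∀ x y : ℝ, 0 < y → FracPoisson.formula α θ μ ν f g Φ x y =
        FracPoisson.formulaPrabhakar α θ μ ν f g Φ x y) ∧
      ∀ N : ℝ → ℝ → ℂ, FracPoisson.IsSolution α θ μ ν f g Φ N ↔
        ∀ x y : ℝ, 0 < y → N x y = FracPoisson.formula α θ μ ν f g Φ x y) := by
  refine ⟨fun N hN y hy => ⟨?_, fun hc x => ?_⟩, fun h => ⟨fun y hy => ?_, fun x y _ => ?_,
    fun N => ⟨fun hN x y hy => ?_, fun hN => ?_⟩⟩⟩
  · exact FracPoisson.isFourierTransform_of_isSolution hμ1 hμ2 hν0 hν1 hf hg hΦ hN hy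
  · have := FracPoisson.eq_formulaPrabhakar_of_isSolution hμ1 hμ2 hν0 hν1 hf hg hΦ hN hy hc x
    exact ⟨this.trans (FracPoisson.formula_eq_formulaPrabhakar α θ μ ν f g Φ x y).symm, this⟩
  · exact FracPoisson.formulaConverges_of_admissible hμ1 hμ2 hν0 hf hg h hy
  · exact FracPoisson.formula_eq_formulaPrabhakar α θ μ ν f g Φ x y
  · rw [FracPoisson.formula_eq_formulaPrabhakar]
    exact FracPoisson.eq_formulaPrabhakar_of_isSolution hμ1 hμ2 hν0 hν1 hf hg hΦ hN hy
      (FracPoisson.formulaConverges_of_admissible hμ1 hμ2 hν0 hf hg h hy) x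
  · refine FracPoisson.isSolution_of_formula hμ1 hμ2 hν0 hν1 hf hg h fun x y hy => ?_
    rw [hN x y hy, FracPoisson.formula_eq_formulaPrabhakar]
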